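/- All graphs $G=(V,E)$ are finite, simple and connected; $n=|V|$, $m=|E|$, and $\Delta$ is the maximum degree. A set $F\subseteq E$ is a connected edge dominating set if the subgraph $G[F]$ formed by the edges of $F$ and their endpoints is connected and every edge of $G$ shares an endpoint with an edge of $F$; it is minimal if $F\setminus\{f\}$ is not a connected edge dominating set for any $f\in F$. Only graphs are considered in which every connected edge dominating set has at least two edges. Algorithms are programs of a uniform-cost random access machine over the natural numbers with addition and truncated subtraction; a graph is given as a list of its edges. There is an absolute constant $C$ such that the following holds. (1) Let $c\in\mathbb R$ and $f:\mathbb N^2\to\mathbb N$, and suppose that there is an algorithm which, for every such graph $G$, computes in time at most $f(n,m)$ a connected edge dominating set of cardinality at most $c$ times the minimum cardinality of a connected edge dominating set of $G$. Then there is an algorithm which, given such a graph $G$ and a number $k\in\mathbb N$, outputs $k$ pairwise distinct minimal connected edge dominating sets of $G$ (all of them, if $G$ has fewer than $k$), such that - $|S|\le (c+2)\,|S'|$ for every output $S$ and every minimal connected edge dominating set $S'$ of $G$ that is not output; - after a preprocessing time of $f(n,m)$ the delay is at most $C\,n m^2\Delta$: the first output occurs by time $f(n,m)+C\,nm^2\Delta$,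 the time between two consecutive outputs is at most $C\,nm^2\Delta$, and the algorithm halts at most $C\,nm^2\Delta$ steps after the last output (by time $f(n,m)+C\,nm^2\Delta$ if there is no output). (2) There is an algorithm with the same properties for the approximation ratio $4$ in place of $c+2$ and with a preprocessing time that is polynomial in $n+m$ in place of $f(n,m)$. -/

import Mathlib

/-! ## Connected edge dominating sets -/

/-- `F` is a connected edge dominating set of `G`: a set of edges of `G` such that the edge induced
subgraph `G[F]` is connected (any two vertices covered by `F` are joined by a walk all of whose
edges lie in `F`) and every edge of `G` shares an endpoint with an edge in `F`. -/
structure IsConnectedEDS {V : Type*} (G : SimpleGraph V) (F : Finset (Sym2 V)) : Prop where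
  subset : (F : Set (Sym2 V)) ⊆ G.edgeSet
  connected : ∀ u v : V, (∃ e ∈ F, u ∈ e) → (∃ e ∈ F, v ∈ e) →
    (SimpleGraph.fromEdgeSet (F : Set (Sym2 V))).Reachable u v
  dominating : ∀ e ∈ G.edgeSet, ∃ f ∈ F, ∃ v, v ∈ e ∧ v ∈ f

/-- A minimal connected edge dominating set: no single edge can be removed. -/
def IsMinimalConnectedEDS {V : Type*} [DecidableEq V] (G : SimpleGraph V)
    (F : Finset (Sym2 V)) : Prop :=
  IsConnectedEDS G F ∧ ∀ f ∈ F, ¬ IsConnectedEDS G (F.erase f)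

/-! ## Graphs as inputs of a machine -/

/-- A finite simple graph, presented as a list of edges: the vertices are `0, …, n - 1`, and the
edges are numbered `0, …, m - 1` in an arbitrary order, edge `i` joining `src i` and `dst i`. -/
structure GraphInput where
  n : ℕ
  m : ℕ
  src : Fin m → Fin n
  dst : Fin m → Fin n
  src_ne_dst : ∀ i, src i ≠ dst i
  edge_injective : Function.Injective fun i => s(src i, dst i)

namespace GraphInput

def edge (G : GraphInput) (i : Fin G.m) : Sym2 (Fin G.n) := s(G.src i, G.dst i)

/-- The graph that is presented. -/
def graph (G : GraphInput) : SimpleGraph (Fin G.n) :=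
  SimpleGraph.fromEdgeSet (Set.range G.edge)

open Classical in
/-- The maximum degree `Δ`. -/
noncomputable def maxDeg (G : GraphInput) : ℕ := G.graph.maxDegree

/-- The input words of a machine: `n, m, src 0, dst 0, src 1, dst 1, …`, followed by zeros. -/
def word (G : GraphInput) : ℕ → ℕ
  | 0 => G.n
  | 1 => G.m
  | j + 2 =>
    if h : j / 2 < G.m then
      if j % 2 = 0 then (G.src ⟨j / 2, h⟩ : ℕ) else (G.dst ⟨j / 2, h⟩ : ℕ)
    else 0

open Classical in
/-- The set of edges of `G` whose numbers lie in `I`. -/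
noncomputable def edgesAt (G : GraphInput) (I : Set ℕ) : Finset (Sym2 (Fin G.n)) :=
  (Finset.univ.filter fun i : Fin G.m => (i : ℕ) ∈ I).image G.edge

/-- The graph is connected, and each of its connected edge dominating sets has at least two
edges. -/
def Admissible (G : GraphInput) : Prop :=
  G.graph.Connected ∧ ∀ F, IsConnectedEDS G.graph F → 2 ≤ F.card

/-- The set of all minimal connected edge dominating sets. -/
def solutions (G : GraphInput) : Set (Finset (Sym2 (Fin G.n))) :=
  {F | IsMinimalConnectedEDS G.graph F}

end GraphInput

/-! ## A random access machine

Uniform-cost random access machine over the natural numbers with addition and truncated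
subtraction (no multiplication or bit operations), programmed in a structured language. A program
mentions finitely many registers and finitely many infinite arrays, all of them zero initially. The
input is read-only. Evaluating an expression costs one step for each of its nodes, and each
elementary command and each test costs one step in addition. -/

namespace RAM

/-- What a machine reads: the words of the input, and one numerical parameter. -/
structure Input where
  word : ℕ → ℕ
  param : ℕ

inductive Exp where
  | const (c : ℕ)
  | reg (x : ℕ)
  | arr (a : ℕ) (e : Exp)
  | inp (e : Exp)
  | param
  | add (e₁ e₂ : Exp)
  | sub (e₁ e₂ : Exp)

inductive Cmd where
  | skip
  | assign (x : ℕ) (e : Exp)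
  | store (a : ℕ) (e₁ e₂ : Exp)
  | print (e : Exp)
  | emit
  | seq (c₁ c₂ : Cmd)
  | ite (e : Exp) (c₁ c₂ : Cmd)
  | while (e : Exp) (c : Cmd)

/-- Configuration of the machine. `line` lists the numbers printed since the last `emit`, and `out`
lists in chronological order the lines that were completed by `emit`, each with the time at which
this happened. -/
structure State where
  reg : ℕ → ℕ
  arr : ℕ → ℕ → ℕ
  time : ℕ
  line : List ℕ
  out : List (ℕ × List ℕ)

def State.init : State where
  reg := fun _ => 0
  arr := fun _ _ => 0
  time := 0
  line := []
  out := []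

/-- Let `t` steps pass. -/
def State.tick (s : State) (t : ℕ) : State := { s with time := s.time + t }

def Exp.eval (I : Input) (s : State) : Exp → ℕ
  | .const c => c
  | .reg x => s.reg x
  | .arr a e => s.arr a (e.eval I s)
  | .inp e => I.word (e.eval I s)
  | .param => I.param
  | .add e₁ e₂ => e₁.eval I s + e₂.eval I s
  | .sub e₁ e₂ => e₁.eval I s - e₂.eval I s

/-- Number of steps for the evaluation of an expression. -/
def Exp.cost : Exp → ℕ
  | .const _ => 1
  | .reg _ => 1
  | .arr _ e => e.cost + 1
  | .inp e => e.cost + 1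
  | .param => 1
  | .add e₁ e₂ => e₁.cost + e₂.cost + 1
  | .sub e₁ e₂ => e₁.cost + e₂.cost + 1

/-- `Exec I c s s'`: on input `I`, the program `c` started in `s` halts in `s'`. -/
inductive Exec (I : Input) : Cmd → State → State → Prop where
  | skip (s) : Exec I .skip s (s.tick 1)
  | assign (s x e) : Exec I (.assign x e) s
      { s.tick (e.cost + 1) with reg := Function.update s.reg x (e.eval I s) }
  | store (s a e₁ e₂) : Exec I (.store a e₁ e₂) s
      { s.tick (e₁.cost + e₂.cost + 1) with
        arr := Function.update s.arr a
          (Function.update (s.arr a) (e₁.eval I s) (e₂.eval I s)) }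
  | print (s e) : Exec I (.print e) s
      { s.tick (e.cost + 1) with line := s.line ++ [e.eval I s] }
  | emit (s) : Exec I .emit s
      { s.tick 1 with line := [], out := s.out ++ [(s.time + 1, s.line)] }
  | seq {c₁ c₂ s s' s''} : Exec I c₁ s s' → Exec I c₂ s' s'' → Exec I (.seq c₁ c₂) s s''
  | ite_true {e c₁ c₂ s s'} : e.eval I s ≠ 0 → Exec I c₁ (s.tick (e.cost + 1)) s' →
      Exec I (.ite e c₁ c₂) s s'
  | ite_false {e c₁ c₂ s s'} : e.eval I s = 0 → Exec I c₂ (s.tick (e.cost + 1)) s' →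
      Exec I (.ite e c₁ c₂) s s'
  | while_true {e c s s' s''} : e.eval I s ≠ 0 → Exec I c (s.tick (e.cost + 1)) s' →
      Exec I (.while e c) s' s'' → Exec I (.while e c) s s''
  | while_false {e c s} : e.eval I s = 0 → Exec I (.while e c) s (s.tick (e.cost + 1))

end RAM

/-! ## Approximation and enumeration algorithms -/

/-- `A` is an `f(n, m)`-time `c`-approximation algorithm for a minimum connected edge dominating
set. The result is returned in array `0`, as the nonzero positions `i < m` of that array. (The
parameter of the machine is not used and set to `0`.) -/
def IsApproximationAlgorithm (A : RAM.Cmd) (c : ℝ) (f : ℕ → ℕ → ℕ) : Prop :=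
  ∀ G : GraphInput, G.Admissible →
    ∃ s : RAM.State, RAM.Exec ⟨G.word, 0⟩ A RAM.State.init s ∧
      s.time ≤ f G.n G.m ∧
      IsConnectedEDS G.graph (G.edgesAt {i | s.arr 0 i ≠ 0}) ∧
      ∀ F, IsConnectedEDS G.graph F →
        ((G.edgesAt {i | s.arr 0 i ≠ 0}).card : ℝ) ≤ c * F.card

/-- The sets of edges output in a run that ended in `s`, in chronological order. -/
noncomputable def outputs (G : GraphInput) (s : RAM.State) : List (Finset (Sym2 (Fin G.n))) :=
  s.out.map fun p => G.edgesAt {i | i ∈ p.2}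

/-- After preprocessing time `p`, the run that ended in `s` has delay at most `D`: the first output
occurs by time `p + D`, consecutive outputs are at most `D` steps apart, and the machine halts at
most `D` steps after the last output (by time `p + D` if there is no output). -/
def HasDelay (s : RAM.State) (p D : ℕ) : Prop :=
  List.IsChain (fun t t' => t' ≤ t + D) (p :: (s.out.map Prod.fst ++ [s.time]))

/-- `B` is a `k`-best enumeration algorithm for minimal connected edge dominating sets with
approximation ratio `r`, with preprocessing time `f(n, m)` and delay at most `C n m² Δ`. Given a
graph and a number `k`, it outputs `k` distinct minimal connected edge dominating sets (all of them
if there are fewer than `k`), each as a list of edge numbers without repetition, such that each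
output is at most `r` times as large as any minimal connected edge dominating set that is not
output. -/
def IsKBestEnumeration (B : RAM.Cmd) (r : ℝ) (f : ℕ → ℕ → ℕ) (C : ℕ) : Prop :=
  ∀ G : GraphInput, G.Admissible → ∀ k : ℕ,
    ∃ s : RAM.State, RAM.Exec ⟨G.word, k⟩ B RAM.State.init s ∧
      s.line = [] ∧
      (∀ p ∈ s.out, p.2.Nodup ∧ ∀ i ∈ p.2, i < G.m) ∧
      (∀ S ∈ outputs G s, S ∈ G.solutions) ∧
      (outputs G s).Nodup ∧
      (outputs G s).length = min k G.solutions.ncard ∧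
      (∀ S ∈ outputs G s, ∀ S' ∈ G.solutions, S' ∉ outputs G s →
        (S.card : ℝ) ≤ r * S'.card) ∧
      HasDelay s (f G.n G.m) (C * (G.n * G.m ^ 2 * G.maxDeg))

/-! ## A program logic for the machine -/

namespace RAM

/-- Registers. -/
abbrev Regs := ℕ → ℕ
/-- Arrays. -/
abbrev Arrs := ℕ → ℕ → ℕ

/-- Value of an expression in terms of the memory alone. -/
def Exp.ev (I : Input) (ρ : Regs) (α : Arrs) : Exp → ℕ
  | .const c => c
  | .reg x => ρ x
  | .arr a e => α a (e.ev I ρ α)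
  | .inp e => I.word (e.ev I ρ α)
  | .param => I.param
  | .add e₁ e₂ => e₁.ev I ρ α + e₂.ev I ρ α
  | .sub e₁ e₂ => e₁.ev I ρ α - e₂.ev I ρ α

theorem Exp.eval_eq_ev (I : Input) (s : State) (e : Exp) : e.eval I s = e.ev I s.reg s.arr := by
  induction e <;> simp_all [Exp.eval, Exp.ev]

/-- May the program write register `x`? -/
def Cmd.wr (x : ℕ) : Cmd → Bool
  | .assign y _ => x == y
  | .seq c₁ c₂ => c₁.wr x || c₂.wr x
  | .ite _ c₁ c₂ => c₁.wr x || c₂.wr x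
  | .while _ c => c.wr x
  | _ => false

/-- May the program write array `a`? -/
def Cmd.wa (a : ℕ) : Cmd → Bool
  | .store b _ _ => a == b
  | .seq c₁ c₂ => c₁.wa a || c₂.wa a
  | .ite _ c₁ c₂ => c₁.wa a || c₂.wa a
  | .while _ c => c.wa a
  | _ => false

theorem Exec.reg_eq {I : Input} {c : Cmd} {s s' : State} (h : Exec I c s s') (x : ℕ)
    (hx : c.wr x = false) : s'.reg x = s.reg x := by
  induction h with
  | assign s y e =>
    have : x ≠ y := by simpa [Cmd.wr] using hx
    simp [Function.update_of_ne this]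
  | seq _ _ ih₁ ih₂ => simp_all [Cmd.wr]
  | ite_true _ _ ih => simp_all [Cmd.wr, State.tick]
  | ite_false _ _ ih => simp_all [Cmd.wr, State.tick]
  | while_true _ _ _ ih₁ ih₂ => simp_all [Cmd.wr, State.tick]
  | _ => simp [State.tick]

theorem Exec.arr_eq {I : Input} {c : Cmd} {s s' : State} (h : Exec I c s s') (a : ℕ)
    (ha : c.wa a = false) : s'.arr a = s.arr a := by
  induction h with
  | store s y e =>
    have : a ≠ y := by simpa [Cmd.wa] using ha
    simp [Function.update_of_ne this]
  | seq _ _ ih₁ ih₂ => simp_all [Cmd.wa]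
  | ite_true _ _ ih => simp_all [Cmd.wa, State.tick]
  | ite_false _ _ ih => simp_all [Cmd.wa, State.tick]
  | while_true _ _ _ ih₁ ih₂ => simp_all [Cmd.wa, State.tick]
  | _ => simp [State.tick]

/-- The program `c`, started with memory `ρ`, `α`, halts without printing or emitting anything, and
its running time and final memory satisfy `Q`. -/
def Run (I : Input) (c : Cmd) (ρ : Regs) (α : Arrs) (Q : ℕ → Regs → Arrs → Prop) : Prop :=
  ∃ t ρ' α', Q t ρ' α' ∧ ∀ τ l o, Exec I c ⟨ρ, α, τ, l, o⟩ ⟨ρ', α', τ + t, l, o⟩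

/-- The memory `ρ'`, `α'` agrees with `ρ`, `α` except for what `c` may write. -/
def Frame (c : Cmd) (ρ : Regs) (α : Arrs) (ρ' : Regs) (α' : Arrs) : Prop :=
  (∀ x, c.wr x = false → ρ' x = ρ x) ∧ ∀ a, c.wa a = false → α' a = α a

theorem Frame.reg {c ρ α ρ' α'} (h : Frame c ρ α ρ' α') (x : ℕ) (hx : c.wr x = false := by rfl) :
    ρ' x = ρ x := h.1 x hx

theorem Frame.arr {c ρ α ρ' α'} (h : Frame c ρ α ρ' α') (a : ℕ) (ha : c.wa a = false := by rfl) :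
    α' a = α a := h.2 a ha

variable {I : Input} {ρ : Regs} {α : Arrs}

theorem Run.frame {c : Cmd} {Q : ℕ → Regs → Arrs → Prop} (h : Run I c ρ α Q) :
    Run I c ρ α fun t ρ' α' => Q t ρ' α' ∧ Frame c ρ α ρ' α' := by
  obtain ⟨t, ρ', α', hQ, hE⟩ := h
  exact ⟨t, ρ', α', ⟨hQ, fun x hx => (hE 0 [] []).reg_eq x hx,
    fun a ha => (hE 0 [] []).arr_eq a ha⟩, hE⟩

theorem Run.imp {c : Cmd} {Q Q' : ℕ → Regs → Arrs → Prop} (h : Run I c ρ α Q)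
    (hQ : ∀ t ρ' α', Frame c ρ α ρ' α' → Q t ρ' α' → Q' t ρ' α') : Run I c ρ α Q' := by
  obtain ⟨t, ρ', α', ⟨hq, hf⟩, hE⟩ := h.frame
  exact ⟨t, ρ', α', hQ _ _ _ hf hq, hE⟩

theorem Run.seq {c₁ c₂ : Cmd} {Q₁ Q : ℕ → Regs → Arrs → Prop} (h₁ : Run I c₁ ρ α Q₁)
    (h₂ : ∀ t ρ' α', Frame c₁ ρ α ρ' α' → Q₁ t ρ' α' →
      Run I c₂ ρ' α' fun t' => Q (t + t')) : Run I (.seq c₁ c₂) ρ α Q := by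
  obtain ⟨t, ρ', α', ⟨hq, hf⟩, hE⟩ := h₁.frame
  obtain ⟨t', ρ'', α'', hq', hE'⟩ := h₂ _ _ _ hf hq
  refine ⟨t + t', ρ'', α'', hq', fun τ l o => (hE τ l o).seq ?_⟩
  simpa [add_assoc] using hE' (τ + t) l o

theorem Run.ite {e : Exp} {c₁ c₂ : Cmd} {Q : ℕ → Regs → Arrs → Prop}
    (h₁ : e.ev I ρ α ≠ 0 → Run I c₁ ρ α fun t => Q (e.cost + 1 + t))
    (h₂ : e.ev I ρ α = 0 → Run I c₂ ρ α fun t => Q (e.cost + 1 + t)) :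
    Run I (.ite e c₁ c₂) ρ α Q := by
  by_cases h : e.ev I ρ α = 0
  · obtain ⟨t, ρ', α', hq, hE⟩ := h₂ h
    refine ⟨_, ρ', α', hq, fun τ l o => .ite_false (by simpa [Exp.eval_eq_ev] using h) ?_⟩
    simpa [add_assoc, State.tick] using hE (τ + (e.cost + 1)) l o
  · obtain ⟨t, ρ', α', hq, hE⟩ := h₁ h
    refine ⟨_, ρ', α', hq, fun τ l o => .ite_true (by simpa [Exp.eval_eq_ev] using h) ?_⟩
    simpa [add_assoc, State.tick] using hE (τ + (e.cost + 1)) l o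

/-- Weakest precondition of a program without loops and output. -/
def wp (I : Input) : Cmd → (ℕ → Regs → Arrs → Prop) → Regs → Arrs → Prop
  | .skip, Q, ρ, α => Q 1 ρ α
  | .assign x e, Q, ρ, α => Q (e.cost + 1) (Function.update ρ x (e.ev I ρ α)) α
  | .store a e₁ e₂, Q, ρ, α => Q (e₁.cost + e₂.cost + 1) ρ
      (Function.update α a (Function.update (α a) (e₁.ev I ρ α) (e₂.ev I ρ α)))
  | .seq c₁ c₂, Q, ρ, α => wp I c₁ (fun t ρ' α' => wp I c₂ (fun t' => Q (t + t')) ρ' α') ρ α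
  | .ite e c₁ c₂, Q, ρ, α => (e.ev I ρ α ≠ 0 → wp I c₁ (fun t => Q (e.cost + 1 + t)) ρ α) ∧
      (e.ev I ρ α = 0 → wp I c₂ (fun t => Q (e.cost + 1 + t)) ρ α)
  | _, _, _, _ => False

theorem Run.of_wp {c : Cmd} {Q : ℕ → Regs → Arrs → Prop} (h : wp I c Q ρ α) : Run I c ρ α Q := by
  induction c generalizing Q ρ α with
  | skip => exact ⟨_, _, _, h, fun τ l o => .skip _⟩
  | assign x e =>
    refine ⟨_, _, _, h, fun τ l o => ?_⟩
    have := Exec.assign (I := I) ⟨ρ, α, τ, l, o⟩ x e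
    simpa [Exp.eval_eq_ev, State.tick] using this
  | store a e₁ e₂ =>
    refine ⟨_, _, _, h, fun τ l o => ?_⟩
    have := Exec.store (I := I) ⟨ρ, α, τ, l, o⟩ a e₁ e₂
    simpa [Exp.eval_eq_ev, State.tick] using this
  | seq c₁ c₂ ih₁ ih₂ => exact (ih₁ h).seq fun t ρ' α' _ hq => ih₂ hq
  | ite e c₁ c₂ ih₁ ih₂ => exact Run.ite (fun he => ih₁ (h.1 he)) fun he => ih₂ (h.2 he)
  | _ => exact h.elim

/-- A sequence of commands. -/
def block : List Cmd → Cmd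
  | [] => .skip
  | c :: cs => .seq c (block cs)

theorem Run.nil {Q : ℕ → Regs → Arrs → Prop} (h : Q 1 ρ α) : Run I (block []) ρ α Q :=
  Run.of_wp h

theorem Run.cons {c : Cmd} {cs : List Cmd} {Q₁ Q : ℕ → Regs → Arrs → Prop} (h₁ : Run I c ρ α Q₁)
    (h₂ : ∀ t ρ' α', Frame c ρ α ρ' α' → Q₁ t ρ' α' →
      Run I (block cs) ρ' α' fun t' => Q (t + t')) : Run I (block (c :: cs)) ρ α Q :=
  Run.seq h₁ h₂

/-- Execute `body` for `x = lo, …, hi - 1`. -/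
def loop (x : ℕ) (lo hi : Exp) (body : Cmd) : Cmd :=
  .seq (.assign x lo) (.while (.sub hi (.reg x))
    (.seq body (.assign x (.add (.reg x) (.const 1)))))

theorem Run.loop {x : ℕ} {lo hi : Exp} {body : Cmd} {Q : ℕ → Regs → Arrs → Prop}
    (Inv : ℕ → ℕ → Regs → Arrs → Prop) {L B : ℕ} (hL : lo.ev I ρ α = L) (hLB : L ≤ B)
    (h0 : Inv L 0 (Function.update ρ x L) α)
    (hx : body.wr x = false)
    (hhi : ∀ i ρ' α', Frame (loop x lo hi body) ρ α ρ' α' → ρ' x = i → L ≤ i → i ≤ B →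
      hi.ev I ρ' α' = B)
    (hstep : ∀ i t ρ' α', L ≤ i → i < B → ρ' x = i → Frame (loop x lo hi body) ρ α ρ' α' →
      Inv i t ρ' α' → Run I body ρ' α' fun t' ρ'' α'' =>
        Inv (i + 1) (t + t' + hi.cost + 7) (Function.update ρ'' x (i + 1)) α'')
    (hQ : ∀ t ρ' α', Frame (loop x lo hi body) ρ α ρ' α' → ρ' x = B → Inv B t ρ' α' →
      Q (t + hi.cost + lo.cost + 4) ρ' α') :
    Run I (loop x lo hi body) ρ α Q := by
  have key : ∀ k i t ρ' α', i + k = B → L ≤ i → ρ' x = i →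
      Frame (RAM.loop x lo hi body) ρ α ρ' α' → Inv i t ρ' α' →
      Run I (.while (.sub hi (.reg x)) (.seq body (.assign x (.add (.reg x) (.const 1))))) ρ' α'
        fun t' ρ'' α'' => Q (t + t' + lo.cost + 1) ρ'' α'' := by
    intro k
    induction k with
    | zero =>
      intro i t ρ' α' hk hi' hx' hF hI
      obtain rfl : i = B := by omega
      refine ⟨hi.cost + 3, ρ', α', ?_, fun τ l o => ?_⟩
      · convert hQ _ _ _ hF hx' hI using 1; ring
      · have h1 := hhi i ρ' α' hF hx' hi' le_rfl
        have := Exec.while_false (I := I) (e := .sub hi (.reg x))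
          (c := .seq body (.assign x (.add (.reg x) (.const 1)))) (s := ⟨ρ', α', τ, l, o⟩)
          (by simp [Exp.eval, Exp.eval_eq_ev, hx', h1])
        simpa [State.tick, Exp.cost] using this
    | succ k ih =>
      intro i t ρ' α' hk hi' hx' hF hI
      obtain ⟨t', ρ'', α'', ⟨hI', hF'⟩, hE⟩ := (hstep i t ρ' α' hi' (by omega) hx' hF hI).frame
      have hF'' : Frame (RAM.loop x lo hi body) ρ α (Function.update ρ'' x (i + 1)) α'' := by
        constructor
        · intro y hy
          have hy' : y ≠ x ∧ body.wr y = false := by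
            simp only [RAM.loop, Cmd.wr, beq_eq_false_iff_ne, Bool.or_eq_false_iff] at hy; tauto
          rw [Function.update_of_ne hy'.1, hF'.1 y hy'.2, hF.1 y hy]
        · intro a ha
          have ha' : body.wa a = false := by simpa [RAM.loop, Cmd.wa] using ha
          rw [hF'.2 a ha', hF.2 a ha]
      obtain ⟨t₂, ρ₂, α₂, hq, hE₂⟩ := ih (i + 1) _ _ _ (by omega) (by omega) (by simp) hF'' hI'
      refine ⟨(hi.cost + 3) + (t' + 4) + t₂, ρ₂, α₂, ?_, fun τ l o => ?_⟩
      · convert hq using 1; ring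
      · have h1 := hhi i ρ' α' hF hx' hi' (by omega)
        refine .while_true (s' := ⟨Function.update ρ'' x (i + 1), α'',
          τ + (hi.cost + 3) + (t' + 4), l, o⟩) ?_ ?_ ?_
        · simp [Exp.eval, Exp.eval_eq_ev, hx', h1]; omega
        · refine .seq (hE _ l o) ?_
          have := Exec.assign (I := I) ⟨ρ'', α'', τ + (hi.cost + 3) + t', l, o⟩ x
            (.add (.reg x) (.const 1))
          have hx2 : ρ'' x = i := by rw [hF'.1 x hx, hx']
          simpa [Exp.eval, State.tick, Exp.cost, hx2, add_assoc] using this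
        · simpa [add_assoc] using hE₂ (τ + (hi.cost + 3) + (t' + 4)) l o
  have hF0 : Frame (RAM.loop x lo hi body) ρ α (Function.update ρ x L) α := by
    constructor
    · intro y hy
      have hy' : y ≠ x ∧ body.wr y = false := by
            simp only [RAM.loop, Cmd.wr, beq_eq_false_iff_ne, Bool.or_eq_false_iff] at hy; tauto
      rw [Function.update_of_ne hy'.1]
    · intros; rfl
  obtain ⟨t, ρ', α', hq, hE⟩ := key (B - L) L 0 _ α (by omega) le_rfl (by simp) hF0 h0
  refine ⟨lo.cost + 1 + t, ρ', α', ?_, fun τ l o => ?_⟩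
  · convert hq using 1; ring
  · refine .seq (.assign _ _ _) ?_
    simpa [Exp.eval_eq_ev, hL, State.tick, add_assoc] using hE (τ + (lo.cost + 1)) l o

/-- The loop rule with a uniform bound `K` on the time of the body. -/
theorem Run.loop_uniform {x : ℕ} {lo hi : Exp} {body : Cmd} {Q : ℕ → Regs → Arrs → Prop} (K : ℕ)
    (Inv : ℕ → Regs → Arrs → Prop) {L B : ℕ} (hL : lo.ev I ρ α = L) (hLB : L ≤ B)
    (h0 : Inv L (Function.update ρ x L) α)
    (hx : body.wr x = false)
    (hhi : ∀ i ρ' α', Frame (RAM.loop x lo hi body) ρ α ρ' α' → ρ' x = i → L ≤ i → i ≤ B →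
      hi.ev I ρ' α' = B)
    (hstep : ∀ i ρ' α', L ≤ i → i < B → ρ' x = i → Frame (RAM.loop x lo hi body) ρ α ρ' α' →
      Inv i ρ' α' → Run I body ρ' α' fun t ρ'' α'' =>
        t ≤ K ∧ Inv (i + 1) (Function.update ρ'' x (i + 1)) α'')
    (hQ : ∀ t ρ' α', Frame (RAM.loop x lo hi body) ρ α ρ' α' → ρ' x = B → Inv B ρ' α' →
      t ≤ (B - L) * (K + hi.cost + 7) + hi.cost + lo.cost + 4 → Q t ρ' α') :
    Run I (RAM.loop x lo hi body) ρ α Q := by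
  refine Run.loop (fun i t ρ α => t ≤ (i - L) * (K + hi.cost + 7) ∧ Inv i ρ α) hL hLB ⟨by simp, h0⟩
    hx hhi (fun i t ρ' α' h1 h2 h3 h4 h5 => ?_) (fun t ρ' α' h1 h2 h3 => hQ _ _ _ h1 h2 h3.2 ?_)
  · refine (hstep i ρ' α' h1 h2 h3 h4 h5.2).imp fun t' ρ'' α'' _ h => ⟨?_, h.2⟩
    rw [Nat.sub_add_comm h1, Nat.add_mul]
    have := h5.1
    have := h.1
    omega
  · have := h3.1
    omega

end RAM

/-! ## Connected edge dominating sets in terms of edge numbers -/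

namespace GraphInput

open Relation Finset

variable (G : GraphInput)

/-- Edge number `i` joins the vertices `u` and `v`. -/
def Joins (i u v : ℕ) : Prop :=
  ∃ h : i < G.m, ((G.src ⟨i, h⟩ : ℕ) = u ∧ (G.dst ⟨i, h⟩ : ℕ) = v) ∨
    ((G.dst ⟨i, h⟩ : ℕ) = u ∧ (G.src ⟨i, h⟩ : ℕ) = v)

variable {G} {i j u v w u' v' : ℕ} {X Y Z : Finset ℕ}

theorem Joins.lt_m (h : G.Joins i u v) : i < G.m := h.1

theorem Joins.lt_left (h : G.Joins i u v) : u < G.n := by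
  obtain ⟨h, ⟨rfl, -⟩ | ⟨rfl, -⟩⟩ := h <;> simp

theorem Joins.symm (h : G.Joins i u v) : G.Joins i v u := by
  obtain ⟨h, h' | h'⟩ := h
  · exact ⟨h, .inr h'.symm⟩
  · exact ⟨h, .inl h'.symm⟩

theorem Joins.lt_right (h : G.Joins i u v) : v < G.n := h.symm.lt_left

theorem Joins.ne (h : G.Joins i u v) : u ≠ v := by
  obtain ⟨h, ⟨rfl, rfl⟩ | ⟨rfl, rfl⟩⟩ := h
  · exact fun h' => G.src_ne_dst _ (Fin.ext h')
  · exact fun h' => G.src_ne_dst _ (Fin.ext h'.symm)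

theorem Joins.edge_eq (h : G.Joins i u v) :
    G.edge ⟨i, h.lt_m⟩ = s(⟨u, h.lt_left⟩, ⟨v, h.lt_right⟩) := by
  obtain ⟨h, ⟨rfl, rfl⟩ | ⟨rfl, rfl⟩⟩ := h
  · rfl
  · exact Sym2.eq_swap

theorem Joins.unique (h : G.Joins i u v) (h' : G.Joins j u v) : i = j := by
  have : G.edge ⟨i, h.lt_m⟩ = G.edge ⟨j, h'.lt_m⟩ := by rw [h.edge_eq, h'.edge_eq]
  simpa using G.edge_injective this

theorem Joins.ends (h : G.Joins i u v) (h' : G.Joins i u' v') :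
    (u = u' ∧ v = v') ∨ (u = v' ∧ v = u') := by
  obtain ⟨h, ⟨rfl, rfl⟩ | ⟨rfl, rfl⟩⟩ := h <;> obtain ⟨-, ⟨rfl, rfl⟩ | ⟨rfl, rfl⟩⟩ := h' <;> simp

theorem Joins.right_eq (h : G.Joins i u v) (h' : G.Joins i u v') : v = v' := by
  have := h.ends h'
  have := h.ne
  omega

theorem exists_joins (h : i < G.m) : ∃ u v, G.Joins i u v := ⟨_, _, h, .inl ⟨rfl, rfl⟩⟩

variable (G)

open Classical in
/-- The vertices covered by a set of edges. -/
noncomputable def cov (X : Finset ℕ) : Finset ℕ :=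
  (range G.n).filter fun v => ∃ i ∈ X, ∃ w, G.Joins i v w

/-- Adjacency by an edge of `X`. -/
def Adj (X : Finset ℕ) (u v : ℕ) : Prop := ∃ i ∈ X, G.Joins i u v

/-- Reachability by edges of `X`. -/
def Reach (X : Finset ℕ) : ℕ → ℕ → Prop := ReflTransGen (G.Adj X)

def Conn (X : Finset ℕ) : Prop := ∀ u ∈ G.cov X, ∀ v ∈ G.cov X, G.Reach X u v

def Dom (X : Finset ℕ) : Prop := ∀ i u v, G.Joins i u v → u ∈ G.cov X ∨ v ∈ G.cov X

/-- A nonempty connected set of edges without cycles. -/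
structure IsTree (X : Finset ℕ) : Prop where
  sub : X ⊆ range G.m
  nonempty : X.Nonempty
  conn : G.Conn X
  card : #(G.cov X) = #X + 1

/-- Connected edge dominating sets, as sets of edge numbers. -/
structure IsCEDS (X : Finset ℕ) : Prop where
  sub : X ⊆ range G.m
  conn : G.Conn X
  dom : G.Dom X

def IsMinCEDS (X : Finset ℕ) : Prop := G.IsCEDS X ∧ ∀ i ∈ X, ¬ G.IsCEDS (X.erase i)

variable {G}

open Classical in
theorem mem_cov : v ∈ G.cov X ↔ ∃ i ∈ X, ∃ w, G.Joins i v w := by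
  refine ⟨fun h => (mem_filter.1 h).2, fun h => mem_filter.2 ⟨?_, h⟩⟩
  revert h
  rw [mem_range]
  rintro ⟨i, -, w, h⟩
  exact h.lt_left

theorem Joins.mem_cov (h : G.Joins i u v) (hi : i ∈ X) : u ∈ G.cov X :=
  GraphInput.mem_cov.2 ⟨i, hi, v, h⟩

theorem cov_subset_range : G.cov X ⊆ range G.n := by
  classical
  exact filter_subset _ _

theorem cov_mono (h : X ⊆ Y) : G.cov X ⊆ G.cov Y := by
  intro v hv
  obtain ⟨i, hi, w, hw⟩ := mem_cov.1 hv
  exact hw.mem_cov (h hi)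

theorem cov_insert (h : G.Joins i u v) : G.cov (insert i X) = insert u (insert v (G.cov X)) := by
  ext z
  simp only [mem_cov, mem_insert]
  constructor
  · rintro ⟨j, rfl | hj, w, hw⟩
    · have := h.ends hw
      omega
    · exact .inr (.inr ⟨j, hj, w, hw⟩)
  · rintro (rfl | rfl | ⟨j, hj, w, hw⟩)
    · exact ⟨i, .inl rfl, _, h⟩
    · exact ⟨i, .inl rfl, _, h.symm⟩
    · exact ⟨j, .inr hj, w, hw⟩

theorem Joins.reach (h : G.Joins i u v) (hi : i ∈ X) : G.Reach X u v :=
  .single ⟨i, hi, h⟩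

theorem Reach.symm (h : G.Reach X u v) : G.Reach X v u := by
  induction h with
  | refl => exact .refl
  | tail _ h ih =>
    obtain ⟨i, hi, h⟩ := h
    exact .head ⟨i, hi, h.symm⟩ ih

theorem Reach.mono (h : X ⊆ Y) (hr : G.Reach X u v) : G.Reach Y u v :=
  ReflTransGen.mono (fun _ _ ⟨i, hi, hj⟩ => ⟨i, h hi, hj⟩) _ _ hr

theorem Reach.trans (h : G.Reach X u v) (h' : G.Reach X v w) : G.Reach X u w :=
  ReflTransGen.trans h h'

theorem Reach.mem_cov (h : G.Reach X u v) (hne : u ≠ v) : u ∈ G.cov X := by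
  obtain h | ⟨w, ⟨i, hi, hw⟩, -⟩ := h.cases_head
  · exact absurd h hne
  · exact hw.mem_cov hi

theorem Reach.exists_crossing (h : G.Reach X u v) (S : ℕ → Prop) (hu : S u) (hv : ¬ S v) :
    ∃ i ∈ X, ∃ a b, G.Joins i a b ∧ S a ∧ ¬ S b := by
  induction h with
  | refl => exact absurd hu hv
  | @tail b c _ h ih =>
    obtain ⟨i, hi, h⟩ := h
    by_cases hb : S b
    · exact ⟨i, hi, b, c, h, hb, hv⟩
    · exact ih hb

theorem conn_of_root {r : ℕ} (h : ∀ v ∈ G.cov X, G.Reach X v r) : G.Conn X :=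
  fun u hu v hv => (h u hu).trans (h v hv).symm

theorem IsTree.pendant (hX : G.IsTree X) (h : G.Joins i u v) (hu : u ∈ G.cov X)
    (hv : v ∉ G.cov X) : G.IsTree (insert i X) ∧ G.cov (insert i X) = insert v (G.cov X) := by
  have hcov : G.cov (insert i X) = insert v (G.cov X) := by
    rw [cov_insert h, insert_comm, insert_eq_of_mem hu]
  have hi : i ∉ X := fun hi => hv (h.symm.mem_cov hi)
  refine ⟨⟨?_, insert_nonempty _ _, conn_of_root (r := u) fun z hz => ?_, ?_⟩, hcov⟩
  · exact insert_subset (by simpa using h.lt_m) hX.sub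
  · rw [hcov, mem_insert] at hz
    obtain rfl | hz := hz
    · exact h.symm.reach (mem_insert_self _ _)
    · exact (hX.conn z hz u hu).mono (subset_insert _ _)
  · rw [hcov, card_insert_of_notMem hv, card_insert_of_notMem hi, hX.card]

theorem isTree_singleton (h : G.Joins i u v) :
    G.IsTree {i} ∧ G.cov {i} = {u, v} := by
  have hcov : G.cov {i} = {u, v} := by
    have : G.cov ∅ = ∅ := by ext; simp [mem_cov]
    rw [← insert_empty_eq, cov_insert h, this]; rfl
  refine ⟨⟨by simpa using h.lt_m, by simp, conn_of_root (r := u) fun z hz => ?_, ?_⟩, hcov⟩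
  · rw [hcov, mem_insert, mem_singleton] at hz
    obtain rfl | rfl := hz
    · exact .refl
    · exact h.symm.reach (by simp)
  · rw [hcov, card_pair h.ne, card_singleton]

theorem exists_spanning_tree (hs : X ⊆ range G.m) (hne : X.Nonempty) (hX : G.Conn X) :
    ∃ T ⊆ X, G.IsTree T ∧ G.cov T = G.cov X := by
  classical
  have hN : (X.powerset.filter G.IsTree).Nonempty := by
    obtain ⟨i, hi⟩ := hne
    obtain ⟨u, v, h⟩ := exists_joins (mem_range.1 (hs hi))
    exact ⟨{i}, by simpa [hi] using (isTree_singleton h).1⟩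
  obtain ⟨T, hT, hmax⟩ := exists_max_image _ card hN
  rw [mem_filter, mem_powerset] at hT
  refine ⟨T, hT.1, hT.2, (cov_mono hT.1).antisymm fun v hv => ?_⟩
  by_contra hv'
  obtain ⟨i₀, hi₀⟩ := hT.2.nonempty
  obtain ⟨u, u', hu⟩ := exists_joins (mem_range.1 (hT.2.sub hi₀))
  have hu : u ∈ G.cov T := hu.mem_cov hi₀
  obtain ⟨i, hi, a, b, hab, ha, hb⟩ :=
    (hX u (cov_mono hT.1 hu) v hv).exists_crossing (· ∈ G.cov T) hu hv'
  have := hmax (insert i T) (by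
    rw [mem_filter, mem_powerset]
    exact ⟨insert_subset hi hT.1, (hT.2.pendant hab ha hb).1⟩)
  rw [card_insert_of_notMem fun h => hb (hab.symm.mem_cov h)] at this
  omega

theorem card_cov_le (hs : X ⊆ range G.m) (hne : X.Nonempty) (hX : G.Conn X) :
    #(G.cov X) ≤ #X + 1 := by
  obtain ⟨T, hT, hT', h⟩ := exists_spanning_tree hs hne hX
  rw [← h, hT'.card]
  have := card_le_card hT
  omega

theorem IsTree.ceds (h : G.IsTree X) (h' : G.Dom X) : G.IsCEDS X := ⟨h.sub, h.conn, h'⟩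

theorem Dom.mono (h : G.Dom X) (hXY : G.cov X ⊆ G.cov Y) : G.Dom Y :=
  fun i u v hi => (h i u v hi).imp (@hXY u) (@hXY v)

theorem IsCEDS.mono (hX : G.IsCEDS X) (hXY : X ⊆ Y) (hY : Y ⊆ range G.m) : G.IsCEDS Y := by
  have key : ∀ v ∈ G.cov Y, ∃ u ∈ G.cov X, G.Reach Y v u := by
    intro v hv
    obtain ⟨i, hi, w, hw⟩ := mem_cov.1 hv
    obtain h | h := hX.dom i v w hw
    · exact ⟨v, h, .refl⟩
    · exact ⟨w, h, hw.reach hi⟩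
  refine ⟨hY, fun u hu v hv => ?_, hX.dom.mono (cov_mono hXY)⟩
  obtain ⟨u', hu', h1⟩ := key u hu
  obtain ⟨v', hv', h2⟩ := key v hv
  exact (h1.trans ((hX.conn u' hu' v' hv').mono hXY)).trans h2.symm

theorem IsMinCEDS.eq_of_subset (hY : G.IsMinCEDS Y) (hX : G.IsCEDS X) (h : X ⊆ Y) : X = Y := by
  refine h.antisymm fun i hi => ?_
  by_contra hi'
  refine hY.2 i hi (hX.mono (fun j hj => mem_erase.2 ⟨?_, h hj⟩)
    ((erase_subset _ _).trans hY.1.sub))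
  rintro rfl
  exact hi' hj

/-! ### Removing an edge of a tree -/

theorem IsTree.not_reach_erase (hX : G.IsTree X) {e x y : ℕ} (he : e ∈ X) (h : G.Joins e x y) :
    ¬ G.Reach (X.erase e) x y := by
  intro hr
  have hreach : ∀ {u v}, G.Reach X u v → G.Reach (X.erase e) u v := by
    intro u v huv
    induction huv with
    | refl => exact .refl
    | @tail b c _ hbc ih =>
      obtain ⟨i, hi, hbc⟩ := hbc
      refine ih.trans ?_
      by_cases hie : i = e
      · subst hie
        obtain ⟨rfl, rfl⟩ | ⟨rfl, rfl⟩ := h.ends hbc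
        · exact hr
        · exact hr.symm
      · exact hbc.reach (mem_erase.2 ⟨hie, hi⟩)
  have hcov : G.cov X ⊆ G.cov (X.erase e) := by
    intro v hv
    obtain ⟨i, hi, w, hw⟩ := mem_cov.1 hv
    exact (hreach (hw.reach hi)).mem_cov hw.ne
  have hne : (X.erase e).Nonempty := by
    obtain ⟨i, hi, -⟩ := mem_cov.1 (hr.mem_cov h.ne)
    exact ⟨i, hi⟩
  have := card_cov_le ((erase_subset _ _).trans hX.sub) hne
    fun u hu v hv => hreach (hX.conn u (cov_mono (erase_subset _ _) hu) v
      (cov_mono (erase_subset _ _) hv))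
  have h1 := card_le_card hcov
  have h2 := hX.card
  have h3 := card_erase_add_one he
  omega

theorem IsTree.reach_erase_or (hX : G.IsTree X) {e x y : ℕ} (he : e ∈ X) (h : G.Joins e x y)
    (hv : v ∈ G.cov X) : G.Reach (X.erase e) x v ∨ G.Reach (X.erase e) y v := by
  have hr := hX.conn x (h.mem_cov he) v hv
  clear hv
  induction hr with
  | refl => exact .inl .refl
  | @tail b c _ hbc ih =>
    obtain ⟨i, hi, hbc⟩ := hbc
    by_cases hie : i = e
    · subst hie
      obtain ⟨rfl, rfl⟩ | ⟨rfl, rfl⟩ := h.ends hbc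
      · exact .inr .refl
      · exact .inl .refl
    · have := hbc.reach (mem_erase.2 ⟨hie, hi⟩)
      exact ih.imp (·.trans this) (·.trans this)

/-- A set of edges that reconnects the parts of a tree after the removal of an edge. -/
theorem IsTree.reconnect (hX : G.IsTree X) {e x y : ℕ} (he : e ∈ X) (h : G.Joins e x y)
    (hsub : X.erase e ⊆ Z) (hxy : G.Reach Z x y)
    (hcov : ∀ v ∈ G.cov Z, ∃ u ∈ G.cov X, G.Reach Z v u) :
    Z.Nonempty ∧ G.Conn Z ∧ G.cov X ⊆ G.cov Z := by
  have key : ∀ v ∈ G.cov X, G.Reach Z v x := by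
    intro v hv
    obtain h' | h' := hX.reach_erase_or he h hv
    · exact (h'.mono hsub).symm
    · exact (hxy.trans (h'.mono hsub)).symm
  refine ⟨?_, conn_of_root (r := x) fun v hv => ?_, fun v hv => ?_⟩
  · obtain ⟨i, hi, -⟩ := mem_cov.1 (hxy.mem_cov h.ne)
    exact ⟨i, hi⟩
  · obtain ⟨u, hu, hr⟩ := hcov v hv
    exact hr.trans (key u hu)
  · by_cases hvx : v = x
    · exact hvx ▸ hxy.mem_cov h.ne
    · exact (key v hv).mem_cov hvx

/-- The condition under which `i`, `j` reconnect the parts of `X.erase e`, where `x` is an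
endpoint of `e`. -/
def IsSwap (G : GraphInput) (X : Finset ℕ) (e x i j a w b : ℕ) : Prop :=
  G.Joins i a w ∧ G.Joins j w b ∧ G.Reach (X.erase e) x a ∧
    ((w ∉ G.cov X ∧ b ∈ G.cov X ∧ ¬ G.Reach (X.erase e) x b) ∨
      (w ∈ G.cov X ∧ ¬ G.Reach (X.erase e) x w ∧ b = a))

theorem IsTree.swap (hX : G.IsTree X) {e x y i j a w b : ℕ} (he : e ∈ X) (h : G.Joins e x y)
    (hs : G.IsSwap X e x i j a w b) :
    G.IsTree (insert i (insert j (X.erase e))) ∧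
      G.cov X ⊆ G.cov (insert i (insert j (X.erase e))) := by
  obtain ⟨hi, hj, hxa, hs⟩ := hs
  have hsub : X.erase e ⊆ insert i (insert j (X.erase e)) :=
    (subset_insert _ _).trans (subset_insert _ _)
  have hr : (insert i (insert j (X.erase e))) ⊆ range G.m :=
    insert_subset (by simpa using hi.lt_m) (insert_subset (by simpa using hj.lt_m)
      ((erase_subset _ _).trans hX.sub))
  have hx : x ∈ G.cov X := h.mem_cov he
  have ha : a ∈ G.cov X := by
    by_cases hax : a = x
    · exact hax ▸ hx
    · exact cov_mono (erase_subset _ _) (hxa.symm.mem_cov hax)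
  have hai : G.Reach (insert i (insert j (X.erase e))) a w := hi.reach (by simp)
  have hwj : G.Reach (insert i (insert j (X.erase e))) w b := hj.reach (by simp)
  have hcard := card_erase_add_one he
  obtain ⟨hw, hb, hxb⟩ | ⟨hw, hxw, rfl⟩ := hs
  · have hyb := (hX.reach_erase_or he h hb).resolve_left hxb
    have hij : i ≠ j := by
      rintro rfl
      have := hi.symm.right_eq hj
      exact hxb (this ▸ hxa)
    obtain ⟨h1, h2, h3⟩ := hX.reconnect he h hsub
      ((((hxa.mono hsub).trans hai).trans hwj).trans (hyb.mono hsub).symm) (by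
        intro v hv
        rw [cov_insert hi, cov_insert hj] at hv
        simp only [mem_insert] at hv
        obtain rfl | rfl | rfl | rfl | hv := hv
        · exact ⟨_, ha, .refl⟩
        · exact ⟨b, hb, hwj⟩
        · exact ⟨b, hb, hwj⟩
        · exact ⟨_, hb, .refl⟩
        · exact ⟨v, cov_mono (erase_subset _ _) hv, .refl⟩)
    refine ⟨⟨hr, h1, h2, ?_⟩, h3⟩
    have hle := card_cov_le hr h1 h2
    have h4 : insert w (G.cov X) ⊆ G.cov (insert i (insert j (X.erase e))) :=
      insert_subset (hj.mem_cov (by simp)) h3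
    have h5 := card_le_card h4
    have hiX : i ∉ X := fun hi' => hw (hi.symm.mem_cov hi')
    have hjX : j ∉ X := fun hj' => hw (hj.mem_cov hj')
    rw [card_insert_of_notMem hw, hX.card] at h5
    rw [card_insert_of_notMem (by simp [hij, hiX]), card_insert_of_notMem (by simp [hjX])] at hle ⊢
    omega
  · obtain rfl : i = j := hi.unique hj.symm
    rw [insert_idem] at *
    have hyw := (hX.reach_erase_or he h hw).resolve_left hxw
    obtain ⟨h1, h2, h3⟩ := hX.reconnect he h hsub
      (((hxa.mono hsub).trans hai).trans (hyw.mono hsub).symm) (by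
        intro v hv
        rw [cov_insert hi] at hv
        simp only [mem_insert] at hv
        obtain rfl | rfl | hv := hv
        · exact ⟨_, ha, .refl⟩
        · exact ⟨_, hw, .refl⟩
        · exact ⟨v, cov_mono (erase_subset _ _) hv, .refl⟩)
    refine ⟨⟨hr, h1, h2, ?_⟩, h3⟩
    have hle := card_cov_le hr h1 h2
    have h5 := card_le_card h3
    have hiX : i ∉ X.erase e := fun hi' => hxw (hxa.trans (hi.reach hi'))
    rw [hX.card] at h5
    rw [card_insert_of_notMem hiX] at hle ⊢
    omega

theorem IsTree.erase_leaf (hX : G.IsTree X) {p : ℕ} (hi : i ∈ X) (h : G.Joins i v p)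
    (hleaf : ∀ j ∈ X, ∀ w, G.Joins j v w → j = i) (h2 : 2 ≤ #X) :
    G.IsTree (X.erase i) ∧ G.cov (X.erase i) = (G.cov X).erase v := by
  have hreach : ∀ {u z}, G.Reach X u z → u ≠ v →
      (z ≠ v → G.Reach (X.erase i) u z) ∧ (z = v → G.Reach (X.erase i) u p) := by
    intro u z hr hu
    induction hr with
    | refl => exact ⟨fun _ => .refl, fun h => absurd h hu⟩
    | @tail b c _ hbc ih =>
      obtain ⟨j, hj, hbc⟩ := hbc
      by_cases hji : j = i
      · subst hji
        have := h.ne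
        obtain ⟨rfl, rfl⟩ | ⟨rfl, rfl⟩ := h.ends hbc
        · exact ⟨fun _ => ih.2 rfl, fun h => absurd h.symm this⟩
        · exact ⟨fun h => absurd rfl h, fun _ => ih.1 this.symm⟩
      · have hb : b ≠ v := by
          rintro rfl
          exact hji (hleaf j hj c hbc)
        have hc : c ≠ v := by
          rintro rfl
          exact hji (hleaf j hj b hbc.symm)
        exact ⟨fun _ => (ih.1 hb).trans (hbc.reach (mem_erase.2 ⟨hji, hj⟩)), fun h => absurd h hc⟩
  have hvn : v ∉ G.cov (X.erase i) := by
    intro hv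
    obtain ⟨j, hj, w, hw⟩ := mem_cov.1 hv
    rw [mem_erase] at hj
    exact hj.1 (hleaf j hj.2 w hw)
  have hc := card_erase_add_one hi
  have hne : (X.erase i).Nonempty := card_pos.1 (by omega)
  have hp : p ∈ G.cov (X.erase i) := by
    obtain ⟨j, hj⟩ := hne
    rw [mem_erase] at hj
    obtain ⟨a, b, hab⟩ := exists_joins (mem_range.1 (hX.sub hj.2))
    have ha : a ≠ v := fun ha => hj.1 (hleaf j hj.2 b (ha ▸ hab))
    by_cases hap : a = p
    · exact hap ▸ hab.mem_cov (mem_erase.2 hj)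
    · exact ((hreach (hX.conn a (hab.mem_cov hj.2) p (h.symm.mem_cov hi)) ha).1
        h.ne.symm).symm.mem_cov (Ne.symm hap)
  have hcov : G.cov (X.erase i) = (G.cov X).erase v := by
    ext z
    rw [mem_erase]
    constructor
    · exact fun hz => ⟨fun h => hvn (h ▸ hz), cov_mono (erase_subset _ _) hz⟩
    · rintro ⟨hzv, hz⟩
      obtain ⟨j, hj, w, hw⟩ := mem_cov.1 hz
      by_cases hji : j = i
      · subst hji
        obtain ⟨rfl, rfl⟩ | ⟨rfl, rfl⟩ := h.ends hw
        · exact absurd rfl hzv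
        · exact hp
      · exact hw.mem_cov (mem_erase.2 ⟨hji, hj⟩)
  refine ⟨⟨(erase_subset _ _).trans hX.sub, hne, fun u hu z hz => ?_, ?_⟩, hcov⟩
  · rw [hcov, mem_erase] at hu hz
    exact (hreach (hX.conn u hu.2 z hz.2) hu.1).1 hz.1
  · rw [hcov, card_erase_of_mem (h.mem_cov hi), hX.card]
    omega

/-- All edges of `X` at `v` coincide. -/
def IsLeaf (G : GraphInput) (X : Finset ℕ) (v : ℕ) : Prop :=
  ∀ i ∈ X, ∀ j ∈ X, ∀ u w, G.Joins i v u → G.Joins j v w → i = j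

theorem IsTree.isMinCEDS (hX : G.IsTree X) (hd : G.Dom X) (h2 : 2 ≤ #X)
    (h : ∀ v ∈ G.cov X, G.IsLeaf X v → ∃ i w, G.Joins i v w ∧ w ∉ G.cov X) :
    G.IsMinCEDS X := by
  refine ⟨hX.ceds hd, fun i hi hc => ?_⟩
  have hcard := card_erase_add_one hi
  have hle := card_cov_le hc.sub (card_pos.1 (by omega)) hc.conn
  have hlt : #(G.cov (X.erase i)) < #(G.cov X) := by
    rw [hX.card]
    omega
  obtain ⟨v, hv, hv'⟩ := exists_mem_notMem_of_card_lt_card hlt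
  have hv'' : ∀ j ∈ X, ∀ w, G.Joins j v w → j = i := by
    intro j hj w hw
    by_contra hji
    exact hv' (hw.mem_cov (mem_erase.2 ⟨hji, hj⟩))
  obtain ⟨j, w, hw, hwX⟩ := h v hv fun i hi j hj u w hu hw =>
    (hv'' i hi u hu).trans (hv'' j hj w hw).symm
  obtain h' | h' := hc.dom j v w hw
  · exact hv' h'
  · exact hwX (cov_mono (erase_subset _ _) h')

/-! ### The solution graph -/

/-- `D` contains the neighbours of `X` that arise from the removal of `e` with endpoint `x`. -/
def Explored (G : GraphInput) (D : Set (Finset ℕ)) (X : Finset ℕ) (e x : ℕ) : Prop :=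
  (∀ i j a w b, G.IsSwap X e x i j a w b → ∃ Z ∈ D, Z ⊆ insert i (insert j (X.erase e))) ∧
    (x ∉ G.cov (X.erase e) →
      (∀ i w, G.Joins i x w → w ∉ G.cov X → ∃ j t, G.Joins j w t ∧ t ≠ x) →
      ∃ Z ∈ D, ∀ v ∈ G.cov Z, (v ∈ G.cov X ∧ v ≠ x) ∨ ∃ i, G.Joins i x v)

theorem IsTree.exists_closer (hX : G.IsTree X) (hd : G.Dom X) (hY : G.IsCEDS Y) {e : ℕ}
    (he : e ∈ X) :
    (∃ x y, G.Joins e x y ∧ x ∉ G.cov (X.erase e) ∧ x ∉ G.cov Y ∧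
      ∀ i w, G.Joins i x w → w ∉ G.cov X → ∃ j t, G.Joins j w t ∧ t ≠ x) ∨
    ∃ x y i j a w b, G.Joins e x y ∧ G.IsSwap X e x i j a w b ∧ i ∈ Y ∧ j ∈ Y := by
  obtain ⟨x, y, h⟩ := exists_joins (mem_range.1 (hX.sub he))
  have key : ∀ {x y}, G.Joins e x y → x ∉ G.cov (X.erase e) → x ∉ G.cov Y →
      ∀ i w, G.Joins i x w → w ∉ G.cov X → ∃ j t, G.Joins j w t ∧ t ≠ x := by
    intro x y _ _ hxY i w hw _
    obtain ⟨j, hj, t, ht⟩ := mem_cov.1 ((hY.dom i x w hw).resolve_left hxY)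
    exact ⟨j, t, ht, fun h => hxY (h ▸ ht.symm.mem_cov hj)⟩
  by_cases hx : x ∉ G.cov (X.erase e) ∧ x ∉ G.cov Y
  · exact .inl ⟨x, y, h, hx.1, hx.2, key h hx.1 hx.2⟩
  by_cases hy : y ∉ G.cov (X.erase e) ∧ y ∉ G.cov Y
  · exact .inl ⟨y, x, h.symm, hy.1, hy.2, key h.symm hy.1 hy.2⟩
  have side : ∀ {x y}, G.Joins e x y → ¬ (x ∉ G.cov (X.erase e) ∧ x ∉ G.cov Y) →
      ∃ p ∈ G.cov Y, p ∈ G.cov X ∧ G.Reach (X.erase e) x p := by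
    intro x y hxy hx
    by_cases hxY : x ∈ G.cov Y
    · exact ⟨x, hxY, hxy.mem_cov he, .refl⟩
    · have hx' : x ∈ G.cov (X.erase e) := by tauto
      obtain ⟨i, hi, z, hz⟩ := mem_cov.1 hx'
      exact ⟨z, (hY.dom i x z hz).resolve_left hxY, hz.symm.mem_cov (mem_of_mem_erase hi),
        hz.reach hi⟩
  obtain ⟨p, hpY, -, hxp⟩ := side h hx
  obtain ⟨q, hqY, hqX, hyq⟩ := side h.symm hy
  right
  by_contra hno
  have inv : ∀ z, G.Reach Y p z → G.Reach (X.erase e) x z ∨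
      (z ∉ G.cov X ∧ ∃ i ∈ Y, ∃ a, G.Joins i a z ∧ G.Reach (X.erase e) x a) := by
    intro z hz
    induction hz with
    | refl => exact .inl hxp
    | @tail b c _ hbc ih =>
      obtain ⟨j, hj, hbc⟩ := hbc
      by_cases hc : G.Reach (X.erase e) x c
      · exact .inl hc
      right
      obtain ih | ⟨hb, i, hi, a, hab, ha⟩ := ih
      · by_cases hcX : c ∈ G.cov X
        · exact absurd ⟨x, y, j, j, b, c, b, h, ⟨hbc, hbc.symm, ih, .inr ⟨hcX, hc, rfl⟩⟩, hj, hj⟩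
            hno
        · exact ⟨hcX, j, hj, b, hbc, ih⟩
      · have hcX := (hd j b c hbc).resolve_left hb
        exact absurd ⟨x, y, i, j, a, b, c, h, ⟨hab, hbc, ha, .inl ⟨hb, hcX, hc⟩⟩, hi, hj⟩ hno
  obtain h' | h' := inv q (hY.conn p hpY q hqY)
  · exact hX.not_reach_erase he h (h'.trans hyq.symm)
  · exact h'.1 hqX

/-- As long as the minimal set `Y` has not been processed, there is a set that has been found but
not processed and whose vertices belong to the first set or to `Y`. -/
theorem exists_frontier {D P : Set (Finset ℕ)} {X₀ : Finset ℕ}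
    (hD : ∀ X ∈ D, G.IsTree X ∧ G.Dom X) (hX₀ : X₀ ∈ D)
    (hP : ∀ X ∈ P, ∀ e ∈ X, ∀ x y, G.Joins e x y → G.Explored D X e x)
    (hY : G.IsMinCEDS Y) (hYP : Y ∉ P) :
    ∃ X ∈ D, X ∉ P ∧ G.cov X ⊆ G.cov X₀ ∪ G.cov Y := by
  by_contra! hno
  have key : ∀ k X, X ∈ D → G.cov X ⊆ G.cov X₀ ∪ G.cov Y →
      #(G.cov X \ G.cov Y) * (G.m + 1) + #(X \ Y) ≤ k → False := by
    intro k
    induction k using Nat.strong_induction_on with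
    | _ k ih =>
    intro X hXD hXc hk
    have hXP : X ∈ P := by
      by_contra hXP
      exact hno X hXD hXP hXc
    obtain ⟨hX, hd⟩ := hD X hXD
    have hXY : ¬ X ⊆ Y := by
      intro h
      exact hYP (hY.eq_of_subset (hX.ceds hd) h ▸ hXP)
    obtain ⟨e, he, heY⟩ := not_subset.1 hXY
    obtain ⟨x, y, h, hx1, hx2, hx3⟩ | ⟨x, y, i, j, a, w, b, h, hs, hi, hj⟩ :=
      hX.exists_closer hd hY.1 he
    · obtain ⟨Z, hZ, hZc⟩ := (hP X hXP e he x y h).2 hx1 hx3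
      have hZc' : ∀ v ∈ G.cov Z, (v ∈ G.cov X ∧ v ≠ x) ∨ v ∈ G.cov Y := by
        intro v hv
        refine (hZc v hv).imp id ?_
        rintro ⟨i, hi⟩
        exact (hY.1.dom i x v hi).resolve_left hx2
      have h1 : G.cov Z \ G.cov Y ⊆ (G.cov X \ G.cov Y).erase x := by
        intro v hv
        rw [mem_sdiff] at hv
        have := hZc' v hv.1
        simp only [mem_erase, mem_sdiff]
        tauto
      have hxm : x ∈ G.cov X \ G.cov Y := mem_sdiff.2 ⟨h.mem_cov he, hx2⟩
      have h2 := card_le_card h1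
      have h3 := card_erase_add_one hxm
      have h4 : #(Z \ Y) ≤ G.m := by
        simpa using card_le_card (sdiff_subset.trans (hD Z hZ).1.sub : Z \ Y ⊆ range G.m)
      refine ih _ ?_ Z hZ (fun v hv => ?_) le_rfl
      · have := Nat.mul_le_mul_right (G.m + 1) h2
        rw [← h3, Nat.add_mul] at hk
        omega
      · have h5 := @hXc v
        have := hZc' v hv
        simp only [mem_union] at *
        tauto
    · obtain ⟨Z, hZ, hZs⟩ := (hP X hXP e he x y h).1 i j a w b hs
      have hcov : G.cov Z ⊆ G.cov X ∪ G.cov Y := by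
        intro v hv
        obtain ⟨l, hl, z, hz⟩ := mem_cov.1 hv
        have := hZs hl
        simp only [mem_insert, mem_erase] at this
        rw [mem_union]
        obtain rfl | rfl | hl := this
        · exact .inr (hz.mem_cov hi)
        · exact .inr (hz.mem_cov hj)
        · exact .inl (hz.mem_cov hl.2)
      have h1 : G.cov Z \ G.cov Y ⊆ G.cov X \ G.cov Y := by
        intro v hv
        have := @hcov v
        simp only [mem_sdiff, mem_union] at *
        tauto
      have h2 : Z \ Y ⊆ (X \ Y).erase e := by
        intro l hl
        have := @hZs l
        simp only [mem_sdiff, mem_insert, mem_erase] at *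
        rcases this hl.1 with rfl | rfl | h'
        · exact absurd hi hl.2
        · exact absurd hj hl.2
        · exact ⟨h'.1, h'.2, hl.2⟩
      have h3 := card_erase_add_one (mem_sdiff.2 ⟨he, heY⟩)
      have h4 := card_le_card h1
      have h5 := card_le_card h2
      refine ih _ ?_ Z hZ (fun v hv => ?_) le_rfl
      · have := Nat.mul_le_mul_right (G.m + 1) h4
        omega
      · have h6 := @hcov v hv
        have h7 := @hXc v
        simp only [mem_union] at *
        tauto
  exact key _ X₀ hX₀ subset_union_left le_rfl

end GraphInput

/-! ## Translation to sets of edges -/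

namespace GraphInput

open Relation Finset

variable {G : GraphInput} {i j u v w : ℕ} {X Y : Finset ℕ}

theorem mem_edgesAt {e : Sym2 (Fin G.n)} :
    e ∈ G.edgesAt X ↔ ∃ i, ∃ h : i < G.m, i ∈ X ∧ G.edge ⟨i, h⟩ = e := by
  classical
  simp only [edgesAt, mem_image, mem_filter, mem_univ, true_and, mem_coe]
  exact ⟨fun ⟨i, h⟩ => ⟨i, i.2, h⟩, fun ⟨i, hi, h⟩ => ⟨⟨i, hi⟩, h⟩⟩

theorem joins_iff (u v : Fin G.n) : G.Joins i u v ↔ ∃ h : i < G.m, G.edge ⟨i, h⟩ = s(u, v) := by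
  constructor
  · exact fun h => ⟨h.lt_m, h.edge_eq⟩
  · rintro ⟨h, h'⟩
    rw [edge, Sym2.eq_iff] at h'
    obtain ⟨rfl, rfl⟩ | ⟨rfl, rfl⟩ := h'
    · exact ⟨h, .inl ⟨rfl, rfl⟩⟩
    · exact ⟨h, .inr ⟨rfl, rfl⟩⟩

theorem graph_adj (u v : Fin G.n) : G.graph.Adj u v ↔ ∃ i, G.Joins i u v := by
  simp only [graph, SimpleGraph.fromEdgeSet_adj, Set.mem_range]
  constructor
  · rintro ⟨⟨i, hi⟩, -⟩
    exact ⟨i, (joins_iff u v).2 ⟨i.2, hi⟩⟩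
  · rintro ⟨i, hi⟩
    obtain ⟨h, h'⟩ := (joins_iff u v).1 hi
    exact ⟨⟨_, h'⟩, fun h => hi.ne (congrArg _ h)⟩

theorem mem_cov_iff_edgesAt (v : Fin G.n) : (v : ℕ) ∈ G.cov X ↔ ∃ e ∈ G.edgesAt X, v ∈ e := by
  rw [mem_cov]
  constructor
  · rintro ⟨i, hi, w, hw⟩
    exact ⟨_, mem_edgesAt.2 ⟨i, hw.lt_m, hi, rfl⟩, by rw [hw.edge_eq]; exact Sym2.mem_mk_left _ _⟩
  · rintro ⟨e, he, hv⟩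
    obtain ⟨i, h, hi, rfl⟩ := mem_edgesAt.1 he
    obtain ⟨w, hw⟩ := Sym2.mem_iff_exists.1 hv
    exact ⟨i, hi, w, (joins_iff v w).2 ⟨h, hw⟩⟩

theorem adj_iff_edgesAt (u v : Fin G.n) :
    (SimpleGraph.fromEdgeSet (G.edgesAt X : Set (Sym2 (Fin G.n)))).Adj u v ↔ G.Adj X u v := by
  simp only [SimpleGraph.fromEdgeSet_adj, mem_coe, mem_edgesAt, Adj]
  constructor
  · rintro ⟨⟨i, h, hi, he⟩, -⟩
    exact ⟨i, hi, (joins_iff u v).2 ⟨h, he⟩⟩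
  · rintro ⟨i, hi, h⟩
    obtain ⟨h', h''⟩ := (joins_iff u v).1 h
    exact ⟨⟨i, h', hi, h''⟩, fun he => h.ne (congrArg _ he)⟩

theorem reachable_iff_reach (u v : Fin G.n) :
    (SimpleGraph.fromEdgeSet (G.edgesAt X : Set (Sym2 (Fin G.n)))).Reachable u v ↔
      G.Reach X u v := by
  rw [SimpleGraph.reachable_iff_reflTransGen]
  constructor
  · intro h
    induction h with
    | refl => exact .refl
    | tail _ h ih => exact ih.tail ((adj_iff_edgesAt _ _).1 h)
  · have key : ∀ z, G.Reach X u z → ∀ w : Fin G.n, (w : ℕ) = z → ReflTransGen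
        (SimpleGraph.fromEdgeSet (G.edgesAt X : Set (Sym2 (Fin G.n)))).Adj u w := by
      intro z h
      induction h with
      | refl => exact fun w hw => Fin.ext hw ▸ .refl
      | @tail b c _ h ih =>
        rintro w rfl
        obtain ⟨i, hi, h'⟩ := h
        exact (ih ⟨b, h'.lt_left⟩ rfl).tail ((adj_iff_edgesAt _ _).2 ⟨i, hi, h'⟩)
    exact fun h => key v h v rfl

theorem isConnectedEDS_edgesAt (hX : X ⊆ range G.m) :
    IsConnectedEDS G.graph (G.edgesAt X) ↔ G.IsCEDS X := by
  constructor
  · intro h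
    refine ⟨hX, fun u hu v hv => ?_, fun i u v hi => ?_⟩
    · have hu' := mem_range.1 (cov_subset_range hu)
      have hv' := mem_range.1 (cov_subset_range hv)
      exact (reachable_iff_reach ⟨u, hu'⟩ ⟨v, hv'⟩).1
        (h.connected _ _ ((mem_cov_iff_edgesAt _).1 hu) ((mem_cov_iff_edgesAt _).1 hv))
    · have he : s(⟨u, hi.lt_left⟩, ⟨v, hi.lt_right⟩) ∈ G.graph.edgeSet :=
        (graph_adj _ _).2 ⟨i, hi⟩
      obtain ⟨f, hf, z, hz, hzf⟩ := h.dominating _ he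
      have hz' := (mem_cov_iff_edgesAt z).2 ⟨f, hf, hzf⟩
      rw [Sym2.mem_iff] at hz
      obtain rfl | rfl := hz
      · exact .inl hz'
      · exact .inr hz'
  · intro h
    refine ⟨fun e he => ?_, fun u v hu hv => ?_, fun e he => ?_⟩
    · obtain ⟨i, hi, -, rfl⟩ := mem_edgesAt.1 he
      exact (graph_adj _ _).2 ⟨i, hi, .inl ⟨rfl, rfl⟩⟩
    · exact (reachable_iff_reach u v).2
        (h.conn _ ((mem_cov_iff_edgesAt u).2 hu) _ ((mem_cov_iff_edgesAt v).2 hv))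
    · induction e with | _ u v
      obtain ⟨i, hi⟩ := (graph_adj u v).1 he
      obtain h' | h' := h.dom i u v hi
      · obtain ⟨f, hf, hu⟩ := (mem_cov_iff_edgesAt u).1 h'
        exact ⟨f, hf, u, Sym2.mem_mk_left _ _, hu⟩
      · obtain ⟨f, hf, hu⟩ := (mem_cov_iff_edgesAt v).1 h'
        exact ⟨f, hf, v, Sym2.mem_mk_right _ _, hu⟩

theorem card_edgesAt (hX : X ⊆ range G.m) : (G.edgesAt X).card = #X := by
  classical
  rw [edgesAt, card_image_of_injective _ (f := G.edge) G.edge_injective, ← card_map Fin.valEmbedding]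
  congr 1
  ext i
  simp only [mem_map, mem_filter, mem_univ, true_and, mem_coe, Fin.valEmbedding_apply]
  exact ⟨fun ⟨j, hj, h⟩ => h ▸ hj, fun hi => ⟨⟨i, mem_range.1 (hX hi)⟩, hi, rfl⟩⟩

theorem edgesAt_injOn (hX : X ⊆ range G.m) (hY : Y ⊆ range G.m)
    (h : G.edgesAt X = G.edgesAt Y) : X = Y := by
  have key : ∀ {X Y : Finset ℕ}, X ⊆ range G.m → G.edgesAt X = G.edgesAt Y → X ⊆ Y := by
    intro X Y hX h i hi
    have hm := mem_range.1 (hX hi)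
    obtain ⟨j, hj, hjY, he⟩ := mem_edgesAt.1 (h ▸ mem_edgesAt.2 ⟨i, hm, hi, rfl⟩)
    have := G.edge_injective he
    simp only [Fin.mk.injEq] at this
    exact this ▸ hjY
  exact (key hX h).antisymm (key hY h.symm)

theorem exists_eq_edgesAt {F : Finset (Sym2 (Fin G.n))} (hF : (F : Set _) ⊆ G.graph.edgeSet) :
    ∃ X ⊆ range G.m, G.edgesAt X = F := by
  classical
  refine ⟨(range G.m).filter fun i => ∃ h : i < G.m, G.edge ⟨i, h⟩ ∈ F, filter_subset _ _, ?_⟩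
  ext e
  simp only [mem_edgesAt, mem_filter, mem_range]
  constructor
  · rintro ⟨i, h, ⟨_, _, hi⟩, rfl⟩
    exact hi
  · intro he
    have := hF he
    rw [graph, SimpleGraph.edgeSet_fromEdgeSet] at this
    obtain ⟨⟨i, rfl⟩, -⟩ := this
    exact ⟨i, i.2, ⟨i.2, i.2, he⟩, rfl⟩

theorem edgesAt_erase (h : i < G.m) :
    G.edgesAt (X.erase i : Finset ℕ) = (G.edgesAt X).erase (G.edge ⟨i, h⟩) := by
  ext e
  simp only [mem_edgesAt, mem_erase]
  constructor
  · rintro ⟨j, hj, ⟨hji, hjX⟩, rfl⟩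
    refine ⟨fun he => hji ?_, j, hj, hjX, rfl⟩
    simpa using G.edge_injective he
  · rintro ⟨hne, j, hj, hjX, rfl⟩
    refine ⟨j, hj, ⟨?_, hjX⟩, rfl⟩
    rintro rfl
    exact hne rfl

theorem edgesAt_mem_solutions (hX : X ⊆ range G.m) :
    G.edgesAt X ∈ G.solutions ↔ G.IsMinCEDS X := by
  rw [solutions, Set.mem_ofPred_eq, IsMinimalConnectedEDS, isConnectedEDS_edgesAt hX, IsMinCEDS]
  refine and_congr_right fun _ => ⟨fun h i hi => ?_, fun h e he => ?_⟩
  · have hm := mem_range.1 (hX hi)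
    have := h _ (mem_edgesAt.2 ⟨i, hm, hi, rfl⟩)
    rwa [← isConnectedEDS_edgesAt ((erase_subset _ _).trans hX), edgesAt_erase hm]
  · obtain ⟨i, hm, hi, rfl⟩ := mem_edgesAt.1 he
    rw [← edgesAt_erase hm, isConnectedEDS_edgesAt ((erase_subset _ _).trans hX)]
    exact h i hi

theorem exists_of_mem_solutions {F : Finset (Sym2 (Fin G.n))} (hF : F ∈ G.solutions) :
    ∃ X, G.IsMinCEDS X ∧ G.edgesAt X = F := by
  obtain ⟨X, hX, rfl⟩ := exists_eq_edgesAt hF.1.subset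
  exact ⟨X, (edgesAt_mem_solutions hX).1 hF, rfl⟩

theorem Admissible.two_le (hG : G.Admissible) (hX : G.IsCEDS X) : 2 ≤ #X := by
  rw [← card_edgesAt hX.sub]
  exact hG.2 _ ((isConnectedEDS_edgesAt hX.sub).2 hX)

theorem Admissible.reach (hG : G.Admissible) (hu : u < G.n) (hv : v < G.n) :
    G.Reach (range G.m) u v := by
  rw [← reachable_iff_reach ⟨u, hu⟩ ⟨v, hv⟩]
  convert hG.1.preconnected ⟨u, hu⟩ ⟨v, hv⟩ using 1
  ext a b
  rw [adj_iff_edgesAt, graph_adj]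
  exact ⟨fun ⟨i, _, hi⟩ => ⟨i, hi⟩, fun ⟨i, hi⟩ => ⟨i, mem_range.2 hi.lt_m, hi⟩⟩

theorem Admissible.n_pos (hG : G.Admissible) : 1 ≤ G.n := by
  obtain ⟨v⟩ := hG.1.nonempty
  exact v.pos

theorem Admissible.two_le_m (hG : G.Admissible) : 2 ≤ G.m := by
  have : G.IsCEDS (range G.m) := ⟨subset_rfl, fun u hu v hv =>
    hG.reach (mem_range.1 (cov_subset_range hu)) (mem_range.1 (cov_subset_range hv)),
    fun i u v hi => .inl (hi.mem_cov (mem_range.2 hi.lt_m))⟩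
  simpa using hG.two_le this

theorem Admissible.n_le (hG : G.Admissible) : G.n ≤ G.m + 1 := by
  have h := card_cov_le (G := G) (X := range G.m) subset_rfl (by
    have := hG.two_le_m
    simp; omega) fun u hu v hv =>
    hG.reach (mem_range.1 (cov_subset_range hu)) (mem_range.1 (cov_subset_range hv))
  rw [card_range] at h
  refine le_trans ?_ h
  conv_lhs => rw [← card_range G.n]
  refine card_le_card fun v hv => ?_
  have hm := hG.two_le_m
  obtain ⟨a, b, hab⟩ := exists_joins (G := G) (i := 0) (by omega)
  by_cases hva : v = a
  · exact hva ▸ hab.mem_cov (by simp; omega)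
  · exact (hG.reach (mem_range.1 hv) hab.lt_left).mem_cov hva

theorem card_le_maxDeg {W : Finset ℕ} (h : ∀ z ∈ W, ∃ i, G.Joins i w z) : #W ≤ G.maxDeg := by
  classical
  obtain rfl | ⟨z₀, hz₀⟩ := W.eq_empty_or_nonempty
  · simp
  obtain ⟨i₀, hi₀⟩ := h z₀ hz₀
  rw [maxDeg]
  refine le_trans ?_ (SimpleGraph.degree_le_maxDegree G.graph ⟨w, hi₀.lt_left⟩)
  rw [← SimpleGraph.card_neighborFinset_eq_degree, ← card_map Fin.valEmbedding]
  refine card_le_card fun z hz => ?_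
  obtain ⟨i, hi⟩ := h z hz
  simp only [mem_map, SimpleGraph.mem_neighborFinset, Fin.valEmbedding_apply]
  exact ⟨⟨z, hi.lt_right⟩, (graph_adj _ _).2 ⟨i, hi⟩, rfl⟩

theorem Admissible.one_le_maxDeg (hG : G.Admissible) : 1 ≤ G.maxDeg := by
  have hm := hG.two_le_m
  obtain ⟨a, b, hab⟩ := exists_joins (G := G) (i := 0) (by omega)
  simpa using card_le_maxDeg (W := {b}) (w := a) fun z hz => ⟨0, by simp_all⟩

theorem Admissible.sq_le (hG : G.Admissible) :
    G.m ^ 2 ≤ G.n * G.m ^ 2 * G.maxDeg :=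
  (Nat.le_mul_of_pos_left _ hG.n_pos).trans (Nat.le_mul_of_pos_right _ hG.one_le_maxDeg)

theorem Admissible.mul_le (hG : G.Admissible) : 2 * G.m ≤ G.n * G.m ^ 2 * G.maxDeg := by
  refine le_trans ?_ hG.sq_le
  rw [pow_two]
  exact Nat.mul_le_mul_right _ hG.two_le_m

theorem word_src (h : i < G.m) : G.word (i + i + 2) = G.src ⟨i, h⟩ := by
  have h1 : (i + i) / 2 = i := by omega
  have h2 : (i + i) % 2 = 0 := by omega
  simp [word, h1, h2, h]

theorem word_dst (h : i < G.m) : G.word (i + i + 3) = G.dst ⟨i, h⟩ := by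
  have h1 : (i + i + 1) / 2 = i := by omega
  have h2 : (i + i + 1) % 2 ≠ 0 := by omega
  change G.word (i + i + 1 + 2) = _
  simp only [word, h1, h, h2, ↓reduceDIte, ↓reduceIte]

end GraphInput

/-! ## Adjacency lists -/

/-- Number of vertices. -/
notation "rN" => 0
/-- Number of edges. -/
notation "rM" => 1
/-- Number of darts. -/
notation "rD" => 2
/-- Tails of the darts. -/
notation "aTail" => 0
/-- Heads of the darts. -/
notation "aHead" => 1
/-- Edges of the darts. -/
notation "aEdge" => 2
/-- Number of the first dart at a vertex. -/
notation "aFirst" => 3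

namespace RAM

open Finset

/-- An expression that is zero if and only if the two values agree. -/
def Exp.dist (a b : Exp) : Exp := .add (.sub a b) (.sub b a)

theorem Exp.ev_dist {I : Input} {ρ : Regs} {α : Arrs} {a b : Exp} :
    (Exp.dist a b).ev I ρ α = 0 ↔ a.ev I ρ α = b.ev I ρ α := by
  simp only [dist, ev]
  omega

theorem Exp.cost_dist {a b : Exp} : (Exp.dist a b).cost = 2 * a.cost + 2 * b.cost + 3 := by
  simp only [dist, cost]
  omega

/-- The darts (oriented edges) of `G`, sorted by tail: dart `d < D` leads from `T d` to `H d` along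
edge `E d`, and the darts with tail `v` are those from `S v` to `S (v + 1) - 1`. -/
structure Darts (G : GraphInput) (D : ℕ) (T H E S : ℕ → ℕ) : Prop where
  join : ∀ d < D, G.Joins (E d) (T d) (H d)
  complete : ∀ i u w, G.Joins i u w → ∃ d < D, E d = i ∧ T d = u ∧ H d = w
  first_le : ∀ v < G.n, S v ≤ S (v + 1)
  le_last : ∀ v < G.n, S (v + 1) ≤ D
  tail_eq : ∀ v < G.n, ∀ d < D, T d = v ↔ S v ≤ d ∧ d < S (v + 1)
  inj : ∀ d < D, ∀ d' < D, T d = T d' → E d = E d' → d = d'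

/-- The darts that precede those at `v` with edge number `i`. -/
structure DartsUpTo (G : GraphInput) (v i D : ℕ) (T H E S : ℕ → ℕ) : Prop where
  join : ∀ d < D, G.Joins (E d) (T d) (H d)
  complete : ∀ j u w, G.Joins j u w → u < v ∨ (u = v ∧ j < i) → ∃ d < D, E d = j ∧ T d = u ∧ H d = w
  before : ∀ d < D, T d < v ∨ (T d = v ∧ E d < i)
  first_le : ∀ u < v, S u ≤ S (u + 1)
  le_last : ∀ u ≤ v, S u ≤ D
  tail_eq : ∀ u < v, ∀ d < D, T d = u ↔ S u ≤ d ∧ d < S (u + 1)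
  tail_eq_last : ∀ d < D, T d = v ↔ S v ≤ d
  inj : ∀ d < D, ∀ d' < D, T d = T d' → E d = E d' → d = d'

variable {G : GraphInput} {D : ℕ} {T H E S : ℕ → ℕ}

theorem DartsUpTo.darts (h : DartsUpTo G G.n 0 D T H E S) : Darts G D T H E S where
  join := h.join
  complete i u w hi := h.complete i u w hi (.inl hi.lt_left)
  first_le := h.first_le
  le_last _ hv := h.le_last _ hv
  tail_eq := h.tail_eq
  inj := h.inj

theorem DartsUpTo.skip {v i : ℕ} (h : DartsUpTo G v i D T H E S) (hi : ∀ w, ¬ G.Joins i v w) :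
    DartsUpTo G v (i + 1) D T H E S where
  join := h.join
  complete j u w hj hu := h.complete j u w hj (by
    obtain hu | ⟨rfl, hu⟩ := hu
    · exact .inl hu
    · have : j ≠ i := by
        rintro rfl
        exact hi w hj
      exact .inr ⟨rfl, by omega⟩)
  before d hd := by
    have := h.before d hd
    omega
  first_le := h.first_le
  le_last := h.le_last
  tail_eq := h.tail_eq
  tail_eq_last := h.tail_eq_last
  inj := h.inj

theorem DartsUpTo.push {v i w : ℕ} (h : DartsUpTo G v i D T H E S) (hi : G.Joins i v w) :
    DartsUpTo G v (i + 1) (D + 1) (Function.update T D v) (Function.update H D w)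
      (Function.update E D i) S := by
  have hD : ∀ d < D + 1, d = D ∨ d < D := by omega
  have key : ∀ (f : ℕ → ℕ) x, ∀ d < D, Function.update f D x d = f d := fun f x d hd =>
    Function.update_of_ne hd.ne _ _
  constructor
  · intro d hd
    obtain rfl | hd := hD d hd
    · simpa using hi
    · simpa [key _ _ d hd] using h.join d hd
  · intro j u z hj hu
    by_cases hji : u = v ∧ j = i
    · obtain ⟨rfl, rfl⟩ := hji
      exact ⟨D, by omega, by simp [hi.right_eq hj]⟩
    · obtain ⟨d, hd, h'⟩ := h.complete j u z hj (by omega)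
      exact ⟨d, by omega, by simpa [key _ _ d hd] using h'⟩
  · intro d hd
    obtain rfl | hd := hD d hd
    · simp
    · have := h.before d hd
      simp only [key _ _ d hd]
      omega
  · exact h.first_le
  · intro u hu
    have := h.le_last u hu
    omega
  · intro u hu d hd
    obtain rfl | hd := hD d hd
    · have := h.le_last (u + 1) hu
      simp
      omega
    · simpa [key _ _ d hd] using h.tail_eq u hu d hd
  · intro d hd
    obtain rfl | hd := hD d hd
    · simpa using h.le_last v le_rfl
    · simpa [key _ _ d hd] using h.tail_eq_last d hd
  · have hne : ∀ d < D, T d = v → E d ≠ i := fun d hd h1 h2 => by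
      have := h.before d hd
      omega
    intro d hd d' hd' h1 h2
    obtain rfl | hd := hD d hd <;> obtain h' | hd' := hD d' hd'
    · exact h'.symm
    · simp only [key _ _ d' hd', Function.update_self] at h1 h2
      exact absurd h2.symm (hne d' hd' h1.symm)
    · subst h'
      simp only [key _ _ d hd, Function.update_self] at h1 h2
      exact absurd h2 (hne d hd h1)
    · simp only [key _ _ d hd, key _ _ d' hd'] at h1 h2
      exact h.inj d hd d' hd' h1 h2

theorem DartsUpTo.next {v : ℕ} (h : DartsUpTo G v G.m D T H E S) :
    DartsUpTo G (v + 1) 0 D T H E (Function.update S (v + 1) D) := by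
  have key : ∀ u ≤ v, Function.update S (v + 1) D u = S u := fun u hu =>
    Function.update_of_ne (by omega) _ _
  constructor
  · exact h.join
  · intro j u w hj hu
    have := hj.lt_m
    exact h.complete j u w hj (by omega)
  · intro d hd
    have := h.before d hd
    omega
  · intro u hu
    rw [key u (by omega)]
    obtain rfl | hu : u = v ∨ u < v := by omega
    · simpa using h.le_last u le_rfl
    · rw [key _ hu]
      exact h.first_le u hu
  · intro u hu
    obtain rfl | hu : u = v + 1 ∨ u ≤ v := by omega
    · simp
    · rw [key u hu]
      exact h.le_last u hu
  · intro u hu d hd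
    rw [key u (by omega)]
    obtain rfl | hu : u = v ∨ u < v := by omega
    · simpa [hd] using h.tail_eq_last d hd
    · rw [key _ hu]
      exact h.tail_eq u hu d hd
  · intro d hd
    have := h.before d hd
    simp only [Function.update_self]
    omega
  · exact h.inj

theorem Darts.card_filter_le (h : Darts G D T H E S) (X : Finset ℕ) :
    #((range D).filter fun d => E d ∈ X) ≤ 2 * #X := by
  have : #((range D).filter fun d => E d ∈ X) ≤ #(X ×ˢ range 2) := by
    refine card_le_card_of_injOn (fun d => (E d, if T d < H d then 1 else 0)) ?_ ?_
    · intro d hd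
      simp only [coe_filter, mem_range, Set.mem_ofPred_eq] at hd
      simp only [coe_product, coe_range, Set.mem_prod, Set.mem_Iio, mem_coe]
      exact ⟨hd.2, by split_ifs <;> omega⟩
    · intro d hd d' hd' he
      simp only [coe_filter, mem_range, Set.mem_ofPred_eq, Prod.mk.injEq] at hd hd' he
      refine h.inj d hd.1 d' hd'.1 ?_ he.1
      have h1 := h.join d hd.1
      have h2 := h.join d' hd'.1
      have := (he.1 ▸ h1).ends h2
      have := h1.ne
      have := he.2
      split_ifs at this <;> omega
  simpa [mul_comm] using this

theorem Darts.le (h : Darts G D T H E S) : D ≤ 2 * G.m := by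
  have := h.card_filter_le (range G.m)
  rwa [filter_true_of_mem fun d hd => mem_range.2 (h.join d (mem_range.1 hd)).lt_m, card_range,
    card_range] at this

theorem Darts.last_sub_first_le (h : Darts G D T H E S) {v : ℕ} (hv : v < G.n) :
    S (v + 1) - S v ≤ G.maxDeg := by
  have hl := h.le_last v hv
  have hT : ∀ d, S v ≤ d → d < S (v + 1) → G.Joins (E d) v (H d) := fun d h1 h2 => by
    have := h.join d (by omega)
    rwa [(h.tail_eq v hv d (by omega)).2 ⟨h1, h2⟩] at this
  rw [← Nat.card_Ico, ← card_image_of_injOn (f := H)]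
  · refine GraphInput.card_le_maxDeg (w := v) fun z hz => ?_
    obtain ⟨d, hd, rfl⟩ := mem_image.1 hz
    rw [mem_Ico] at hd
    exact ⟨_, hT d hd.1 hd.2⟩
  · intro d hd d' hd' he
    simp only [coe_Ico, Set.mem_Ico] at hd hd'
    refine h.inj d (by omega) d' (by omega) ?_ ?_
    · rw [(h.tail_eq v hv d (by omega)).2 hd, (h.tail_eq v hv d' (by omega)).2 hd']
    · exact (hT d hd.1 hd.2).unique (he ▸ hT d' hd'.1 hd'.2)

/-- The memory holds the darts of `G`. -/
structure Env (G : GraphInput) (ρ : Regs) (α : Arrs) : Prop where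
  n_eq : ρ rN = G.n
  m_eq : ρ rM = G.m
  darts : Darts G (ρ rD) (α aTail) (α aHead) (α aEdge) (α aFirst)

/-- `c` does not change the darts. -/
def KeepsEnv (c : Cmd) : Bool :=
  !(c.wr rN || c.wr rM || c.wr rD || c.wa aTail || c.wa aHead || c.wa aEdge || c.wa aFirst)

theorem Env.of_frame {c : Cmd} {ρ : Regs} {α : Arrs} {ρ' : Regs} {α' : Arrs} (h : Env G ρ α)
    (hF : Frame c ρ α ρ' α') (hc : KeepsEnv c = true := by rfl) : Env G ρ' α' := by
  simp only [KeepsEnv, Bool.not_eq_true', Bool.or_eq_false_iff] at hc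
  obtain ⟨⟨⟨⟨⟨⟨h1, h2⟩, h3⟩, h4⟩, h5⟩, h6⟩, h7⟩ := hc
  refine ⟨(hF.1 _ h1).trans h.1, (hF.1 _ h2).trans h.2, ?_⟩
  rw [hF.1 _ h3, hF.2 _ h4, hF.2 _ h5, hF.2 _ h6, hF.2 _ h7]
  exact h.3

/-- First endpoint of the edge in register `x`. -/
def Exp.src (x : ℕ) : Exp := .inp (.add (.add (.reg x) (.reg x)) (.const 2))

/-- Second endpoint of the edge in register `x`. -/
def Exp.dst (x : ℕ) : Exp := .inp (.add (.add (.reg x) (.reg x)) (.const 3))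

def buildDarts : Cmd := block [
  .assign rN (.inp (.const 0)),
  .assign rM (.inp (.const 1)),
  loop 6 (.const 0) (.reg rN) (block [
    loop 7 (.const 0) (.reg rM) (block [
      .assign 8 (.const 0),
      .ite (.dist (.src 7) (.reg 6)) .skip (.assign 8 (.add (.dst 7) (.const 1))),
      .ite (.dist (.dst 7) (.reg 6)) .skip (.assign 8 (.add (.src 7) (.const 1))),
      .ite (.reg 8) (block [
        .store aTail (.reg rD) (.reg 6),
        .store aHead (.reg rD) (.sub (.reg 8) (.const 1)),
        .store aEdge (.reg rD) (.reg 7),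
        .assign rD (.add (.reg rD) (.const 1))]) .skip]),
    .store aFirst (.add (.reg 6) (.const 1)) (.reg rD)])]

theorem buildDarts_run {I : Input} (hI : I.word = G.word) {ρ : Regs} {α : Arrs} (hD : ρ rD = 0)
    (hF : α aFirst 0 = 0) :
    Run I buildDarts ρ α fun t ρ' α' => t ≤ 200 * (G.n + 1) * (G.m + 1) ∧ Env G ρ' α' := by
  refine Run.cons (Q₁ := fun t ρ' α' => t = 3 ∧ ρ' = Function.update ρ rN G.n ∧ α' = α)
    (Run.of_wp (by simp [wp, Exp.ev, Exp.cost, hI, GraphInput.word])) ?_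
  rintro _ _ α - ⟨rfl, rfl, rfl⟩
  refine Run.cons (Q₁ := fun t ρ' α' => t = 3 ∧ ρ' rN = G.n ∧ ρ' rM = G.m ∧ ρ' rD = 0 ∧ α' = α)
    (Run.of_wp (by simp [wp, Exp.ev, Exp.cost, hI, GraphInput.word, hD])) ?_
  rintro _ ρ α - ⟨rfl, hn, hm, hD, rfl⟩
  refine Run.cons (Run.loop_uniform (100 * (G.m + 1)) (L := 0) (B := G.n)
    (fun v ρ α => DartsUpTo G v 0 (ρ rD) (α aTail) (α aHead) (α aEdge) (α aFirst))
    (Q := fun t ρ' α' => t ≤ G.n * (100 * (G.m + 1) + 8) + 6 ∧ Env G ρ' α')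
    rfl (Nat.zero_le _) ?_ rfl (fun i ρ' α' hF _ _ _ => (hF.reg rN).trans hn) ?_ ?_) ?_
  · have h0 : Function.update ρ 6 0 rD = 0 := by simpa using hD
    rw [h0]
    constructor <;> simp [hF]
  · intro v ρ₁ α₁ _ hv hv' hF₁ hI₁
    refine Run.cons (Run.loop_uniform 80 (L := 0) (B := G.m)
      (fun i ρ α => DartsUpTo G v i (ρ rD) (α aTail) (α aHead) (α aEdge) (α aFirst))
      (Q := fun t ρ' α' => t ≤ G.m * 88 + 6 ∧
        DartsUpTo G v G.m (ρ' rD) (α' aTail) (α' aHead) (α' aEdge) (α' aFirst))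
      rfl (Nat.zero_le _) (by simpa using hI₁) rfl
      (fun i ρ' α' hF _ _ _ => (hF.reg rM).trans ((hF₁.reg rM).trans hm)) ?_ ?_) ?_
    · intro i ρ₂ α₂ _ hi hi' hF₂ hI₂
      refine Run.of_wp ?_
      have h6 : ρ₂ 6 = v := (hF₂.reg 6).trans hv'
      have hs : I.word (i + i + 2) = G.src ⟨i, hi⟩ := by rw [hI, GraphInput.word_src]
      have hd : I.word (i + i + 3) = G.dst ⟨i, hi⟩ := by rw [hI, GraphInput.word_dst]
      have hne : (G.src ⟨i, hi⟩ : ℕ) ≠ G.dst ⟨i, hi⟩ := fun h => G.src_ne_dst _ (Fin.ext h)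
      simp only [block, wp, Exp.ev_dist, ne_eq, Exp.ev, Exp.src, Exp.dst, Exp.cost,
        Function.update_self, Function.update_apply, hi', h6, Exp.cost_dist]
      by_cases h1 : (G.src ⟨i, hi⟩ : ℕ) = v
      · have h2 : ¬ (G.dst ⟨i, hi⟩ : ℕ) = v := fun h2 => hne (h1.trans h2.symm)
        simpa [h1, h2, hs, hd] using hI₂.push ⟨hi, .inl ⟨h1, rfl⟩⟩
      · by_cases h2 : (G.dst ⟨i, hi⟩ : ℕ) = v
        · simpa [h1, h2, hs, hd] using hI₂.push ⟨hi, .inr ⟨h2, rfl⟩⟩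
        · simpa [h1, h2, hs, hd] using hI₂.skip fun w => by
            rintro ⟨_, ⟨h, -⟩ | ⟨h, -⟩⟩
            · exact h1 h
            · exact h2 h
    · intro t ρ' α' hF' _ h ht
      simp only [Exp.cost] at ht
      exact ⟨by omega, h⟩
    · rintro t ρ' α' hF' ⟨ht, h⟩
      have h6 : ρ' 6 = v := (hF'.reg 6).trans hv'
      refine Run.of_wp ?_
      simp only [block, wp, Exp.ev, Exp.cost, h6]
      refine ⟨by omega, ?_⟩
      simpa using h.next
  · intro t ρ' α' hF' _ h ht
    simp only [Exp.cost] at ht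
    exact ⟨by omega, (hF'.reg rN).trans hn, (hF'.reg rM).trans hm, h.darts⟩
  · rintro t ρ' α' - ⟨ht, h⟩
    refine Run.nil ⟨?_, h⟩
    nlinarith

end RAM

/-! ## Spanning trees of components -/

/-- Edges of the graph that is searched. -/
notation "aSearch" => 4
/-- Vertices that have been reached. -/
notation "aReach" => 5
/-- Edges of a spanning tree. -/
notation "aSpan" => 6

namespace RAM

open Finset

/-- The positions below `m` at which `f` is nonzero. -/
def supp (m : ℕ) (f : ℕ → ℕ) : Finset ℕ := (range m).filter fun i => f i ≠ 0

theorem mem_supp {m i : ℕ} {f : ℕ → ℕ} : i ∈ supp m f ↔ i < m ∧ f i ≠ 0 := by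
  simp [supp]

theorem eq_zero_iff_notMem_supp {m i : ℕ} {f : ℕ → ℕ} (hi : i < m) : f i = 0 ↔ i ∉ supp m f := by
  simp [mem_supp, hi]

theorem supp_subset {m : ℕ} {f : ℕ → ℕ} : supp m f ⊆ range m := filter_subset _ _

theorem supp_update_one {m i : ℕ} {f : ℕ → ℕ} (hi : i < m) :
    supp m (Function.update f i 1) = insert i (supp m f) := by
  ext j
  by_cases h : j = i <;> simp [mem_supp, h, hi]

theorem supp_update_zero {m i : ℕ} {f : ℕ → ℕ} :
    supp m (Function.update f i 0) = (supp m f).erase i := by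
  ext j
  by_cases h : j = i <;> simp [mem_supp, h]

/-- Clear the first entries of array `a`. -/
def clear (a x b : ℕ) : Cmd := loop x (.const 0) (.reg b) (.store a (.reg x) (.const 0))

theorem clear_run {I : Input} {ρ : Regs} {α : Arrs} {a x b : ℕ} (hxb : x ≠ b) :
    Run I (clear a x b) ρ α fun t _ α' => t ≤ ρ b * 11 + 6 ∧ supp (ρ b) (α' a) = ∅ := by
  have hwr : (clear a x b).wr b = false := by
    simp [clear, loop, Cmd.wr, hxb.symm]
  refine Run.loop_uniform 3 (L := 0) (B := ρ b) (fun i ρ' α' => ∀ j < i, α' a j = 0) rfl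
    (Nat.zero_le _) (by simp) rfl (fun i ρ' α' hF _ _ _ => hF.1 _ hwr) ?_ ?_
  · intro i ρ' α' _ hi hx _ h
    refine Run.of_wp ⟨by simp [Exp.cost], fun j hj => ?_⟩
    simp only [Exp.ev, hx, Function.update_self, Function.update_apply]
    split_ifs with h'
    · rfl
    · exact h j (by omega)
  · intro t ρ' α' _ _ h ht
    simp only [Exp.cost] at ht
    refine ⟨by omega, ?_⟩
    ext i
    simp only [mem_supp, notMem_empty, iff_false]
    exact fun h' => h'.2 (h i h'.1)

/-- The tail of the dart in register `x`. -/
def Exp.tail (x : ℕ) : Exp := .arr aTail (.reg x)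
/-- The head of the dart in register `x`. -/
def Exp.head (x : ℕ) : Exp := .arr aHead (.reg x)
/-- The edge of the dart in register `x`. -/
def Exp.edge (x : ℕ) : Exp := .arr aEdge (.reg x)

/-- Traverse the dart in register `9` if it leads to a new vertex. -/
def searchDart : Cmd :=
  .ite (.arr aSearch (.edge 9)) (.ite (.arr aReach (.tail 9)) (.ite (.arr aReach (.head 9)) .skip
    (block [.store aReach (.head 9) (.const 1), .store aSpan (.edge 9) (.const 1)])) .skip) .skip

/-- Search the graph with edge set `aSearch` from the vertex in register `10`. -/
def search : Cmd := block [
  clear aReach 7 rN,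
  clear aSpan 7 rM,
  .store aReach (.reg 10) (.const 1),
  loop 8 (.const 0) (.reg rN) (loop 9 (.const 0) (.reg rD) searchDart)]

variable {G : GraphInput} {S R T : Finset ℕ} {r : ℕ}

/-- `T` is a tree of edges of `S` that connects the set `R` of vertices, which contains `r`. -/
structure SearchInv (G : GraphInput) (S : Finset ℕ) (r : ℕ) (R T : Finset ℕ) : Prop where
  root : r ∈ R
  reach : ∀ v ∈ R, G.Reach S r v
  sub : T ⊆ S
  tree : (T = ∅ ∧ R = {r}) ∨ (G.IsTree T ∧ G.cov T = R)

theorem SearchInv.step (h : SearchInv G S r R T) {i a b : ℕ} (hi : G.Joins i a b) (hiS : i ∈ S)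
    (ha : a ∈ R) (hb : b ∉ R) : SearchInv G S r (insert b R) (insert i T) := by
  refine ⟨mem_insert_of_mem h.root, ?_, insert_subset hiS h.sub, .inr ?_⟩
  · simp only [mem_insert, forall_eq_or_imp]
    exact ⟨(h.reach a ha).trans (hi.reach hiS), h.reach⟩
  · obtain ⟨rfl, rfl⟩ | ⟨h1, rfl⟩ := h.tree
    · obtain rfl := mem_singleton.1 ha
      have := GraphInput.isTree_singleton hi
      rw [insert_empty_eq, this.2]
      exact ⟨this.1, by ext; simp [or_comm]⟩
    · exact h1.pendant hi ha hb

/-- No edge of `S` leaves `R`. -/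
def Closed (G : GraphInput) (S R : Finset ℕ) : Prop :=
  ∀ i ∈ S, ∀ a b, G.Joins i a b → a ∈ R → b ∈ R

theorem SearchInv.mem_iff (h : SearchInv G S r R T) (hc : Closed G S R) (v : ℕ) :
    v ∈ R ↔ G.Reach S r v := by
  refine ⟨h.reach v, fun hv => ?_⟩
  by_contra hvR
  obtain ⟨i, hi, a, b, hab, ha, hb⟩ := hv.exists_crossing (· ∈ R) h.root hvR
  exact hb (hc i hi a b hab ha)

theorem searchDart_run {I : Input} {ρ : Regs} {α : Arrs} {d : ℕ} (hx : ρ 9 = d)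
    (hj : G.Joins (α aEdge d) (α aTail d) (α aHead d)) :
    Run I searchDart ρ α fun t _ α' => t ≤ 52 ∧
      if α aEdge d ∈ supp G.m (α aSearch) ∧ α aTail d ∈ supp G.n (α aReach) ∧
        α aHead d ∉ supp G.n (α aReach)
      then supp G.n (α' aReach) = insert (α aHead d) (supp G.n (α aReach)) ∧
        supp G.m (α' aSpan) = insert (α aEdge d) (supp G.m (α aSpan))
      else α' = α := by
  refine Run.of_wp ?_
  have h1 := eq_zero_iff_notMem_supp (f := α aSearch) hj.lt_m
  have h2 := eq_zero_iff_notMem_supp (f := α aReach) hj.lt_left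
  have h3 := eq_zero_iff_notMem_supp (f := α aReach) hj.lt_right
  simp only [searchDart, block, wp, Exp.ev, Exp.edge, Exp.head, Exp.tail, Exp.cost, hx, ne_eq,
    h1, h2, h3, not_not]
  refine ⟨fun hs => ⟨fun ht => ⟨fun hh => ?_, fun hh => ?_⟩, fun ht => ?_⟩, fun hs => ?_⟩
  · simp [hh]
  · simp [hs, ht, hh, supp_update_one hj.lt_right, supp_update_one hj.lt_m]
  · simp [ht]
  · simp [hs]

theorem search_run {I : Input} {ρ : Regs} {α : Arrs} (hE : Env G ρ α) (hr : ρ 10 = r)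
    (hrn : r < G.n) (hS : supp G.m (α aSearch) = S) :
    Run I search ρ α fun t _ α' => t ≤ 200 * (G.n + 1) * (G.m + 1) ∧
      Closed G S (supp G.n (α' aReach)) ∧
      SearchInv G S r (supp G.n (α' aReach)) (supp G.m (α' aSpan)) := by
  refine Run.cons (clear_run (by decide)) ?_
  rintro t₁ ρ₁ α₁ hF₁ ⟨ht₁, h₁⟩
  have hE₁ := hE.of_frame hF₁
  rw [hE.n_eq] at ht₁ h₁
  refine Run.cons (clear_run (by decide)) ?_
  rintro t₂ ρ₂ α₂ hF₂ ⟨ht₂, h₂⟩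
  have hE₂ := hE₁.of_frame hF₂
  rw [hE₁.m_eq] at ht₂ h₂
  have hr₂ : ρ₂ 10 = r := (hF₂.reg 10).trans ((hF₁.reg 10).trans hr)
  refine Run.cons (Q₁ := fun t ρ' α' => t = 3 ∧ ρ' = ρ₂ ∧
    SearchInv G S r (supp G.n (α' aReach)) (supp G.m (α' aSpan))) (Run.of_wp ?_) ?_
  · simp only [wp, Exp.cost, Exp.ev, hr₂, true_and]
    have h3 : α₂ aReach = α₁ aReach := hF₂.arr _
    have h4 : supp G.n (Function.update (α₂ aReach) r 1) = {r} := by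
      rw [supp_update_one hrn, h3, h₁]; rfl
    have h5 : supp G.m (Function.update α₂ aReach (Function.update (α₂ aReach) r 1) aSpan) = ∅ := by
      rw [Function.update_of_ne (by decide), h₂]
    rw [Function.update_self, h4, h5]
    exact ⟨by simp, by simpa using .refl, by simp, .inl ⟨rfl, rfl⟩⟩
  rintro _ ρ₃ α₃ hF₃ ⟨rfl, -, h₃⟩
  have hE₃ := hE₂.of_frame hF₃
  have hS₃ : supp G.m (α₃ aSearch) = S := by
    rw [hF₃.arr aSearch, hF₂.arr aSearch, hF₁.arr aSearch, hS]
  refine Run.cons (Run.loop_uniform (2 * G.m * 60 + 6) (L := 0) (B := G.n) (fun j _ α' =>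
    SearchInv G S r (supp G.n (α' aReach)) (supp G.m (α' aSpan)) ∧
      (Closed G S (supp G.n (α' aReach)) ∨ j < #(supp G.n (α' aReach))))
    (Q := fun t _ α' => t ≤ G.n * (2 * G.m * 60 + 14) + 6 ∧ Closed G S (supp G.n (α' aReach)) ∧
      SearchInv G S r (supp G.n (α' aReach)) (supp G.m (α' aSpan)))
    rfl (Nat.zero_le _) ⟨h₃, .inr (card_pos.2 ⟨r, h₃.root⟩)⟩ rfl
    (fun i ρ' α' hF _ _ _ => (hF.reg rN).trans hE₃.n_eq) ?_ ?_) ?_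
  · rintro j ρ₄ α₄ _ hj - hF₄ ⟨h₄, h₄'⟩
    have hE₄ := hE₃.of_frame hF₄
    refine Run.loop_uniform 52 (L := 0) (B := ρ₄ rD) (fun d _ α' =>
      SearchInv G S r (supp G.n (α' aReach)) (supp G.m (α' aSpan)) ∧
      ((supp G.n (α' aReach) = supp G.n (α₄ aReach) ∧ ∀ d' < d, α₄ aEdge d' ∈ S →
          α₄ aTail d' ∈ supp G.n (α₄ aReach) → α₄ aHead d' ∈ supp G.n (α₄ aReach)) ∨
        (#(supp G.n (α₄ aReach)) < #(supp G.n (α' aReach)) ∧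
          ¬ Closed G S (supp G.n (α₄ aReach)))))
      rfl (Nat.zero_le _) ⟨h₄, .inl ⟨rfl, by simp⟩⟩ rfl
      (fun i ρ' α' hF _ _ _ => hF.reg rD) ?_ ?_
    · rintro d ρ₅ α₅ _ hd hx hF₅ ⟨h₅, h₅'⟩
      have hj := hE₄.darts.join d hd
      have hS₅ : supp G.m (α₅ aSearch) = S := by
        rw [hF₅.arr aSearch, hF₄.arr aSearch, hS₃]
      have hE : α₅ aEdge = α₄ aEdge := hF₅.arr _
      have hT : α₅ aTail = α₄ aTail := hF₅.arr _
      have hH : α₅ aHead = α₄ aHead := hF₅.arr _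
      refine (searchDart_run hx (by rwa [hE, hT, hH])).imp ?_
      rintro t ρ₆ α₆ - ⟨ht, h⟩
      rw [hS₅, hE, hT, hH] at h
      refine ⟨ht, ?_⟩
      split_ifs at h with hc
      · rw [h.1, h.2]
        refine ⟨h₅.step hj hc.1 hc.2.1 hc.2.2, .inr ?_⟩
        rw [card_insert_of_notMem hc.2.2]
        obtain ⟨h1, h2⟩ | ⟨h1, h2⟩ := h₅'
        · rw [← h1]
          exact ⟨by omega, fun hc' => hc.2.2 (hc' _ hc.1 _ _ hj hc.2.1)⟩
        · exact ⟨by omega, h2⟩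
      · subst h
        refine ⟨h₅, h₅'.imp_left fun ⟨h1, h2⟩ => ⟨h1, fun d' hd' => ?_⟩⟩
        obtain hd' | rfl : d' < d ∨ d' = d := by omega
        · exact h2 d' hd'
        · rw [h1] at hc
          tauto
    · rintro t ρ' α' hF' _ ⟨h5, h5'⟩ ht
      have hD := hE₄.darts.le
      simp only [Exp.cost] at ht
      refine ⟨by omega, h5, ?_⟩
      obtain ⟨h1, h2⟩ | ⟨h1, h2⟩ := h5'
      · left
        intro i hi a b hab ha
        rw [h1] at ha ⊢
        obtain ⟨d, hd, rfl, rfl, rfl⟩ := hE₄.darts.complete i a b hab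
        exact h2 d hd hi ha
      · right
        have := h₄'.resolve_left h2
        omega
  · rintro t ρ' α' hF' _ ⟨h5, h5'⟩ ht
    simp only [Exp.cost] at ht
    refine ⟨by omega, h5'.resolve_right fun h => ?_, h5⟩
    have := card_le_card (supp_subset (m := G.n) (f := α' aReach))
    rw [card_range] at this
    omega
  · rintro t ρ' α' - ⟨ht, h⟩
    refine Run.nil ⟨?_, h⟩
    nlinarith

end RAM

/-! ## Removing leaves of a tree -/

/-- The set of edges under construction. -/
notation "aSet" => 7
/-- Degrees. -/
notation "aDeg" => 8
/-- Vertices with a neighbour that is not covered. -/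
notation "aOpen" => 9

namespace RAM

open Finset

def countDegrees : Cmd := loop 12 (.const 0) (.reg rD)
  (.ite (.arr aSet (.edge 12)) (.store aDeg (.tail 12) (.add (.arr aDeg (.tail 12)) (.const 1)))
    .skip)

def markOpen : Cmd := loop 12 (.const 0) (.reg rD)
  (.ite (.arr aDeg (.head 12)) .skip (.store aOpen (.tail 12) (.const 1)))

/-- Remove all edges at the vertex in register `11`. -/
def dropVertex : Cmd :=
  loop 12 (.arr aFirst (.reg 11)) (.arr aFirst (.add (.reg 11) (.const 1)))
    (block [.store aOpen (.head 12) (.const 1), .store aSet (.edge 12) (.const 0)])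

def dropLeaves : Cmd := loop 11 (.const 0) (.reg rN)
  (.ite (.dist (.arr aDeg (.reg 11)) (.const 1)) .skip
    (.ite (.arr aOpen (.reg 11)) .skip dropVertex))

/-- Turn a tree in `aSet` that is an edge dominating set into a minimal one. -/
def minimize : Cmd := block [
  clear aDeg 11 rN, clear aOpen 11 rN, countDegrees, markOpen, dropLeaves]

variable {G : GraphInput} {I : Input} {ρ : Regs} {α : Arrs} {X : Finset ℕ}

theorem countDegrees_run (hE : Env G ρ α) (hX : supp G.m (α aSet) = X)
    (h0 : supp G.n (α aDeg) = ∅) :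
    Run I countDegrees ρ α fun t _ α' => t ≤ 80 * G.m + 10 ∧
      ∀ v < G.n, (α' aDeg v = 0 ↔ v ∉ G.cov X) ∧
        (α' aDeg v = 1 ↔ v ∈ G.cov X ∧ G.IsLeaf X v) := by
  refine Run.loop_uniform 30 (L := 0) (B := ρ rD) (fun d _ α' => ∀ v < G.n,
    α' aDeg v = #((range d).filter fun d' => α aTail d' = v ∧ α aEdge d' ∈ X)) rfl (Nat.zero_le _)
    ?_ rfl (fun i ρ' α' hF _ _ _ => hF.reg rD) ?_ ?_
  · intro v hv
    have : v ∉ supp G.n (α aDeg) := by simp [h0]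
    simpa using (eq_zero_iff_notMem_supp hv).2 this
  · intro d ρ₁ α₁ _ hd hx hF h
    have hj := hE.darts.join d hd
    have hT : α₁ aTail = α aTail := hF.arr _
    have hE' : α₁ aEdge = α aEdge := hF.arr _
    have hS : α₁ aSet = α aSet := hF.arr _
    have h1 := eq_zero_iff_notMem_supp (f := α aSet) hj.lt_m
    rw [hX] at h1
    refine Run.of_wp ?_
    simp only [wp, Exp.ev, Exp.edge, Exp.tail, Exp.cost, hx, hE', hT, hS, ne_eq, h1, not_not]
    refine ⟨fun hs => ⟨by norm_num, fun v hv => ?_⟩, fun hs => ⟨by norm_num, fun v hv => ?_⟩⟩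
    · rw [Function.update_self, range_add_one, filter_insert]
      by_cases hv' : α aTail d = v
      · rw [if_pos ⟨hv', hs⟩, card_insert_of_notMem (by simp), ← hv', Function.update_self,
          h _ hj.lt_left]
      · rw [if_neg (by tauto), Function.update_of_ne (Ne.symm hv'), h v hv]
    · rw [range_add_one, filter_insert, if_neg (by tauto), h v hv]
  · intro t ρ' α' hF _ h ht
    have hD := hE.darts.le
    simp only [Exp.cost] at ht
    refine ⟨by omega, fun v hv => ?_⟩
    rw [h v hv]
    have hcov : v ∈ G.cov X → 0 < #((range (ρ rD)).filter fun d' => α aTail d' = v ∧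
        α aEdge d' ∈ X) := by
      intro hc
      obtain ⟨i, hi, w, hw⟩ := GraphInput.mem_cov.1 hc
      obtain ⟨d, hd, rfl, rfl, rfl⟩ := hE.darts.complete i v w hw
      exact card_pos.2 ⟨d, by simp [hd, hi]⟩
    have hcov' : 0 < #((range (ρ rD)).filter fun d' => α aTail d' = v ∧
        α aEdge d' ∈ X) → v ∈ G.cov X := by
      intro hc
      obtain ⟨d, hd⟩ := card_pos.1 hc
      simp only [mem_filter, mem_range] at hd
      exact hd.2.1 ▸ (hE.darts.join d hd.1).mem_cov hd.2.2
    have hleaf : G.IsLeaf X v ↔ #((range (ρ rD)).filter fun d' => α aTail d' = v ∧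
        α aEdge d' ∈ X) ≤ 1 := by
      rw [card_le_one]
      simp only [mem_filter, mem_range]
      constructor
      · rintro hl a ⟨ha, ha', haX⟩ b ⟨hb, hb', hbX⟩
        refine hE.darts.inj a ha b hb (ha'.trans hb'.symm) ?_
        have h1 := hE.darts.join a ha
        have h2 := hE.darts.join b hb
        rw [ha'] at h1
        rw [hb'] at h2
        exact hl _ haX _ hbX _ _ h1 h2
      · intro hl i hi j hj u w hu hw
        obtain ⟨d, hd, rfl, hdv, -⟩ := hE.darts.complete i v u hu
        obtain ⟨d', hd', rfl, hdv', -⟩ := hE.darts.complete j v w hw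
        rw [hl d ⟨hd, hdv, hi⟩ d' ⟨hd', hdv', hj⟩]
    rw [hleaf]
    constructor
    · constructor
      · intro h0 hc
        have := hcov hc
        omega
      · intro hc
        by_contra h0
        exact hc (hcov' (by omega))
    · constructor
      · exact fun h1 => ⟨hcov' (by omega), h1.le⟩
      · rintro ⟨h1, h2⟩
        have := hcov h1
        omega

theorem markOpen_run (hE : Env G ρ α) (h : ∀ v < G.n, α aDeg v = 0 ↔ v ∉ G.cov X)
    (h0 : supp G.n (α aOpen) = ∅) :
    Run I markOpen ρ α fun t _ α' => t ≤ 80 * G.m + 10 ∧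
      ∀ v < G.n, α' aOpen v ≠ 0 ↔ ∃ i w, G.Joins i v w ∧ w ∉ G.cov X := by
  refine Run.loop_uniform 30 (L := 0) (B := ρ rD) (fun d _ α' => ∀ v < G.n,
    α' aOpen v ≠ 0 ↔ ∃ d' < d, α aTail d' = v ∧ α aHead d' ∉ G.cov X) rfl (Nat.zero_le _)
    ?_ rfl (fun i ρ' α' hF _ _ _ => hF.reg rD) ?_ ?_
  · intro v hv
    have : v ∉ supp G.n (α aOpen) := by simp [h0]
    simpa using (eq_zero_iff_notMem_supp hv).2 this
  · intro d ρ₁ α₁ _ hd hx hF hI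
    have hj := hE.darts.join d hd
    have hT : α₁ aTail = α aTail := hF.arr _
    have hH : α₁ aHead = α aHead := hF.arr _
    have hS : α₁ aDeg = α aDeg := hF.arr _
    refine Run.of_wp ?_
    simp only [wp, Exp.ev, Exp.head, Exp.tail, Exp.cost, hx, hT, hH, hS, ne_eq, h _ hj.lt_right,
      not_not, Nat.lt_succ_iff_lt_or_eq, or_and_right, exists_or, exists_eq_left]
    refine ⟨fun hs => ⟨by norm_num, fun v hv => ?_⟩, fun hs => ⟨by norm_num, fun v hv => ?_⟩⟩
    · rw [← ne_eq, hI v hv]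
      simp [hs]
    · rw [Function.update_self, Function.update_apply]
      split_ifs with hv'
      · simp [hv', hs]
      · rw [← ne_eq, hI v hv]
        simp [Ne.symm hv']
  · intro t ρ' α' hF _ h ht
    have hD := hE.darts.le
    simp only [Exp.cost] at ht
    refine ⟨by omega, fun v hv => (h v hv).trans ⟨?_, ?_⟩⟩
    · rintro ⟨d, hd, rfl, hd'⟩
      exact ⟨_, _, hE.darts.join d hd, hd'⟩
    · rintro ⟨i, w, hi, hw⟩
      obtain ⟨d, hd, rfl, rfl, rfl⟩ := hE.darts.complete i v w hi
      exact ⟨d, hd, rfl, hw⟩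

theorem dropVertex_run {v : ℕ} (hE : Env G ρ α) (hx : ρ 11 = v) (hv : v < G.n) :
    Run I dropVertex ρ α fun t _ α' => t ≤ 40 * (α aFirst (v + 1) - α aFirst v) + 20 ∧
      (∀ u < G.n, α' aOpen u ≠ 0 ↔ α aOpen u ≠ 0 ∨ ∃ i, G.Joins i v u) ∧
      ∀ i < G.m, α' aSet i ≠ 0 ↔ α aSet i ≠ 0 ∧ ¬ ∃ w, G.Joins i v w := by
  have hd0 : ∀ d, α aFirst v ≤ d → d < α aFirst (v + 1) →
      G.Joins (α aEdge d) v (α aHead d) := fun d h1 h2 => by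
    have hd : d < ρ rD := by
      have := hE.darts.le_last v hv
      omega
    have := hE.darts.join d hd
    rwa [(hE.darts.tail_eq v hv d hd).2 ⟨h1, h2⟩] at this
  refine Run.loop_uniform 20 (L := α aFirst v) (B := α aFirst (v + 1)) (fun d _ α' =>
    (∀ u, α' aOpen u ≠ 0 ↔ α aOpen u ≠ 0 ∨ ∃ d' < d, α aFirst v ≤ d' ∧ α aHead d' = u) ∧
    ∀ i, α' aSet i ≠ 0 ↔ α aSet i ≠ 0 ∧ ¬ ∃ d' < d, α aFirst v ≤ d' ∧ α aEdge d' = i)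
    (by simp [Exp.ev, hx]) (hE.darts.first_le v hv) ?_ rfl ?_ ?_ ?_
  · have : ∀ d, ¬ (d < α aFirst v ∧ α aFirst v ≤ d) := fun d => by omega
    simp only [← and_assoc, this, false_and, exists_false, or_false, not_false_eq_true, and_true,
      implies_true]
  · intro i ρ' α' hF _ _ _
    have h1 : ρ' 11 = v := (hF.reg 11).trans hx
    have h2 : α' aFirst = α aFirst := hF.arr _
    simp [Exp.ev, h1, h2]
  · rintro d ρ₁ α₁ hd' hd hx hF ⟨h1, h2⟩
    have hH : α₁ aHead = α aHead := hF.arr _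
    have hE' : α₁ aEdge = α aEdge := hF.arr _
    refine Run.of_wp ?_
    simp only [block, wp, Exp.ev, Exp.edge, Exp.head, Exp.cost, hx, Nat.lt_succ_iff_lt_or_eq,
      or_and_right, exists_or, exists_eq_left, hd', true_and]
    refine ⟨by norm_num, fun u => ?_, fun i => ?_⟩
    · rw [Function.update_of_ne (by decide), Function.update_self, Function.update_apply, hH]
      split_ifs with h
      · simp [h]
      · rw [h1]
        simp [Ne.symm h]
    · rw [Function.update_self, Function.update_of_ne (a := aEdge) (by decide),
        Function.update_of_ne (a := aSet) (by decide), Function.update_apply, hE']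
      split_ifs with h
      · simp [h]
      · rw [h2]
        simp [Ne.symm h]
  · rintro t ρ' α' hF _ ⟨h1, h2⟩ ht
    simp only [Exp.cost] at ht
    have key : ∀ i u, G.Joins i v u ↔ ∃ d < α aFirst (v + 1), α aFirst v ≤ d ∧ α aEdge d = i ∧
        α aHead d = u := by
      intro i u
      constructor
      · intro hi
        obtain ⟨d, hd, rfl, hdv, rfl⟩ := hE.darts.complete i v u hi
        have := (hE.darts.tail_eq v hv d hd).1 hdv
        exact ⟨d, this.2, this.1, rfl, rfl⟩
      · rintro ⟨d, h1, h2, rfl, rfl⟩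
        exact hd0 d h2 h1
    refine ⟨by omega, fun u _ => ?_, fun i _ => ?_⟩
    · rw [h1]
      simp only [key]
      refine or_congr_right ⟨?_, ?_⟩
      · rintro ⟨d, h⟩
        exact ⟨_, d, h.1, h.2.1, rfl, h.2.2⟩
      · rintro ⟨_, d, h⟩
        exact ⟨d, h.1, h.2.1, h.2.2.2⟩
    · rw [h2]
      simp only [key]
      refine and_congr_right fun _ => not_congr ⟨?_, ?_⟩
      · rintro ⟨d, h⟩
        exact ⟨_, d, h.1, h.2.1, h.2.2, rfl⟩
      · rintro ⟨_, d, h⟩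
        exact ⟨d, h.1, h.2.1, h.2.2.1⟩

/-- Invariant of the removal of leaves: the vertices below `v` have been treated. -/
structure DropInv (G : GraphInput) (X₀ : Finset ℕ) (v : ℕ) (X : Finset ℕ) (o : ℕ → ℕ) : Prop where
  sub : X ⊆ X₀
  tree : G.IsTree X
  dom : G.Dom X
  opn : ∀ u < G.n, o u ≠ 0 ↔ ∃ i w, G.Joins i u w ∧ w ∉ G.cov X
  after : ∀ u, v ≤ u → u < G.n → o u = 0 → u ∈ G.cov X₀ → u ∈ G.cov X ∧
    ∀ i ∈ X₀, ∀ w, G.Joins i u w → i ∈ X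
  before : ∀ u < v, u ∈ G.cov X → G.IsLeaf X u → o u ≠ 0

theorem DropInv.keep {X₀ : Finset ℕ} {v : ℕ} {o : ℕ → ℕ} (h : DropInv G X₀ v X o)
    (hv : o v ≠ 0 ∨ ¬ (v ∈ G.cov X₀ ∧ G.IsLeaf X₀ v)) : DropInv G X₀ (v + 1) X o := by
  refine ⟨h.sub, h.tree, h.dom, h.opn, fun u hu => h.after u (by omega), fun u hu hc hl => ?_⟩
  obtain hu | rfl : u < v ∨ u = v := by omega
  · exact h.before u hu hc hl
  · intro ho
    have hc' := GraphInput.cov_mono h.sub hc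
    refine hv.resolve_right (fun hv => hv ⟨hc', fun i hi j hj a b ha hb => ?_⟩) ho
    have := (h.after u le_rfl (mem_range.1 (GraphInput.cov_subset_range hc)) ho hc').2
    exact hl i (this i hi a ha) j (this j hj b hb) a b ha hb

theorem DropInv.drop (hG : G.Admissible) {X₀ Z : Finset ℕ} {v : ℕ} {o o' : ℕ → ℕ}
    (h : DropInv G X₀ v X o) (hv : v < G.n) (ho : o v = 0) (hc : v ∈ G.cov X₀)
    (hl : G.IsLeaf X₀ v) (ho' : ∀ u < G.n, o' u ≠ 0 ↔ o u ≠ 0 ∨ ∃ i, G.Joins i v u)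
    (hZ : ∀ i, i ∈ Z ↔ i ∈ X ∧ ¬ ∃ w, G.Joins i v w) : DropInv G X₀ (v + 1) Z o' := by
  obtain ⟨hcX, hX⟩ := h.after v le_rfl hv ho hc
  obtain ⟨i, hi, p, hp⟩ := GraphInput.mem_cov.1 hcX
  have hleaf : ∀ j ∈ X, ∀ w, G.Joins j v w → j = i := fun j hj w hw =>
    hl j (h.sub hj) i (h.sub hi) w p hw hp
  obtain rfl : Z = X.erase i := by
    ext j
    rw [hZ, mem_erase]
    constructor
    · rintro ⟨h1, h2⟩
      exact ⟨fun hji => h2 ⟨p, hji ▸ hp⟩, h1⟩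
    · rintro ⟨h1, h2⟩
      exact ⟨h2, fun ⟨w, hw⟩ => h1 (hleaf j h2 w hw)⟩
  obtain ⟨ht, hcov⟩ := h.tree.erase_leaf hi hp hleaf (hG.two_le (h.tree.ceds h.dom))
  have hnb : ∀ j w, G.Joins j v w → w ∈ G.cov X := fun j w hw => by
    by_contra hw'
    exact (h.opn v hv).2 ⟨j, w, hw, hw'⟩ ho
  refine ⟨(erase_subset _ _).trans h.sub, ht, fun j a b hab => ?_, fun u hu => ?_,
    fun u hu hun hou hcu => ?_, fun u hu hcu hlu => ?_⟩
  · rw [hcov, mem_erase, mem_erase]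
    by_cases hav : a = v
    · subst hav
      exact .inr ⟨hab.ne.symm, hnb j b hab⟩
    · by_cases hbv : b = v
      · subst hbv
        exact .inl ⟨hab.ne, hnb j a hab.symm⟩
      · have := h.dom j a b hab
        tauto
  · rw [ho' u hu, h.opn u hu, hcov]
    constructor
    · rintro (⟨j, w, hj, hw⟩ | ⟨j, hj⟩)
      · exact ⟨j, w, hj, fun h => hw (mem_of_mem_erase h)⟩
      · exact ⟨j, v, hj.symm, by simp⟩
    · rintro ⟨j, w, hj, hw⟩
      by_cases hwv : w = v
      · exact .inr ⟨j, hwv ▸ hj.symm⟩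
      · exact .inl ⟨j, w, hj, fun h => hw (mem_erase.2 ⟨hwv, h⟩)⟩
  · have h1 : ¬ (o u ≠ 0 ∨ ∃ i, G.Joins i v u) := fun h => (ho' u hun).2 h hou
    rw [not_or, not_ne_iff] at h1
    obtain ⟨h2, h3⟩ := h.after u (by omega) hun h1.1 hcu
    refine ⟨hcov ▸ mem_erase.2 ⟨by omega, h2⟩, fun j hj w hw => mem_erase.2 ⟨?_, h3 j hj w hw⟩⟩
    rintro rfl
    obtain ⟨rfl, -⟩ | ⟨rfl, rfl⟩ := hp.ends hw
    · omega
    · exact h1.2 ⟨j, hp⟩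
  · rw [hcov, mem_erase] at hcu
    have hun := mem_range.1 (GraphInput.cov_subset_range hcu.2)
    rw [ho' u hun]
    by_cases hvu : ∃ i, G.Joins i v u
    · exact .inr hvu
    refine .inl (h.before u (by omega) hcu.2 fun j hj j' hj' a b ha hb => ?_)
    have key : ∀ j ∈ X, ∀ a, G.Joins j u a → j ∈ X.erase i := by
      intro j hj a ha
      refine mem_erase.2 ⟨?_, hj⟩
      rintro rfl
      obtain ⟨rfl, -⟩ | ⟨rfl, rfl⟩ := hp.ends ha
      · exact hcu.1 rfl
      · exact hvu ⟨j, hp⟩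
    exact hlu j (key j hj a ha) j' (key j' hj' b hb) a b ha hb

theorem dropLeaves_run (hG : G.Admissible) (hE : Env G ρ α) (hX : supp G.m (α aSet) = X)
    (ht : G.IsTree X) (hd : G.Dom X)
    (hdeg : ∀ v < G.n, α aDeg v = 1 ↔ v ∈ G.cov X ∧ G.IsLeaf X v)
    (hopn : ∀ v < G.n, α aOpen v ≠ 0 ↔ ∃ i w, G.Joins i v w ∧ w ∉ G.cov X) :
    Run I dropLeaves ρ α fun t _ α' => t ≤ 80 * G.n + 80 * G.m + 10 ∧
      supp G.m (α' aSet) ⊆ X ∧ G.IsTree (supp G.m (α' aSet)) ∧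
      G.IsMinCEDS (supp G.m (α' aSet)) := by
  refine Run.loop (L := 0) (B := G.n) (fun v t _ α' => (∀ u < v, α aFirst 0 ≤ α aFirst (u + 1)) ∧
    t ≤ 80 * v + 40 * (α aFirst v - α aFirst 0) ∧
    DropInv G X v (supp G.m (α' aSet)) (α' aOpen)) rfl (Nat.zero_le _)
    ⟨by simp, by simp, hX.subset, hX.symm ▸ ht, hX.symm ▸ hd, hX.symm ▸ hopn,
      fun u _ _ _ hc => ?_, by simp⟩ rfl
    (fun i ρ' α' hF _ _ _ => (hF.reg rN).trans hE.n_eq) ?_ ?_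
  · rw [hX]
    exact ⟨hc, fun i hi _ _ => hi⟩
  · rintro v t ρ₁ α₁ _ hv hx hF ⟨hS, htm, h⟩
    have hE₁ := hE.of_frame hF
    have hDeg : α₁ aDeg = α aDeg := hF.arr _
    have hFi : α₁ aFirst = α aFirst := hF.arr _
    have hS' : α aFirst 0 ≤ α aFirst v := by
      obtain rfl | hv0 := Nat.eq_zero_or_pos v
      · exact le_rfl
      · have := hS (v - 1) (by omega)
        rwa [Nat.sub_add_cancel hv0] at this
    have hS'' := hE.darts.first_le v hv
    have hSn : ∀ u < v + 1, α aFirst 0 ≤ α aFirst (u + 1) := fun u hu => by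
      obtain hu | rfl : u < v ∨ u = v := by omega
      · exact hS u hu
      · omega
    have hskip : ∀ t', t' ≤ 40 → α₁ aOpen v ≠ 0 ∨ ¬ (v ∈ G.cov X ∧ G.IsLeaf X v) →
        ((∀ u < v + 1, α aFirst 0 ≤ α aFirst (u + 1)) ∧
        t + t' + 8 ≤ 80 * (v + 1) + 40 * (α aFirst (v + 1) - α aFirst 0) ∧
        DropInv G X (v + 1) (supp G.m (α₁ aSet)) (α₁ aOpen)) := fun t' ht' ho =>
      ⟨hSn, by omega, h.keep ho⟩
    refine Run.ite (fun h1 => Run.of_wp ?_) fun h1 => Run.ite (fun h2 => Run.of_wp ?_) fun h2 => ?_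
    · simp only [ne_eq, Exp.ev_dist, Exp.ev, hx, hDeg, hdeg v hv] at h1
      exact hskip _ (by simp [Exp.cost_dist, Exp.cost]) (.inr h1)
    · simp only [Exp.ev, hx] at h2
      exact hskip _ (by simp [Exp.cost_dist, Exp.cost]) (.inl h2)
    · simp only [Exp.ev_dist, Exp.ev, hx, hDeg, hdeg v hv] at h1 h2
      refine (dropVertex_run hE₁ hx hv).imp ?_
      rintro t' ρ₂ α₂ - ⟨ht', ho, hs⟩
      rw [hFi] at ht'
      refine ⟨hSn, ?_, h.drop hG hv h2 h1.1 h1.2 ho fun i => ?_⟩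
      · simp only [Exp.cost_dist, Exp.cost]
        omega
      · simp only [mem_supp]
        constructor
        · rintro ⟨h1, h2⟩
          have := (hs i h1).1 h2
          exact ⟨⟨h1, this.1⟩, this.2⟩
        · rintro ⟨⟨h1, h2⟩, h3⟩
          exact ⟨h1, (hs i h1).2 ⟨h2, h3⟩⟩
  · rintro t ρ' α' - _ ⟨-, htm, h⟩
    have : α aFirst G.n ≤ ρ rD := by
      obtain hn := hG.n_pos
      have := hE.darts.le_last (G.n - 1) (by omega)
      rwa [Nat.sub_add_cancel hn] at this
    have := hE.darts.le
    simp only [Exp.cost]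
    refine ⟨by omega, h.sub, h.tree, h.tree.isMinCEDS h.dom (hG.two_le (h.tree.ceds h.dom))
      fun v hv hl => ?_⟩
    have hvn := mem_range.1 (GraphInput.cov_subset_range hv)
    exact (h.opn v hvn).1 (h.before v hvn hv hl)

theorem minimize_run (hG : G.Admissible) (hE : Env G ρ α) (hX : supp G.m (α aSet) = X)
    (ht : G.IsTree X) (hd : G.Dom X) :
    Run I minimize ρ α fun t _ α' => t ≤ 500 * G.m ∧
      supp G.m (α' aSet) ⊆ X ∧ G.IsTree (supp G.m (α' aSet)) ∧
      G.IsMinCEDS (supp G.m (α' aSet)) := by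
  refine Run.cons (clear_run (by decide)) ?_
  rintro t₁ ρ₁ α₁ hF₁ ⟨ht₁, h₁⟩
  have hE₁ := hE.of_frame hF₁
  refine Run.cons (clear_run (by decide)) ?_
  rintro t₂ ρ₂ α₂ hF₂ ⟨ht₂, h₂⟩
  have hE₂ := hE₁.of_frame hF₂
  rw [hE.n_eq] at ht₁ h₁
  rw [hE₁.n_eq] at ht₂ h₂
  have hX₂ : supp G.m (α₂ aSet) = X := by rw [hF₂.arr aSet, hF₁.arr aSet, hX]
  refine Run.cons (countDegrees_run hE₂ hX₂ (by rw [hF₂.arr aDeg, h₁])) ?_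
  rintro t₃ ρ₃ α₃ hF₃ ⟨ht₃, h₃⟩
  have hE₃ := hE₂.of_frame hF₃
  refine Run.cons (markOpen_run (X := X) hE₃ (fun v hv => (h₃ v hv).1)
    (by rw [hF₃.arr aOpen, h₂])) ?_
  rintro t₄ ρ₄ α₄ hF₄ ⟨ht₄, h₄⟩
  have hE₄ := hE₃.of_frame hF₄
  refine Run.cons (dropLeaves_run hG hE₄ (by rw [hF₄.arr aSet, hF₃.arr aSet, hX₂]) ht hd
    (fun v hv => by rw [hF₄.arr aDeg, (h₃ v hv).2]) h₄) ?_
  rintro t₅ ρ₅ α₅ - ⟨ht₅, h₅⟩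
  refine Run.nil ⟨?_, h₅⟩
  have := hG.n_le
  have := hG.two_le_m
  omega

end RAM

/-! ## A dictionary and a priority queue of edge sets -/

/-- Number of nodes of the trie. -/
notation "rNodes" => 3
/-- Node of the set that was taken from the queue, or `0`. -/
notation "rTop" => 4
/-- Children of the nodes of the trie. -/
notation "aChild" => 10
/-- Parents of the nodes of the trie. -/
notation "aParent" => 11
/-- Labels of the nodes of the trie. -/
notation "aBit" => 12
/-- Leaves of the trie whose set has been found. -/
notation "aSeen" => 13
/-- Successor of a leaf in its bucket. -/
notation "aNext" => 14
/-- First leaves of the buckets, by size of the set. -/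
notation "aBucket" => 15
/-- The set of edges that is currently explored. -/
notation "aCur" => 16

namespace RAM

open Finset

/-! ### The trie -/

/-- A binary trie with the nodes `1, …, K` and the root `1`. -/
structure Trie (K : ℕ) (C P B : ℕ → ℕ) : Prop where
  pos : 1 ≤ K
  child : ∀ ν, 1 ≤ ν → ν ≤ K → ∀ b < 2, C (ν + ν + b) ≠ 0 →
    C (ν + ν + b) ≤ K ∧ P (C (ν + ν + b)) = ν ∧ B (C (ν + ν + b)) = b
  fresh : ∀ ν, K < ν → ∀ b < 2, C (ν + ν + b) = 0

def bit (X : Finset ℕ) (i : ℕ) : ℕ := if i ∈ X then 1 else 0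

theorem bit_lt (X : Finset ℕ) (i : ℕ) : bit X i < 2 := by
  unfold bit
  split_ifs <;> omega

theorem bit_eq_bit {X Y : Finset ℕ} {i : ℕ} : bit X i = bit Y i ↔ (i ∈ X ↔ i ∈ Y) := by
  unfold bit
  split_ifs <;> simp_all

/-- Starting at the root, the first `i` bits of `X` lead to the node `ν`. -/
def IsPath (C : ℕ → ℕ) (X : Finset ℕ) : ℕ → ℕ → Prop
  | 0, ν => ν = 1
  | i + 1, ν => ν ≠ 0 ∧ ∃ μ, IsPath C X i μ ∧ C (μ + μ + bit X i) = ν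

variable {K : ℕ} {C C' P B : ℕ → ℕ} {X Y : Finset ℕ} {i ν ν' : ℕ}

theorem IsPath.unique (h : IsPath C X i ν) (h' : IsPath C X i ν') : ν = ν' := by
  induction i generalizing ν ν' with
  | zero => exact h.trans h'.symm
  | succ i ih =>
    obtain ⟨-, μ, h1, h2⟩ := h
    obtain ⟨-, μ', h1', h2'⟩ := h'
    rw [← h2, ← h2', ih h1 h1']

theorem IsPath.mem_nodes (hT : Trie K C P B) (h : IsPath C X i ν) : 1 ≤ ν ∧ ν ≤ K := by
  induction i generalizing ν with
  | zero => exact ⟨h.ge, h.le.trans hT.pos⟩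
  | succ i ih =>
    obtain ⟨h0, μ, h1, rfl⟩ := h
    exact ⟨by omega, (hT.child μ (ih h1).1 (ih h1).2 _ (bit_lt _ _) h0).1⟩

theorem IsPath.mono (hC : ∀ a, C a ≠ 0 → C' a = C a) (h : IsPath C X i ν) : IsPath C' X i ν := by
  induction i generalizing ν with
  | zero => exact h
  | succ i ih =>
    obtain ⟨h0, μ, h1, rfl⟩ := h
    exact ⟨h0, μ, ih h1, hC _ h0⟩

theorem IsPath.parent (hT : Trie K C P B) (h : IsPath C X (i + 1) ν) :
    IsPath C X i (P ν) ∧ B ν = bit X i := by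
  obtain ⟨h0, μ, h1, rfl⟩ := h
  have := hT.child μ (h1.mem_nodes hT).1 (h1.mem_nodes hT).2 _ (bit_lt _ _) h0
  exact ⟨this.2.1.symm ▸ h1, this.2.2⟩

theorem IsPath.inj (hT : Trie K C P B) (h : IsPath C X i ν) (h' : IsPath C Y i ν) :
    ∀ j < i, j ∈ X ↔ j ∈ Y := by
  induction i generalizing ν with
  | zero => simp
  | succ i ih =>
    intro j hj
    obtain hj | rfl : j < i ∨ j = i := by omega
    · exact ih (h.parent hT).1 (h'.parent hT).1 j hj
    · exact bit_eq_bit.1 ((h.parent hT).2.symm.trans (h'.parent hT).2)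

theorem Trie.alloc (hT : Trie K C P B) {b : ℕ} (h2 : ν ≤ K) (hb : b < 2) :
    Trie (K + 1) (Function.update C (ν + ν + b) (K + 1)) (Function.update P (K + 1) ν)
      (Function.update B (K + 1) b) := by
  refine ⟨by omega, fun μ hμ hμK b' hb' => ?_, fun μ hμ b' hb' => ?_⟩
  · by_cases h : μ + μ + b' = ν + ν + b
    · rw [h, Function.update_self]
      have : μ = ν := by omega
      have : b' = b := by omega
      simp [*]
    · rw [Function.update_of_ne h]
      intro hne
      have hμ' : μ ≤ K := by
        by_contra hμ'
        exact hne (hT.fresh μ (by omega) b' hb')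
      have := hT.child μ hμ hμ' b' hb' hne
      rw [Function.update_of_ne (by omega), Function.update_of_ne (by omega)]
      exact ⟨by omega, this.2⟩
  · rw [Function.update_of_ne (by omega)]
    exact hT.fresh μ (by omega) b' hb'

/-- Enter the child of node `14` that belongs to edge `13`, after creating it if necessary. -/
def descend : Cmd := block [
  .ite (.arr aSet (.reg 13))
    (block [.assign 17 (.const 1), .assign 16 (.add (.reg 16) (.const 1))])
    (.assign 17 (.const 0)),
  .assign 15 (.add (.add (.reg 14) (.reg 14)) (.reg 17)),
  .ite (.arr aChild (.reg 15)) .skip (block [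
    .assign rNodes (.add (.reg rNodes) (.const 1)),
    .store aChild (.reg 15) (.reg rNodes),
    .store aParent (.reg rNodes) (.reg 14),
    .store aBit (.reg rNodes) (.reg 17)]),
  .assign 14 (.arr aChild (.reg 15))]

/-- Find the leaf (register `14`) and the size (register `16`) of the set in `aSet`. -/
def intern : Cmd := block [.assign 14 (.const 1), .assign 16 (.const 0),
  loop 13 (.const 0) (.reg rM) descend]

variable {G : GraphInput} {I : Input} {ρ : Regs} {α : Arrs}

theorem descend_run (hi : ρ 13 = i) (him : i < G.m) (hX : supp G.m (α aSet) = X)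
    (hT : Trie (ρ rNodes) (α aChild) (α aParent) (α aBit))
    (hp : IsPath (α aChild) X i (ρ 14)) :
    Run I descend ρ α fun t ρ' α' => t ≤ 60 ∧
      Trie (ρ' rNodes) (α' aChild) (α' aParent) (α' aBit) ∧
      (∀ a, α aChild a ≠ 0 → α' aChild a = α aChild a) ∧
      IsPath (α' aChild) X (i + 1) (ρ' 14) ∧ ρ' 16 = ρ 16 + bit X i := by
  refine Run.cons (Q₁ := fun t ρ' α' => t ≤ 20 ∧ α' = α ∧ ρ' 17 = bit X i ∧
    ρ' 16 = ρ 16 + bit X i) (Run.of_wp ?_) ?_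
  · have h1 := eq_zero_iff_notMem_supp (f := α aSet) him
    rw [hX] at h1
    simp only [block, wp, Exp.ev, Exp.cost, hi, ne_eq, h1, not_not, bit]
    exact ⟨fun h => by simp [h], fun h => by simp [h]⟩
  rintro t₁ ρ₁ α₁ hF ⟨ht₁, hα, h17, h16⟩
  have h14 : ρ₁ 14 = ρ 14 := hF.reg 14
  have h3 : ρ₁ rNodes = ρ rNodes := hF.reg rNodes
  rw [← hα, ← h3] at hT
  rw [← hα, ← h14] at hp
  rw [← hα]
  clear hF hα h14 h3 hX hi
  refine Run.of_wp ?_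
  have hμ := hp.mem_nodes hT
  have hup : ∀ a, α₁ aChild a ≠ 0 → α₁ aChild (ρ₁ 14 + ρ₁ 14 + bit X i) = 0 →
      Function.update (α₁ aChild) (ρ₁ 14 + ρ₁ 14 + bit X i) (ρ₁ rNodes + 1) a = α₁ aChild a := by
    intro a ha h0
    refine Function.update_of_ne ?_ _ _
    rintro rfl
    exact ha h0
  simp only [block, wp, Exp.ev, Exp.cost, Function.update_self, ne_eq,
    Nat.reduceEqDiff, not_false_eq_true, Function.update_of_ne, h17, h16]
  refine ⟨fun h0 => ⟨by omega, hT, fun _ _ => trivial, ⟨h0, _, hp, rfl⟩, trivial⟩,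
    fun h0 => ⟨by omega, hT.alloc hμ.2 (bit_lt _ _), fun a ha => hup a ha h0,
      ⟨by omega, _, hp.mono fun a ha => hup a ha h0, Function.update_self ..⟩, trivial⟩⟩

theorem intern_run (hE : Env G ρ α) (hX : supp G.m (α aSet) = X)
    (hT : Trie (ρ rNodes) (α aChild) (α aParent) (α aBit)) :
    Run I intern ρ α fun t ρ' α' => t ≤ 80 * G.m + 20 ∧
      Trie (ρ' rNodes) (α' aChild) (α' aParent) (α' aBit) ∧
      (∀ a, α aChild a ≠ 0 → α' aChild a = α aChild a) ∧
      IsPath (α' aChild) X G.m (ρ' 14) ∧ ρ' 16 = #X := by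
  refine Run.cons (Q₁ := fun t ρ' α' => t = 2 ∧ α' = α ∧ ρ' 14 = 1) (Run.of_wp ?_) ?_
  · simp [wp, Exp.ev, Exp.cost]
  rintro _ ρ₁ α hF₁ ⟨rfl, rfl, h₁⟩
  refine Run.cons (Q₁ := fun t ρ' α' => t = 2 ∧ α' = α ∧ ρ' 16 = 0) (Run.of_wp ?_) ?_
  · simp [wp, Exp.ev, Exp.cost]
  rintro _ ρ₂ α hF₂ ⟨rfl, rfl, h₂⟩
  refine Run.cons (Run.loop_uniform 60 (L := 0) (B := G.m) (fun i ρ' α' =>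
    Trie (ρ' rNodes) (α' aChild) (α' aParent) (α' aBit) ∧
      (∀ a, α aChild a ≠ 0 → α' aChild a = α aChild a) ∧
      IsPath (α' aChild) X i (ρ' 14) ∧ ρ' 16 = #(X.filter (· < i))) rfl (Nat.zero_le _) ?_ rfl
    (fun i ρ' α' hF _ _ _ => by
      rw [show (Exp.reg rM).ev I ρ' α' = ρ' rM from rfl, hF.reg rM, hF₂.reg rM, hF₁.reg rM, hE.m_eq])
    ?_ (Q := fun t ρ' α' => t ≤ 68 * G.m + 6 ∧
      Trie (ρ' rNodes) (α' aChild) (α' aParent) (α' aBit) ∧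
      (∀ a, α aChild a ≠ 0 → α' aChild a = α aChild a) ∧
      IsPath (α' aChild) X G.m (ρ' 14) ∧ ρ' 16 = #X) ?_) ?_
  · simp only [ne_eq, Nat.reduceEqDiff, not_false_eq_true,
      Function.update_of_ne, h₂, not_lt_zero, filter_false, card_empty]
    rw [hF₂.reg rNodes, hF₁.reg rNodes, hF₂.reg 14, h₁]
    exact ⟨hT, fun _ _ => trivial, rfl, trivial⟩
  · rintro i ρ₃ α₃ _ hi hx hF₃ ⟨h3, h4, h5, h6⟩
    refine (descend_run hx hi (by rw [hF₃.arr aSet, hX]) h3 h5).imp ?_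
    rintro t ρ₄ α₄ - ⟨ht, h7, h8, h9, h10⟩
    refine ⟨ht, by simpa using h7, fun a ha => ?_, by simpa using h9, ?_⟩
    · rw [h8 a (by rwa [h4 a ha]), h4 a ha]
    · simp only [ne_eq, Nat.reduceEqDiff, not_false_eq_true,
        Function.update_of_ne, h10, h6, bit, Nat.lt_succ_iff_lt_or_eq, filter_or]
      rw [card_union_of_disjoint, filter_eq']
      · split_ifs <;> simp
      · rw [disjoint_left]
        intro a ha hb
        simp only [mem_filter] at ha hb
        omega
  · rintro t ρ' α' _ _ ⟨h3, h4, h5, h6⟩ ht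
    simp only [Exp.cost] at ht
    refine ⟨by omega, h3, h4, h5, ?_⟩
    rw [h6, filter_true_of_mem]
    intro a ha
    rw [← hX, mem_supp] at ha
    exact ha.1
  · rintro t ρ' α' _ ⟨ht, h⟩
    exact Run.nil ⟨by omega, h⟩

/-- Write the set that belongs to the leaf `rTop` to `aCur`. -/
def unpack : Cmd := block [.assign 18 (.reg rTop),
  loop 19 (.const 0) (.reg rM) (block [
    .store aCur (.sub (.sub (.reg rM) (.reg 19)) (.const 1)) (.arr aBit (.reg 18)),
    .assign 18 (.arr aParent (.reg 18))])]

theorem unpack_run (hE : Env G ρ α) (hX : X ⊆ range G.m)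
    (hT : Trie (ρ rNodes) (α aChild) (α aParent) (α aBit))
    (hp : IsPath (α aChild) X G.m (ρ rTop)) :
    Run I unpack ρ α fun t _ α' => t ≤ 40 * G.m + 20 ∧ supp G.m (α' aCur) = X := by
  refine Run.cons (Q₁ := fun t ρ' α' => t = 2 ∧ α' = α ∧ ρ' 18 = ρ rTop) (Run.of_wp ?_) ?_
  · simp [wp, Exp.ev, Exp.cost]
  rintro _ ρ₁ α hF₁ ⟨rfl, rfl, h₁⟩
  have hm : ρ₁ rM = G.m := by rw [hF₁.reg rM, hE.m_eq]
  refine Run.cons (Run.loop_uniform 20 (L := 0) (B := G.m) (fun i ρ' α' =>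
    IsPath (α aChild) X (G.m - i) (ρ' 18) ∧ ∀ j, G.m - i ≤ j → j < G.m → α' aCur j = bit X j)
    rfl (Nat.zero_le _) ?_ rfl
    (fun i ρ' α' hF _ _ _ => (hF.reg rM).trans hm)
    ?_ (Q := fun t ρ' α' => t ≤ 28 * G.m + 6 ∧ supp G.m (α' aCur) = X) ?_) ?_
  · refine ⟨by simpa [h₁] using hp, fun j h1 h2 => by omega⟩
  · rintro i ρ₂ α₂ _ hi hx hF₂ ⟨h2, h3⟩
    obtain ⟨k, hk⟩ : ∃ k, G.m - i = k + 1 := ⟨G.m - i - 1, by omega⟩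
    have hk' : G.m - (i + 1) = k := by omega
    rw [hk] at h2 h3
    have h4 := h2.parent hT
    have hm₂ : ρ₂ rM = G.m := (hF₂.reg rM).trans hm
    have hP : α₂ aParent = α aParent := hF₂.arr _
    have hB : α₂ aBit = α aBit := hF₂.arr _
    refine Run.of_wp ?_
    simp only [block, wp, Exp.ev, Exp.cost, Function.update_self, ne_eq,
      Nat.reduceEqDiff, not_false_eq_true, Function.update_of_ne, hm₂, hx, hk, hk', hP, hB, h4.2,
      Nat.add_sub_cancel]
    refine ⟨by norm_num, h4.1, fun j h1 h2 => ?_⟩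
    rw [Function.update_apply]
    split_ifs with h
    · rw [h]
    · exact h3 j (by omega) h2
  · rintro t ρ' α' _ _ ⟨h2, h3⟩ ht
    simp only [Exp.cost] at ht
    refine ⟨by omega, ?_⟩
    ext j
    rw [mem_supp]
    constructor
    · rintro ⟨h4, h5⟩
      rw [h3 j (by omega) h4, bit] at h5
      simpa using h5
    · intro h4
      have := mem_range.1 (hX h4)
      refine ⟨this, ?_⟩
      rw [h3 j (by omega) this, bit, if_pos h4]
      exact one_ne_zero
  · rintro t ρ' α' _ ⟨ht, h⟩
    exact Run.nil ⟨by omega, h⟩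

end RAM

/-! ### The queue -/

namespace RAM

open Finset

/-- `h` is the head of a linked list of leaves that represents the list of edge sets. -/
def Linked (C : ℕ → ℕ) (m : ℕ) (N : ℕ → ℕ) : ℕ → List (Finset ℕ) → Prop
  | h, [] => h = 0
  | h, X :: l => IsPath C X m h ∧ Linked C m N (N h) l

theorem Linked.mono {C C' : ℕ → ℕ} {m : ℕ} {N N' : ℕ → ℕ} {l : List (Finset ℕ)} {h : ℕ}
    (hC : ∀ a, C a ≠ 0 → C' a = C a) (hN : ∀ X ∈ l, ∀ ν, IsPath C X m ν → N' ν = N ν)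
    (hl : Linked C m N h l) : Linked C' m N' h l := by
  induction l generalizing h with
  | nil => exact hl
  | cons X l ih =>
    refine ⟨hl.1.mono hC, ?_⟩
    rw [hN X (by simp) h hl.1]
    exact ih (fun Y hY => hN Y (by simp [hY])) hl.2

/-- `X` has been processed or is in the queue. -/
def Found (P : List (Finset ℕ)) (L : ℕ → List (Finset ℕ)) (X : Finset ℕ) : Prop :=
  X ∈ P ∨ ∃ s, X ∈ L s

/-- The memory represents the list `P` of processed sets and the queue with buckets `L`. -/
structure Store (G : GraphInput) (P : List (Finset ℕ)) (L : ℕ → List (Finset ℕ))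
    (ρ : Regs) (α : Arrs) : Prop where
  trie : Trie (ρ rNodes) (α aChild) (α aParent) (α aBit)
  linked : ∀ s, Linked (α aChild) G.m (α aNext) (α aBucket s) (L s)
  seen : ∀ ν, α aSeen ν ≠ 0 ↔ ∃ X, Found P L X ∧ IsPath (α aChild) X G.m ν
  path : ∀ X, Found P L X → ∃ ν, IsPath (α aChild) X G.m ν
  tree : ∀ X, Found P L X → G.IsTree X
  minimal : ∀ X, Found P L X → G.IsMinCEDS X
  size : ∀ s, ∀ X ∈ L s, #X = s
  nodup : ∀ s, (L s).Nodup
  nodup_processed : P.Nodup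
  disjoint : ∀ s, ∀ X ∈ L s, X ∉ P

variable {G : GraphInput} {I : Input} {ρ ρ' : Regs} {α α' : Arrs} {X Y : Finset ℕ}
  {P : List (Finset ℕ)} {L : ℕ → List (Finset ℕ)}

/-- `c` does not change the dictionary and the queue. -/
def KeepsStore (c : Cmd) : Bool :=
  !(c.wr rNodes || c.wa aChild || c.wa aParent || c.wa aBit || c.wa aSeen || c.wa aNext ||
    c.wa aBucket)

theorem Store.of_frame {c : Cmd} (h : Store G P L ρ α) (hF : Frame c ρ α ρ' α')
    (hc : KeepsStore c = true := by rfl) : Store G P L ρ' α' := by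
  simp only [KeepsStore, Bool.not_eq_true', Bool.or_eq_false_iff] at hc
  obtain ⟨⟨⟨⟨⟨⟨h1, h2⟩, h3⟩, h4⟩, h5⟩, h6⟩, h7⟩ := hc
  constructor
  · rw [hF.1 _ h1, hF.2 _ h2, hF.2 _ h3, hF.2 _ h4]
    exact h.trie
  · rw [hF.2 _ h2, hF.2 _ h6, hF.2 _ h7]
    exact h.linked
  · rw [hF.2 _ h2, hF.2 _ h5]
    exact h.seen
  · rw [hF.2 _ h2]
    exact h.path
  exacts [h.tree, h.minimal, h.size, h.nodup, h.nodup_processed, h.disjoint]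

theorem Store.empty (h1 : ρ rNodes = 1) (h2 : α aChild = 0) (h3 : α aSeen = 0)
    (h4 : α aBucket = 0) : Store G [] (fun _ => []) ρ α := by
  have hf : ∀ X, ¬ Found [] (fun _ => []) X := by simp [Found]
  refine ⟨⟨by omega, ?_, ?_⟩, ?_, ?_, ?_, ?_, ?_, ?_, ?_, ?_, ?_⟩ <;>
    simp [h2, h3, h4, hf, Linked]

theorem Store.eq_of_path (h : Store G P L ρ α) {ν : ℕ} (hX : X ⊆ range G.m) (hY : Y ⊆ range G.m)
    (h1 : IsPath (α aChild) X G.m ν) (h2 : IsPath (α aChild) Y G.m ν) : X = Y := by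
  ext j
  have := h1.inj h.trie h2 j
  have h3 := @hX j
  have h4 := @hY j
  simp only [mem_range] at h3 h4
  tauto

/-- The trie may grow. -/
theorem Store.grow (h : Store G P L ρ α)
    (hT : Trie (ρ' rNodes) (α' aChild) (α' aParent) (α' aBit))
    (hC : ∀ a, α aChild a ≠ 0 → α' aChild a = α aChild a) (h1 : α' aSeen = α aSeen)
    (h2 : α' aNext = α aNext) (h3 : α' aBucket = α aBucket) : Store G P L ρ' α' := by
  refine ⟨hT, fun s => ?_, fun ν => ?_, fun X hX => ?_, h.tree, h.minimal, h.size, h.nodup,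
    h.nodup_processed, h.disjoint⟩
  · rw [h2, h3]
    exact (h.linked s).mono hC fun _ _ _ _ => rfl
  · rw [h1, h.seen]
    refine exists_congr fun X => and_congr_right fun hX => ⟨fun hp => hp.mono hC, fun hp => ?_⟩
    obtain ⟨ν', hν'⟩ := h.path X hX
    rwa [hp.unique (hν'.mono hC)]
  · obtain ⟨ν, hν⟩ := h.path X hX
    exact ⟨ν, hν.mono hC⟩

/-- Put the set of leaf `14` and size `16` into the queue if it is new. -/
def enqueue : Cmd := .ite (.arr aSeen (.reg 14)) .skip (block [
  .store aSeen (.reg 14) (.const 1),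
  .store aNext (.reg 14) (.arr aBucket (.reg 16)),
  .store aBucket (.reg 16) (.reg 14)])

theorem Store.push {ν : ℕ} (h : Store G P L ρ α) (hp : IsPath (α aChild) X G.m ν)
    (ht : G.IsTree X) (hm : G.IsMinCEDS X) (hs : α aSeen ν = 0) (h0 : ρ' rNodes = ρ rNodes)
    (h1 : α' aChild = α aChild) (h2 : α' aParent = α aParent) (h3 : α' aBit = α aBit)
    (h4 : α' aSeen = Function.update (α aSeen) ν 1)
    (h5 : α' aNext = Function.update (α aNext) ν (α aBucket #X))
    (h6 : α' aBucket = Function.update (α aBucket) #X ν) :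
    Store G P (Function.update L #X (X :: L #X)) ρ' α' := by
  have hnew : ¬ Found P L X := fun hX => (h.seen ν).2 ⟨X, hX, hp⟩ hs
  have hmem : ∀ s Y, Y ∈ Function.update L #X (X :: L #X) s ↔ Y ∈ L s ∨ (s = #X ∧ Y = X) := by
    intro s Y
    rw [Function.update_apply]
    split_ifs with hs <;> simp [hs, or_comm]
  have hF : ∀ Y, Found P (Function.update L #X (X :: L #X)) Y ↔ Found P L Y ∨ Y = X := by
    intro Y
    simp only [Found, hmem, exists_or, exists_eq_left, or_assoc]
  have hlink : ∀ s, Linked (α' aChild) G.m (α' aNext) (α aBucket s) (L s) := by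
    intro s
    rw [h1]
    refine (h.linked s).mono (fun _ _ => rfl) fun Y hY ν' hν' => ?_
    rw [h5]
    refine Function.update_of_ne ?_ _ _
    rintro rfl
    refine hnew (.inr ⟨s, ?_⟩)
    rwa [h.eq_of_path hm.1.sub (h.minimal Y (.inr ⟨s, hY⟩)).1.sub hp hν']
  refine ⟨by rw [h0, h1, h2, h3]; exact h.trie, fun s => ?_, fun ν' => ?_, fun Y hY => ?_,
    fun Y hY => ?_, fun Y hY => ?_, fun s Y hY => ?_, fun s => ?_, h.nodup_processed,
    fun s Y hY hP => ?_⟩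
  · rw [h6]
    by_cases hs : s = #X
    · subst hs
      rw [Function.update_self, Function.update_self]
      refine ⟨h1 ▸ hp, ?_⟩
      have := hlink #X
      rwa [h5, Function.update_self, ← h5]
    · rw [Function.update_of_ne hs, Function.update_of_ne hs]
      exact hlink s
  · simp only [hF, h1, or_and_right, exists_or, exists_eq_left, ← h.seen, h4, Function.update_apply]
    split_ifs with hν
    · simp [hν, hp]
    · have : ¬ IsPath (α aChild) X G.m ν' := fun h' => hν (h'.unique hp)
      simp [this]
  · rw [h1]
    obtain hY | rfl := (hF Y).1 hY
    · exact h.path Y hY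
    · exact ⟨ν, hp⟩
  · obtain hY | rfl := (hF Y).1 hY
    · exact h.tree Y hY
    · exact ht
  · obtain hY | rfl := (hF Y).1 hY
    · exact h.minimal Y hY
    · exact hm
  · obtain hY | ⟨rfl, rfl⟩ := (hmem s Y).1 hY
    · exact h.size s Y hY
    · rfl
  · rw [Function.update_apply]
    split_ifs with hs
    · exact List.nodup_cons.2 ⟨fun hX => hnew (.inr ⟨_, hX⟩), h.nodup _⟩
    · exact h.nodup s
  · obtain hY | ⟨rfl, rfl⟩ := (hmem s Y).1 hY
    · exact h.disjoint s Y hY hP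
    · exact hnew (.inl hP)

theorem enqueue_run (hS : Store G P L ρ α) (hp : IsPath (α aChild) X G.m (ρ 14))
    (h16 : ρ 16 = #X) (ht : G.IsTree X) (hm : G.IsMinCEDS X) :
    Run I enqueue ρ α fun t ρ' α' => t ≤ 20 ∧ ∃ L', Store G P L' ρ' α' ∧ (∀ s, L s ⊆ L' s) ∧
      Found P L' X := by
  refine Run.of_wp ?_
  simp only [enqueue, block, wp, Exp.ev, Exp.cost, h16]
  refine ⟨fun h => ⟨by norm_num, L, hS, fun _ => List.Subset.refl _, ?_⟩,
    fun h => ⟨by norm_num, _, hS.push hp ht hm h rfl ?_ ?_ ?_ ?_ ?_ ?_, fun s => ?_, ?_⟩⟩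
  · obtain ⟨Y, hY, hYp⟩ := (hS.seen _).1 h
    rwa [hS.eq_of_path hm.1.sub (hS.minimal Y hY).1.sub hp hYp]
  any_goals simp
  · rw [Function.update_apply]
    split_ifs with h
    · rw [h]
      exact List.subset_cons_self _ _
    · exact List.Subset.refl _
  · exact .inr ⟨#X, by simp⟩

/-- Minimize the tree in `aSet` and put it into the queue if it is new. -/
def insertSet : Cmd := block [minimize, intern, enqueue]

theorem insertSet_run (hG : G.Admissible) (hE : Env G ρ α) (hS : Store G P L ρ α)
    (hX : supp G.m (α aSet) = X) (ht : G.IsTree X) (hd : G.Dom X) :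
    Run I insertSet ρ α fun t ρ' α' => t ≤ 700 * G.m ∧ ∃ L', Store G P L' ρ' α' ∧
      (∀ s, L s ⊆ L' s) ∧ ∃ Z ⊆ X, Found P L' Z := by
  refine Run.cons (minimize_run hG hE hX ht hd) ?_
  rintro t₁ ρ₁ α₁ hF₁ ⟨ht₁, h₁, h₁', h₁''⟩
  have hE₁ := hE.of_frame hF₁
  have hS₁ := hS.of_frame hF₁
  refine Run.cons (intern_run hE₁ rfl hS₁.trie) ?_
  rintro t₂ ρ₂ α₂ hF₂ ⟨ht₂, h₂, h₃, h₄, h₅⟩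
  have hS₂ := hS₁.grow h₂ h₃ (hF₂.arr _) (hF₂.arr _) (hF₂.arr _)
  refine Run.cons (enqueue_run hS₂ h₄ h₅ h₁' h₁'') ?_
  rintro t₃ ρ₃ α₃ hF₃ ⟨ht₃, L', h₆, h₇, h₈⟩
  have := hG.two_le_m
  exact Run.nil ⟨by omega, L', h₆, h₇, _, h₁, h₈⟩

/-- Take a smallest set from the queue. -/
def dequeue : Cmd := block [.assign rTop (.const 0),
  loop 20 (.const 0) (.add (.reg rM) (.const 1)) (.ite (.reg rTop) .skip
    (.ite (.arr aBucket (.reg 20)) (block [.assign rTop (.arr aBucket (.reg 20)),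
      .store aBucket (.reg 20) (.arr aNext (.reg rTop))]) .skip))]

/-- The result of taking `X` from the queue. -/
structure Dequeued (G : GraphInput) (P : List (Finset ℕ)) (L : ℕ → List (Finset ℕ)) (X : Finset ℕ)
    (L' : ℕ → List (Finset ℕ)) (ρ : Regs) (α : Arrs) : Prop where
  path : IsPath (α aChild) X G.m (ρ rTop)
  store : Store G (P ++ [X]) L' ρ α
  found : ∀ Z, Found (P ++ [X]) L' Z ↔ Found P L Z
  le : ∀ s, ∀ Z ∈ L s, #X ≤ #Z

theorem Store.pop {s : ℕ} {l : List (Finset ℕ)} (h : Store G P L ρ α) (hl : L s = X :: l)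
    (hs : ∀ s' < s, L s' = []) (h0 : ρ' rNodes = ρ rNodes)
    (h1 : α' aChild = α aChild) (h2 : α' aParent = α aParent) (h3 : α' aBit = α aBit)
    (h4 : α' aSeen = α aSeen) (h5 : α' aNext = α aNext)
    (h6 : α' aBucket = Function.update (α aBucket) s (α aNext (α aBucket s)))
    (h7 : ρ' rTop = α aBucket s) : Dequeued G P L X (Function.update L s l) ρ' α' := by
  have hlink := h.linked s
  rw [hl] at hlink
  have hnd := h.nodup s
  rw [hl, List.nodup_cons] at hnd
  have hmem : ∀ s' Y, Y ∈ L s' ↔ Y ∈ Function.update L s l s' ∨ (s' = s ∧ Y = X) := by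
    intro s' Y
    rw [Function.update_apply]
    split_ifs with hs'
    · simp [hs', hl, or_comm]
    · simp [hs']
  have hfound : ∀ Z, Found (P ++ [X]) (Function.update L s l) Z ↔ Found P L Z := by
    intro Z
    simp only [Found, hmem, List.mem_append, List.mem_singleton, exists_or, exists_eq_left,
      or_assoc]
    tauto
  have hXs : X ∈ L s := by simp [hl]
  have hX := h.size s X hXs
  refine ⟨by rw [h1, h7]; exact hlink.1, ⟨by rw [h0, h1, h2, h3]; exact h.trie, fun s' => ?_,
    fun ν => ?_, fun Z hZ => ?_, fun Z hZ => h.tree Z ((hfound Z).1 hZ),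
    fun Z hZ => h.minimal Z ((hfound Z).1 hZ),
    fun s' Z hZ => h.size s' Z ((hmem _ _).2 (.inl hZ)), fun s' => ?_, ?_, fun s' Y hY hP => ?_⟩,
    hfound, fun s' Z hZ => ?_⟩
  · rw [h1, h5, h6, Function.update_apply, Function.update_apply]
    split_ifs with hs'
    · exact hlink.2
    · exact h.linked s'
  · rw [h4, h1, h.seen]
    simp only [hfound]
  · rw [h1]
    exact h.path Z ((hfound Z).1 hZ)
  · rw [Function.update_apply]
    split_ifs with hs'
    · exact hnd.2
    · exact h.nodup s'
  · refine h.nodup_processed.append (List.nodup_singleton _) ?_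
    simpa using h.disjoint s X hXs
  · have hY' := (hmem s' Y).2 (.inl hY)
    obtain hP | hP := List.mem_append.1 hP
    · exact h.disjoint s' Y hY' hP
    · obtain rfl := List.mem_singleton.1 hP
      have := h.size s' Y hY'
      have hss : s' = s := by omega
      subst hss
      rw [Function.update_self] at hY
      exact hnd.1 hY
  · rw [hX, h.size s' Z hZ]
    by_contra hlt
    simp [hs s' (by omega)] at hZ

theorem dequeue_run (hE : Env G ρ α) (hS : Store G P L ρ α) :
    Run I dequeue ρ α fun t ρ' α' => t ≤ 40 * G.m + 60 ∧
      ((ρ' rTop = 0 ∧ Store G P L ρ' α' ∧ ∀ s, L s = []) ∨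
        (ρ' rTop ≠ 0 ∧ ∃ X L', Dequeued G P L X L' ρ' α')) := by
  refine Run.cons (Q₁ := fun t ρ' α' => t = 2 ∧ α' = α ∧ ρ' rTop = 0) (Run.of_wp ?_) ?_
  · simp [wp, Exp.ev, Exp.cost]
  rintro _ ρ₁ α₁ hF₁ ⟨rfl, hα, h₁⟩
  have hm : ρ₁ rM = G.m := by rw [hF₁.reg rM, hE.m_eq]
  have hS₁ := hS.of_frame hF₁
  refine Run.cons (Run.loop_uniform 24 (L := 0) (B := G.m + 1) (fun s ρ' α' =>
    (ρ' rTop = 0 ∧ Store G P L ρ' α' ∧ ∀ s' < s, L s' = []) ∨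
        (ρ' rTop ≠ 0 ∧ ∃ X L', Dequeued G P L X L' ρ' α'))
    rfl (Nat.zero_le _) ?_ rfl
    (fun i ρ' α' hF _ _ _ => congrArg (· + 1) ((hF.reg rM).trans hm))
    ?_ (Q := fun t ρ' α' => t ≤ 34 * (G.m + 1) + 8 ∧ ((ρ' rTop = 0 ∧ Store G P L ρ' α' ∧
      ∀ s, L s = []) ∨ (ρ' rTop ≠ 0 ∧ ∃ X L', Dequeued G P L X L' ρ' α'))) ?_) ?_
  · refine .inl ⟨by simpa using h₁, ?_, by simp⟩
    exact hS₁.of_frame (c := .assign 20 (.const 0)) ⟨fun x hx => Function.update_of_ne (by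
      simpa [Cmd.wr] using hx) _ _, fun _ _ => rfl⟩
  · rintro s ρ₂ α₂ _ hs hx hF₂ (⟨h2, h3, h4⟩ | ⟨h2, X, L', h3⟩)
    · refine Run.of_wp ?_
      simp only [block, wp, Exp.ev, Exp.cost, hx, h2]
      refine ⟨fun h => absurd rfl h, fun _ => ⟨fun h5 => ?_, fun h5 => ?_⟩⟩
      · have hl : ∃ X l, L s = X :: l := by
          cases hL : L s with
          | nil =>
            have := h3.linked s
            rw [hL] at this
            exact absurd this h5
          | cons X l => exact ⟨X, l, rfl⟩
        obtain ⟨X, l, hl⟩ := hl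
        refine ⟨by norm_num, .inr ⟨by simpa using h5, X, _,
          h3.pop hl h4 ?_ ?_ ?_ ?_ ?_ ?_ ?_ ?_⟩⟩
        all_goals simp [hx]
      · refine ⟨by norm_num, .inl ⟨by simpa using h2, ?_, fun s' hs' => ?_⟩⟩
        · exact h3.of_frame (c := .assign 20 (.const 0)) ⟨fun x hx => Function.update_of_ne (by
            simpa [Cmd.wr] using hx) _ _, fun _ _ => rfl⟩
        · obtain h | rfl : s' < s ∨ s' = s := by omega
          · exact h4 s' h
          · cases hL : L s' with
            | nil => rfl
            | cons X l =>
              have := h3.linked s'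
              rw [hL, h5] at this
              have := (this.1.mem_nodes h3.trie).1
              omega
    · refine Run.of_wp ?_
      simp only [block, wp, Exp.ev, Exp.cost, hx]
      refine ⟨fun _ => ⟨by norm_num, .inr ⟨by simpa using h2, X, L', ?_⟩⟩, fun h => absurd h h2⟩
      exact ⟨by simpa using h3.path, h3.store.of_frame (c := .assign 20 (.const 0)) ⟨fun x hx =>
        Function.update_of_ne (by simpa [Cmd.wr] using hx) _ _, fun _ _ => rfl⟩, h3.found, h3.le⟩
  · rintro t ρ' α' _ _ h ht
    simp only [Exp.cost] at ht
    refine ⟨by omega, h.imp_left fun ⟨h2, h3, h4⟩ => ⟨h2, h3, fun s => ?_⟩⟩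
    by_cases hs : s < G.m + 1
    · exact h4 s hs
    · refine List.eq_nil_iff_forall_not_mem.2 fun Z hZ => ?_
      have h5 := h3.size s Z hZ
      have h6 := card_le_card (h3.tree Z (.inr ⟨s, hZ⟩)).sub
      rw [card_range] at h6
      omega
  · rintro t ρ' α' _ ⟨ht, h⟩
    exact Run.nil ⟨by omega, h⟩

end RAM

/-! ## Exploration of the neighbours of a set -/

/-- Vertices covered by the current set. -/
notation "aCurV" => 17

namespace RAM

open Finset

/-- Copy the first entries of array `a` to array `b`. -/
def copy (a b x : ℕ) : Cmd := loop x (.const 0) (.reg rM) (.store b (.reg x) (.arr a (.reg x)))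

/-- Mark in array `b` the vertices covered by the edges in array `a`. -/
def markCov (a b x : ℕ) : Cmd := block [clear b x rN, loop x (.const 0) (.reg rD)
  (.ite (.arr a (.edge x)) (.store b (.tail x) (.const 1)) .skip)]

variable {G : GraphInput} {I : Input} {ρ ρ' : Regs} {α α' : Arrs} {X Y R : Finset ℕ}
  {P : List (Finset ℕ)} {L L' : ℕ → List (Finset ℕ)}

theorem copy_run {a b x : ℕ} (hE : Env G ρ α) (hab : a ≠ b) (hx : x ≠ rM) :
    Run I (copy a b x) ρ α fun t _ α' => t ≤ 20 * G.m + 10 ∧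
      supp G.m (α' b) = supp G.m (α a) := by
  have hwr : (copy a b x).wr rM = false := by simp [copy, loop, Cmd.wr, hx.symm]
  have hwa : (copy a b x).wa a = false := by simp [copy, loop, Cmd.wa, hab]
  refine Run.loop_uniform 10 (L := 0) (B := G.m) (fun i ρ' α' => ∀ j < i, α' b j = α a j) rfl
    (Nat.zero_le _) (by simp) rfl (fun i ρ' α' hF _ _ _ => (hF.1 _ hwr).trans hE.m_eq) ?_ ?_
  · intro i ρ' α' _ hi hx hF h
    have ha : α' a = α a := hF.2 a hwa
    refine Run.of_wp ⟨by simp [Exp.cost], fun j hj => ?_⟩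
    simp only [Exp.ev, hx, Function.update_self, Function.update_apply, ha]
    split_ifs with h'
    · rw [h']
    · exact h j (by omega)
  · intro t ρ' α' _ _ h ht
    simp only [Exp.cost] at ht
    refine ⟨by omega, ?_⟩
    ext i
    simp only [mem_supp]
    exact and_congr_right fun hi => by rw [h i hi]

theorem markCov_run {a b x : ℕ} (hE : Env G ρ α) (hab : a ≠ b) (hx : 3 ≤ x) (hb : 4 ≤ b)
    (hX : supp G.m (α a) = X) :
    Run I (markCov a b x) ρ α fun t _ α' => t ≤ 100 * G.m + 50 + 11 * G.n ∧
      supp G.n (α' b) = G.cov X := by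
  refine Run.cons (clear_run (by omega)) ?_
  rintro t₁ ρ₁ α₁ hF₁ ⟨ht₁, h₁⟩
  rw [hE.n_eq] at ht₁ h₁
  have hk : KeepsEnv (clear b x rN) = true := by
    simp [KeepsEnv, clear, loop, Cmd.wr, Cmd.wa]
    omega
  have hE₁ := hE.of_frame hF₁ hk
  have hX₁ : supp G.m (α₁ a) = X := by
    rw [hF₁.2 a (by simp [clear, loop, Cmd.wa, hab]), hX]
  clear hF₁ hX hE
  have hwr : (loop x (.const 0) (.reg rD)
      (.ite (.arr a (.edge x)) (.store b (.tail x) (.const 1)) .skip)).wr rD = false := by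
    simp [loop, Cmd.wr]
    omega
  have hwa : ∀ c, c ≠ b → (loop x (.const 0) (.reg rD)
      (.ite (.arr a (.edge x)) (.store b (.tail x) (.const 1)) .skip)).wa c = false := by
    intro c hc
    simp [loop, Cmd.wa, hc]
  refine Run.cons (Run.loop_uniform 20 (L := 0) (B := ρ₁ rD) (fun d _ α' => supp G.n (α' b) ⊆ G.cov X ∧
    ∀ d' < d, α₁ aEdge d' ∈ X → α₁ aTail d' ∈ supp G.n (α' b)) (Q := fun t _ α' =>
      t ≤ 100 * G.m + 6 ∧ supp G.n (α' b) = G.cov X) rfl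
    (Nat.zero_le _) (by simp [h₁]) rfl (fun i ρ' α' hF _ _ _ => hF.1 _ hwr) ?_ ?_) ?_
  · rintro d ρ₂ α₂ _ hd hx hF ⟨h2, h3⟩
    have hj := hE₁.darts.join d hd
    have ha : α₂ a = α₁ a := hF.2 _ (hwa _ hab)
    have he : α₂ aEdge = α₁ aEdge := hF.2 _ (hwa _ (by omega))
    have ht : α₂ aTail = α₁ aTail := hF.2 _ (hwa _ (by omega))
    have h0 := eq_zero_iff_notMem_supp (f := α₁ a) hj.lt_m
    rw [hX₁] at h0
    refine Run.of_wp ?_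
    simp only [wp, Exp.ev, Exp.cost, Exp.edge, Exp.tail, hx, ha, he, ht, ne_eq, h0, not_not,
      Function.update_self, supp_update_one hj.lt_left]
    refine ⟨fun h => ⟨by norm_num, insert_subset (hj.mem_cov h) h2, fun d' hd' hX' => ?_⟩,
      fun h => ⟨by norm_num, h2, fun d' hd' hX' => ?_⟩⟩
    · obtain h | rfl : d' < d ∨ d' = d := by omega
      · exact mem_insert_of_mem (h3 d' h hX')
      · exact mem_insert_self _ _
    · obtain h' | rfl : d' < d ∨ d' = d := by omega
      · exact h3 d' h' hX'
      · exact absurd hX' h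
  · rintro t ρ' α' _ _ ⟨h2, h3⟩ ht
    have := hE₁.darts.le
    simp only [Exp.cost] at ht
    refine ⟨by omega, h2.antisymm fun v hv => ?_⟩
    obtain ⟨i, hi, w, hw⟩ := GraphInput.mem_cov.1 hv
    obtain ⟨d, hd, rfl, rfl, rfl⟩ := hE₁.darts.complete i v w hw
    exact h3 d hd hi
  · rintro t ρ' α' _ ⟨ht, h⟩
    exact Run.nil ⟨by omega, h⟩

theorem Found.mono (h : ∀ s, L s ⊆ L' s) (hX : Found P L X) : Found P L' X :=
  hX.imp_right fun ⟨s, hs⟩ => ⟨s, h s hs⟩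

/-- The memory is prepared for the exploration of the neighbours of `X` that arise by the removal
of the edge `e`, which joins `x` and `y`. -/
structure Removed (G : GraphInput) (X : Finset ℕ) (e x y : ℕ) (α : Arrs) : Prop where
  tree : G.IsTree X
  dom : G.Dom X
  mem : e ∈ X
  joins : G.Joins e x y
  search : supp G.m (α aSearch) = X.erase e
  reach : ∀ v < G.n, α aReach v = 0 ↔ ¬ G.Reach (X.erase e) x v
  cov : ∀ v < G.n, α aCurV v = 0 ↔ v ∉ G.cov X

theorem Removed.of_frame {c : Cmd} {e x y : ℕ} (h : Removed G X e x y α) (hF : Frame c ρ α ρ' α')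
    (h1 : c.wa aSearch = false := by rfl) (h2 : c.wa aReach = false := by rfl)
    (h3 : c.wa aCurV = false := by rfl) : Removed G X e x y α' :=
  ⟨h.tree, h.dom, h.mem, h.joins, hF.2 _ h1 ▸ h.search, hF.2 _ h2 ▸ h.reach, hF.2 _ h3 ▸ h.cov⟩

/-- Test whether the darts `22` and `23` reconnect the parts of the tree. -/
def testSwap : Cmd := .ite (.arr aCurV (.head 22))
  (.ite (.arr aReach (.head 22)) (.assign 24 (.const 0))
    (.ite (.dist (.head 23) (.tail 22)) (.assign 24 (.const 0)) (.assign 24 (.const 1))))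
  (.ite (.arr aCurV (.head 23))
    (.ite (.arr aReach (.head 23)) (.assign 24 (.const 0)) (.assign 24 (.const 1)))
    (.assign 24 (.const 0)))

def trySwap : Cmd := block [testSwap, .ite (.reg 24) (block [copy aSearch aSet 25,
  .store aSet (.edge 22) (.const 1), .store aSet (.edge 23) (.const 1), insertSet]) .skip]

def swaps : Cmd := loop 22 (.const 0) (.reg rD) (.ite (.arr aReach (.tail 22))
  (loop 23 (.arr aFirst (.head 22)) (.arr aFirst (.add (.head 22) (.const 1))) trySwap) .skip)

theorem testSwap_run {e x y d d' : ℕ} (hR : Removed G X e x y α) (h22 : ρ 22 = d) (h23 : ρ 23 = d')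
    (hd : G.Joins (α aEdge d) (α aTail d) (α aHead d))
    (hd' : G.Joins (α aEdge d') (α aHead d) (α aHead d'))
    (hx : G.Reach (X.erase e) x (α aTail d)) :
    Run I testSwap ρ α fun t ρ' α' => t ≤ 60 ∧ α' = α ∧ (ρ' 24 ≠ 0 ↔
      G.IsSwap X e x (α aEdge d) (α aEdge d') (α aTail d) (α aHead d) (α aHead d')) := by
  refine Run.of_wp ?_
  simp only [testSwap, wp, Exp.ev, Exp.cost, Exp.ev_dist, Exp.head, Exp.tail, h22, h23, ne_eq,
    hR.cov _ hd.lt_right, hR.reach _ hd.lt_right, hR.cov _ hd'.lt_right, hR.reach _ hd'.lt_right,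
    not_not, Function.update_self, GraphInput.IsSwap, hd, hd', hx, Exp.cost_dist, true_and]
  refine ⟨fun h1 => ⟨fun h2 => ?_, fun h2 => ⟨fun h3 => ?_, fun h3 => ?_⟩⟩,
    fun h1 => ⟨fun h2 => ⟨fun h3 => ?_, fun h3 => ?_⟩, fun h2 => ?_⟩⟩
  all_goals
    refine ⟨by norm_num, ?_⟩
    simp [*]

theorem trySwap_run (hG : G.Admissible) (hE : Env G ρ α) (hS : Store G P L ρ α)
    {e x y d d' : ℕ} (hR : Removed G X e x y α) (h22 : ρ 22 = d) (h23 : ρ 23 = d')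
    (hd : G.Joins (α aEdge d) (α aTail d) (α aHead d))
    (hd' : G.Joins (α aEdge d') (α aHead d) (α aHead d'))
    (hx : G.Reach (X.erase e) x (α aTail d)) :
    Run I trySwap ρ α fun t ρ' α' => t ≤ 800 * G.m ∧ ∃ L', Store G P L' ρ' α' ∧
      (∀ s, L s ⊆ L' s) ∧
      (G.IsSwap X e x (α aEdge d) (α aEdge d') (α aTail d) (α aHead d) (α aHead d') →
        ∃ Z, Found P L' Z ∧ Z ⊆ insert (α aEdge d) (insert (α aEdge d') (X.erase e))) := by
  have hm := hG.two_le_m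
  refine Run.cons (testSwap_run hR h22 h23 hd hd' hx) ?_
  rintro t₁ ρ₁ α₁ hF₁ ⟨ht₁, hα, h₁⟩
  have hE₁ := hE.of_frame hF₁
  have hS₁ := hS.of_frame hF₁
  rw [← hF₁.reg 22] at h22
  rw [← hF₁.reg 23] at h23
  clear hF₁ hE hS
  subst hα
  refine Run.cons (Q₁ := fun t ρ' α' => t ≤ 730 * G.m + 30 ∧ ∃ L', Store G P L' ρ' α' ∧
      (∀ s, L s ⊆ L' s) ∧
      (G.IsSwap X e x (α₁ aEdge d) (α₁ aEdge d') (α₁ aTail d) (α₁ aHead d) (α₁ aHead d') →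
        ∃ Z, Found P L' Z ∧ Z ⊆ insert (α₁ aEdge d) (insert (α₁ aEdge d') (X.erase e))))
    (Run.ite (fun hs => ?_) fun hs => ?_) ?_
  · simp only [Exp.ev] at hs
    rw [h₁] at hs
    have hsw := hR.tree.swap hR.mem hR.joins hs
    refine Run.cons (copy_run hE₁ (by decide) (by decide)) ?_
    rintro t₂ ρ₂ α₂ hF₂ ⟨ht₂, h₂⟩
    have hE₂ := hE₁.of_frame hF₂
    have hS₂ := hS₁.of_frame hF₂
    have hedge : α₂ aEdge = α₁ aEdge := hF₂.arr _
    rw [← hF₂.reg 22] at h22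
    rw [← hF₂.reg 23] at h23
    rw [hR.search] at h₂
    refine Run.cons (Q₁ := fun t _ α' => t = 4 ∧
      supp G.m (α' aSet) = insert (α₁ aEdge d) (X.erase e)) (Run.of_wp ?_) ?_
    · simp only [wp, Exp.ev, Exp.cost, Exp.edge, h22, hedge, Function.update_self,
        supp_update_one hd.lt_m, h₂, and_self]
    rintro _ ρ₃ α₃ hF₃ ⟨rfl, h₃⟩
    have hE₃ := hE₂.of_frame hF₃
    have hS₃ := hS₂.of_frame hF₃
    rw [← hF₃.reg 23] at h23
    rw [← hF₃.arr aEdge] at hedge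
    refine Run.cons (Q₁ := fun t _ α' => t = 4 ∧
      supp G.m (α' aSet) = insert (α₁ aEdge d) (insert (α₁ aEdge d') (X.erase e)))
      (Run.of_wp ?_) ?_
    · simp only [wp, Exp.ev, Exp.cost, Exp.edge, h23, hedge, Function.update_self,
        supp_update_one hd'.lt_m, h₃, true_and]
      exact insert_comm _ _ _
    rintro _ ρ₄ α₄ hF₄ ⟨rfl, h₄⟩
    refine Run.cons (insertSet_run hG (hE₃.of_frame hF₄) (hS₃.of_frame hF₄) h₄ hsw.1
      (hR.dom.mono hsw.2)) ?_
    rintro t₅ ρ₅ α₅ hF₅ ⟨ht₅, L', h₅, h₆, Z, hZ, h₇⟩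
    refine Run.nil ⟨?_, L', h₅, h₆, fun _ => ⟨Z, h₇, hZ⟩⟩
    simp only [Exp.cost]
    omega
  · simp only [Exp.ev] at hs
    refine Run.of_wp ⟨by simp only [Exp.cost]; omega, L, hS₁, fun _ => List.Subset.refl _,
      fun hsw => absurd hs (h₁.2 hsw)⟩
  · rintro t ρ' α' _ ⟨ht, h⟩
    exact Run.nil ⟨by omega, h⟩

theorem swaps_run (hG : G.Admissible) (hE : Env G ρ α) (hS : Store G P L ρ α)
    {e x y : ℕ} (hR : Removed G X e x y α) :
    Run I swaps ρ α fun t ρ' α' => t ≤ 3000 * (G.m ^ 2 * G.maxDeg) ∧ ∃ L', Store G P L' ρ' α' ∧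
      (∀ s, L s ⊆ L' s) ∧
      ∀ i j a w b, G.IsSwap X e x i j a w b →
        ∃ Z, Found P L' Z ∧ Z ⊆ insert i (insert j (X.erase e)) := by
  have hm := hG.two_le_m
  have hΔ := hG.one_le_maxDeg
  refine Run.loop_uniform (G.maxDeg * (800 * G.m + 30) + 40) (L := 0) (B := ρ rD) (fun d ρ' α' =>
    ∃ L', Store G P L' ρ' α' ∧ (∀ s, L s ⊆ L' s) ∧ ∀ d₁ < d, ∀ d₂ < ρ rD, α aTail d₂ = α aHead d₁ →
      G.IsSwap X e x (α aEdge d₁) (α aEdge d₂) (α aTail d₁) (α aHead d₁) (α aHead d₂) →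
        ∃ Z, Found P L' Z ∧ Z ⊆ insert (α aEdge d₁) (insert (α aEdge d₂) (X.erase e)))
    rfl (Nat.zero_le _) ⟨L, ?_, fun _ => List.Subset.refl _, by simp⟩ rfl
    (fun i ρ' α' hF _ _ _ => hF.reg rD) ?_ ?_
  · exact hS.of_frame (c := .assign 22 (.const 0)) ⟨fun x hx => Function.update_of_ne (by
      simpa [Cmd.wr] using hx) _ _, fun _ _ => rfl⟩
  · rintro d ρ₁ α₁ _ hd hx hF₁ ⟨L₁, hS₁, hL₁, h₁⟩
    have hE₁ := hE.of_frame hF₁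
    have hR₁ := hR.of_frame hF₁
    have hj := hE.darts.join d hd
    have hT : α₁ aTail = α aTail := hF₁.arr _
    have hH : α₁ aHead = α aHead := hF₁.arr _
    have hEd : α₁ aEdge = α aEdge := hF₁.arr _
    have hFi : α₁ aFirst = α aFirst := hF₁.arr _
    have hD : ρ₁ rD = ρ rD := hF₁.reg rD
    have hupd : ∀ (i v : ℕ) {ρ' α' L'}, i = 22 ∨ i = 23 → Store G P L' ρ' α' →
        Store G P L' (Function.update ρ' i v) α' := by
      intro i v ρ' α' L' hi h
      refine h.of_frame (c := .assign i (.const 0)) ⟨fun x hx => Function.update_of_ne (by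
        simpa [Cmd.wr] using hx) _ _, fun _ _ => rfl⟩ ?_
      obtain rfl | rfl := hi <;> rfl
    refine Run.ite (fun h => ?_) fun h => ?_
    · simp only [Exp.ev, Exp.tail, hx, hT, ne_eq, hR₁.reach _ hj.lt_left, not_not] at h
      have hv := hj.lt_right
      refine Run.loop_uniform (800 * G.m) (L := α aFirst (α aHead d))
        (B := α aFirst (α aHead d + 1)) (fun d' ρ' α' =>
        ∃ L', Store G P L' ρ' α' ∧ (∀ s, L₁ s ⊆ L' s) ∧ ∀ d₂, α aFirst (α aHead d) ≤ d₂ → d₂ < d' →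
          G.IsSwap X e x (α aEdge d) (α aEdge d₂) (α aTail d) (α aHead d) (α aHead d₂) →
            ∃ Z, Found P L' Z ∧ Z ⊆ insert (α aEdge d) (insert (α aEdge d₂) (X.erase e)))
        (by simp [Exp.ev, Exp.head, hx, hH, hFi]) (hE.darts.first_le _ hv)
        ⟨L₁, hupd _ _ (.inr rfl) hS₁, fun _ => List.Subset.refl _, fun _ _ _ => by omega⟩ rfl ?_ ?_ ?_
      · intro i ρ' α' hF _ _ _
        have h1 : ρ' 22 = d := (hF.reg 22).trans hx
        have h2 : α' aFirst = α aFirst := (hF.arr _).trans hFi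
        have h3 : α' aHead = α aHead := (hF.arr _).trans hH
        simp [Exp.ev, Exp.head, h1, h2, h3]
      · rintro d' ρ₂ α₂ hd'1 hd'2 hx' hF₂ ⟨L₂, hS₂, hL₂, h₂⟩
        have hd'D : d' < ρ rD := by
          have := hE.darts.le_last _ hv
          omega
        have hj' := hE.darts.join d' hd'D
        rw [(hE.darts.tail_eq _ hv d' hd'D).2 ⟨hd'1, hd'2⟩] at hj'
        have hT₂ : α₂ aTail = α aTail := (hF₂.arr _).trans hT
        have hH₂ : α₂ aHead = α aHead := (hF₂.arr _).trans hH
        have hEd₂ : α₂ aEdge = α aEdge := (hF₂.arr _).trans hEd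
        refine (trySwap_run hG (hE₁.of_frame hF₂) hS₂ (hR₁.of_frame hF₂) ((hF₂.reg 22).trans hx) hx'
          (by rwa [hT₂, hH₂, hEd₂]) (by rwa [hH₂, hEd₂]) (by rwa [hT₂])).imp ?_
        rintro t ρ₃ α₃ hF₃ ⟨ht, L₃, hS₃, hL₃, h₃⟩
        rw [hT₂, hH₂, hEd₂] at h₃
        refine ⟨ht, L₃, hupd _ _ (.inr rfl) hS₃, fun s => List.Subset.trans (hL₂ s) (hL₃ s),
          fun d₂ hd₂ hd₂' hsw => ?_⟩
        obtain hlt | rfl : d₂ < d' ∨ d₂ = d' := by omega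
        · obtain ⟨Z, hZ, hZ'⟩ := h₂ d₂ hd₂ hlt hsw
          exact ⟨Z, hZ.mono hL₃, hZ'⟩
        · exact h₃ hsw
      · rintro t ρ₂ α₂ hF₂ _ ⟨L₂, hS₂, hL₂, h₂⟩ ht
        simp only [Exp.cost, Exp.head, Exp.tail] at ht ⊢
        have hdeg := hE.darts.last_sub_first_le hv
        refine ⟨?_, L₂, hupd _ _ (.inl rfl) hS₂, fun s => List.Subset.trans (hL₁ s) (hL₂ s),
          fun d₁ hd₁ d₂ hd₂ ht₂ hsw => ?_⟩
        · have := Nat.mul_le_mul hdeg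
            (show 800 * G.m + (1 + 1 + 1 + 1 + 1) + 7 ≤ 800 * G.m + 30 by omega)
          omega
        · obtain hlt | rfl : d₁ < d ∨ d₁ = d := by omega
          · obtain ⟨Z, hZ, hZ'⟩ := h₁ d₁ hlt d₂ hd₂ ht₂ hsw
            exact ⟨Z, hZ.mono hL₂, hZ'⟩
          · have := (hE.darts.tail_eq _ hv d₂ hd₂).1 ht₂
            exact h₂ d₂ this.1 this.2 hsw
    · simp only [Exp.ev, Exp.tail, hx, hT, hR₁.reach _ hj.lt_left] at h
      refine Run.of_wp ⟨by simp only [Exp.cost, Exp.tail]; omega, L₁, hupd _ _ (.inl rfl) hS₁, hL₁,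
        fun d₁ hd₁ d₂ hd₂ ht₂ hsw => ?_⟩
      obtain hlt | rfl : d₁ < d ∨ d₁ = d := by omega
      · exact h₁ d₁ hlt d₂ hd₂ ht₂ hsw
      · exact absurd hsw.2.2.1 h
  · rintro t ρ' α' _ _ ⟨L', hS', hL', h'⟩ ht
    have hD := hE.darts.le
    refine ⟨?_, L', hS', hL', fun i j a w b hsw => ?_⟩
    · simp only [Exp.cost] at ht
      have h1 : (ρ rD - 0) * (G.maxDeg * (800 * G.m + 30) + 40 + 1 + 7) ≤
          2 * G.m * (G.maxDeg * (800 * G.m + 30) + 48) := Nat.mul_le_mul (by omega) (by omega)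
      have h2 : G.m ≤ G.m * G.maxDeg := Nat.le_mul_of_pos_right _ (by omega)
      have h3 : 2 * (G.m * G.maxDeg) ≤ G.m ^ 2 * G.maxDeg := by
        rw [pow_two, mul_assoc]
        exact Nat.mul_le_mul_right _ hm
      have h4 : 2 * G.m * (G.maxDeg * (800 * G.m + 30) + 48) =
        1600 * (G.m ^ 2 * G.maxDeg) + 60 * (G.m * G.maxDeg) + 96 * G.m := by ring
      omega
    · obtain ⟨d₁, hd₁, rfl, rfl, rfl⟩ := hE.darts.complete _ _ _ hsw.1
      obtain ⟨d₂, hd₂, rfl, ht₂, rfl⟩ := hE.darts.complete _ _ _ hsw.2.1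
      exact h' d₁ hd₁ d₂ hd₂ ht₂ hsw

end RAM

/-- Vertices covered by the set under construction. -/
notation "aMark" => 18
/-- Neighbours of a leaf that are not covered. -/
notation "aNbr" => 19

namespace RAM

open Finset

variable {G : GraphInput} {I : Input} {ρ ρ' : Regs} {α α' : Arrs} {X F : Finset ℕ}
  {P : List (Finset ℕ)} {L L' : ℕ → List (Finset ℕ)} {e x y : ℕ}

theorem Store.update (h : Store G P L ρ α) (i v : ℕ) (hi : i ≠ rNodes := by decide) :
    Store G P L (Function.update ρ i v) α := by
  refine h.of_frame (c := .assign i (.const 0)) ⟨fun x hx => Function.update_of_ne (by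
    simpa [Cmd.wr] using hx) _ _, fun _ _ => rfl⟩ ?_
  simp [KeepsStore, Cmd.wr, Cmd.wa, hi.symm]

/-- The result of replacing the leaf `x` of `X` by some of its neighbours. -/
structure Detached (G : GraphInput) (X : Finset ℕ) (x : ℕ) (F : Finset ℕ) : Prop where
  tree : G.IsTree F
  super : ∀ v ∈ G.cov X, v ≠ x → v ∈ G.cov F
  sub : ∀ v ∈ G.cov F, (v ∈ G.cov X ∧ v ≠ x) ∨ (v ∉ G.cov X ∧ ∃ i, G.Joins i x v)

theorem Removed.detached (hG : G.Admissible) (h : Removed G X e x y α)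
    (hx : x ∉ G.cov (X.erase e)) : Detached G X x (X.erase e) := by
  obtain ⟨h1, h2⟩ := h.tree.erase_leaf h.mem h.joins (fun j hj w hw => by
    by_contra hje
    exact hx (hw.mem_cov (mem_erase.2 ⟨hje, hj⟩))) (hG.two_le (h.tree.ceds h.dom))
  refine ⟨h1, fun v hv hvx => ?_, fun v hv => ?_⟩
  · exact h2 ▸ mem_erase.2 ⟨hvx, hv⟩
  · rw [h2, mem_erase] at hv
    exact .inl ⟨hv.2, hv.1⟩

theorem Detached.attach (h : Detached G X x F) (hd : G.Dom X) {i w t : ℕ} (hi : G.Joins i w t)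
    (hw : w ∉ G.cov X) (hxw : ∃ j, G.Joins j x w) (hwF : w ∉ G.cov F) (ht : t ≠ x) :
    Detached G X x (insert i F) ∧ G.cov (insert i F) = insert w (G.cov F) := by
  have htX := (hd i w t hi).resolve_left hw
  obtain ⟨h1, h2⟩ := h.tree.pendant hi.symm (h.super t htX ht) hwF
  refine ⟨⟨h1, fun v hv hvx => ?_, fun v hv => ?_⟩, h2⟩
  · exact h2 ▸ mem_insert_of_mem (h.super v hv hvx)
  · rw [h2, mem_insert] at hv
    obtain rfl | hv := hv
    · exact .inr ⟨hw, hxw⟩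
    · exact h.sub v hv

def markNbrs : Cmd := loop 22 (.const 0) (.reg rD) (.ite (.dist (.tail 22) (.reg 10)) .skip
  (.ite (.arr aCurV (.head 22)) .skip (.store aNbr (.head 22) (.const 1))))

def attachNbrs : Cmd := loop 22 (.const 0) (.reg rD) (.ite (.arr aNbr (.tail 22))
  (.ite (.arr aMark (.tail 22)) .skip (.ite (.dist (.head 22) (.reg 10))
    (block [.store aSet (.edge 22) (.const 1), .store aMark (.tail 22) (.const 1)]) .skip)) .skip)

/-- Test whether the set under construction is dominating. -/
def testDom : Cmd := block [.assign 24 (.const 1), loop 22 (.const 0) (.reg rD)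
  (.ite (.arr aMark (.tail 22)) .skip (.ite (.arr aMark (.head 22)) .skip
    (.assign 24 (.const 0))))]

/-- Find the neighbour of the current set that arises by the removal of the leaf `10`. -/
def leafMove : Cmd := block [copy aSearch aSet 25, markCov aSet aMark 25,
  .ite (.arr aMark (.reg 10)) .skip (block [clear aNbr 25 rN, markNbrs, attachNbrs, testDom,
    .ite (.reg 24) insertSet .skip])]

theorem markNbrs_run (hE : Env G ρ α) (hR : Removed G X e x y α) (h10 : ρ 10 = x)
    (h0 : supp G.n (α aNbr) = ∅) :
    Run I markNbrs ρ α fun t _ α' => t ≤ 80 * G.m + 10 ∧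
      ∀ v < G.n, α' aNbr v = 0 ↔ ¬ (v ∉ G.cov X ∧ ∃ i, G.Joins i x v) := by
  refine Run.loop_uniform 30 (L := 0) (B := ρ rD) (fun d _ α' => ∀ v < G.n,
    α' aNbr v ≠ 0 ↔ v ∉ G.cov X ∧ ∃ d' < d, α aTail d' = x ∧ α aHead d' = v) rfl (Nat.zero_le _)
    ?_ rfl (fun i ρ' α' hF _ _ _ => hF.reg rD) ?_ ?_
  · intro v hv
    have : v ∉ supp G.n (α aNbr) := by simp [h0]
    simpa using (eq_zero_iff_notMem_supp hv).2 this
  · intro d ρ₁ α₁ _ hd hx hF hI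
    have hj := hE.darts.join d hd
    have hT : α₁ aTail = α aTail := hF.arr _
    have hH : α₁ aHead = α aHead := hF.arr _
    have hV : α₁ aCurV = α aCurV := hF.arr _
    have h10' : ρ₁ 10 = x := (hF.reg 10).trans h10
    refine Run.of_wp ?_
    simp only [wp, Exp.ev, Exp.ev_dist, Exp.head, Exp.tail, Exp.cost, Exp.cost_dist, hx, hT, hH, hV,
      h10', ne_eq, hR.cov _ hj.lt_right, not_not, Nat.lt_succ_iff_lt_or_eq, or_and_right,
      exists_or, exists_eq_left]
    refine ⟨fun h => ⟨by norm_num, fun v hv => ?_⟩, fun h => ⟨fun h' => ⟨by norm_num, fun v hv => ?_⟩,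
      fun h' => ⟨by norm_num, fun v hv => ?_⟩⟩⟩
    · rw [← ne_eq, hI v hv]
      simp [h]
    · rw [← ne_eq, hI v hv]
      refine and_congr_right fun hvX => (or_iff_left ?_).symm
      rintro ⟨-, rfl⟩
      exact hvX h'
    · rw [Function.update_self, Function.update_apply]
      split_ifs with hv'
      · simp [h, h', hv']
      · rw [← ne_eq, hI v hv]
        simp [Ne.symm hv']
  · intro t ρ' α' hF _ h ht
    have hD := hE.darts.le
    simp only [Exp.cost] at ht
    refine ⟨by omega, fun v hv => ?_⟩
    rw [← not_iff_not, not_not, ← ne_eq, h v hv]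
    refine and_congr_right fun _ => ⟨?_, ?_⟩
    · rintro ⟨d, hd, rfl, rfl⟩
      exact ⟨_, hE.darts.join d hd⟩
    · rintro ⟨i, hi⟩
      obtain ⟨d, hd, -, h1, h2⟩ := hE.darts.complete i x v hi
      exact ⟨d, hd, h1, h2⟩

theorem attachNbrs_run (hE : Env G ρ α) (hR : Removed G X e x y α) (h10 : ρ 10 = x)
    (hF : Detached G X x (supp G.m (α aSet)))
    (hV : supp G.n (α aMark) = G.cov (supp G.m (α aSet)))
    (hN : ∀ v < G.n, α aNbr v = 0 ↔ ¬ (v ∉ G.cov X ∧ ∃ i, G.Joins i x v)) :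
    Run I attachNbrs ρ α fun t _ α' => t ≤ 120 * G.m + 10 ∧
      Detached G X x (supp G.m (α' aSet)) ∧ supp G.n (α' aMark) = G.cov (supp G.m (α' aSet)) ∧
      ∀ i w, G.Joins i x w → w ∉ G.cov X → (∃ j t, G.Joins j w t ∧ t ≠ x) →
        w ∈ G.cov (supp G.m (α' aSet)) := by
  refine Run.loop_uniform 50 (L := 0) (B := ρ rD) (fun d _ α' =>
    Detached G X x (supp G.m (α' aSet)) ∧ supp G.n (α' aMark) = G.cov (supp G.m (α' aSet)) ∧
      ∀ d' < d, (∃ i, G.Joins i x (α aTail d')) → α aTail d' ∉ G.cov X → α aHead d' ≠ x →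
        α aTail d' ∈ G.cov (supp G.m (α' aSet))) rfl (Nat.zero_le _)
    ⟨hF, hV, by simp⟩ rfl (fun i ρ' α' hF _ _ _ => hF.reg rD) ?_ ?_
  · rintro d ρ₁ α₁ _ hd hx hF ⟨hI₁, hI₂, hI₃⟩
    have hj := hE.darts.join d hd
    have hT : α₁ aTail = α aTail := hF.arr _
    have hH : α₁ aHead = α aHead := hF.arr _
    have hEd : α₁ aEdge = α aEdge := hF.arr _
    have hNb : α₁ aNbr = α aNbr := hF.arr _
    have h10' : ρ₁ 10 = x := (hF.reg 10).trans h10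
    have hM := eq_zero_iff_notMem_supp (f := α₁ aMark) hj.lt_left
    rw [hI₂] at hM
    have hlast : ∀ {p : ℕ → Prop}, (∀ d' < d, p d') → p d → ∀ d' < d + 1, p d' := by
      intro p h1 h2 d' hd'
      obtain h | rfl : d' < d ∨ d' = d := by omega
      · exact h1 d' h
      · exact h2
    refine Run.of_wp ?_
    simp only [block, wp, Exp.ev, Exp.ev_dist, Exp.head, Exp.tail, Exp.edge, Exp.cost,
      Exp.cost_dist, hx, hT, hH, hEd, hNb, h10', ne_eq, hM, hN _ hj.lt_left, not_not]
    refine ⟨fun h => ⟨fun h' => ⟨by norm_num, hI₁, hI₂, hlast hI₃ fun _ _ _ => h'⟩,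
      fun h' => ⟨fun hh => ?_, fun hh => ⟨by norm_num, hI₁, hI₂, hlast hI₃ fun _ _ h1 =>
        absurd hh h1⟩⟩⟩, fun h => ⟨by norm_num, hI₁, hI₂, hlast hI₃ fun h1 h2 _ =>
        absurd ⟨h2, h1⟩ h⟩⟩
    obtain ⟨h1, h2⟩ := hI₁.attach hR.dom hj h.1 h.2 h' hh
    have e1 : supp G.m (Function.update (α₁ aSet) (α aEdge d) 1) =
        insert (α aEdge d) (supp G.m (α₁ aSet)) := supp_update_one hj.lt_m
    simp only [Function.update_self, Nat.reduceEqDiff, not_false_eq_true, ne_eq,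
      Function.update_of_ne, hT, e1, supp_update_one hj.lt_left, h2, hI₂]
    exact ⟨by norm_num, h1, trivial, hlast (fun d' hd' a b c => mem_insert_of_mem (hI₃ d' hd' a b c))
      fun _ _ _ => mem_insert_self _ _⟩
  · rintro t ρ' α' hF _ ⟨h1, h2, h3⟩ ht
    have hD := hE.darts.le
    simp only [Exp.cost] at ht
    refine ⟨by omega, h1, h2, ?_⟩
    rintro i w hi hw ⟨j, t, hj, htx⟩
    obtain ⟨d, hd, -, rfl, rfl⟩ := hE.darts.complete j w t hj
    exact h3 d hd ⟨i, hi⟩ hw htx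

theorem testDom_run (hE : Env G ρ α) (hV : supp G.n (α aMark) = G.cov F) :
    Run I testDom ρ α fun t ρ' _ => t ≤ 80 * G.m + 20 ∧ (ρ' 24 ≠ 0 ↔ G.Dom F) := by
  refine Run.cons (Q₁ := fun t ρ' α' => t = 2 ∧ α' = α ∧ ρ' 24 = 1) (Run.of_wp ?_) ?_
  · simp [wp, Exp.ev, Exp.cost]
  rintro _ ρ₁ α₁ hF₁ ⟨rfl, hα, h₁⟩
  refine Run.cons (Run.loop_uniform 30 (L := 0) (B := ρ rD) (fun d ρ' _ => (ρ' 24 ≠ 0 ↔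
    ∀ d' < d, α aTail d' ∈ G.cov F ∨ α aHead d' ∈ G.cov F)) rfl (Nat.zero_le _)
    (by simp [h₁]) rfl (fun i ρ' α' hF _ _ _ => (hF.reg rD).trans (hF₁.reg rD)) ?_ 
    (Q := fun t ρ' _ => t ≤ 80 * G.m + 6 ∧ (ρ' 24 ≠ 0 ↔ G.Dom F)) ?_) ?_
  · intro d ρ₂ α₂ _ hd hx hF hI
    have hj := hE.darts.join d hd
    have hT : α₂ aTail = α aTail := by rw [hF.arr aTail, hα]
    have hH : α₂ aHead = α aHead := by rw [hF.arr aHead, hα]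
    have hM : α₂ aMark = α aMark := by rw [hF.arr aMark, hα]
    have h1 := eq_zero_iff_notMem_supp (f := α aMark) hj.lt_left
    have h2 := eq_zero_iff_notMem_supp (f := α aMark) hj.lt_right
    rw [hV] at h1 h2
    refine Run.of_wp ?_
    simp only [wp, Exp.ev, Exp.head, Exp.tail, Exp.cost, hx, hT, hH, hM, ne_eq, h1, h2, not_not,
      Nat.forall_lt_succ_right]
    refine ⟨fun h => ⟨by norm_num, ?_⟩, fun h => ⟨fun h' => ⟨by norm_num, ?_⟩,
      fun h' => ⟨by norm_num, ?_⟩⟩⟩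
    · simpa [h] using hI
    · simpa [h'] using hI
    · simp [h, h']
  · intro t ρ' α' hF _ h ht
    have hD := hE.darts.le
    simp only [Exp.cost] at ht
    refine ⟨by omega, h.trans ⟨fun h i u v hi => ?_, fun h d hd => h _ _ _ (hE.darts.join d hd)⟩⟩
    obtain ⟨d, hd, -, rfl, rfl⟩ := hE.darts.complete i u v hi
    exact h d hd
  · rintro t ρ' α' _ ⟨ht, h⟩
    exact Run.nil ⟨by omega, h⟩

theorem leafMove_run (hG : G.Admissible) (hE : Env G ρ α) (hS : Store G P L ρ α)
    (hR : Removed G X e x y α) (h10 : ρ 10 = x) :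
    Run I leafMove ρ α fun t ρ' α' => t ≤ 1500 * G.m ∧ ∃ L', Store G P L' ρ' α' ∧
      (∀ s, L s ⊆ L' s) ∧ (x ∉ G.cov (X.erase e) →
      (∀ i w, G.Joins i x w → w ∉ G.cov X → ∃ j t, G.Joins j w t ∧ t ≠ x) →
      ∃ Z, Found P L' Z ∧ ∀ v ∈ G.cov Z, (v ∈ G.cov X ∧ v ≠ x) ∨ ∃ i, G.Joins i x v) := by
  have hm := hG.two_le_m
  have hn := hG.n_le
  refine Run.cons (copy_run hE (by decide) (by decide)) ?_
  rintro t₁ ρ₁ α₁ hF₁ ⟨ht₁, h₁⟩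
  rw [hR.search] at h₁
  have hE₁ := hE.of_frame hF₁
  refine Run.cons (markCov_run hE₁ (by decide) (by decide) (by decide) h₁) ?_
  rintro t₂ ρ₂ α₂ hF₂ ⟨ht₂, h₂⟩
  have hE₂ := hE₁.of_frame hF₂
  have hS₂ := (hS.of_frame hF₁).of_frame hF₂
  have hR₂ := (hR.of_frame hF₁).of_frame hF₂
  have h10₂ : ρ₂ 10 = x := by rw [hF₂.reg 10, hF₁.reg 10, h10]
  rw [← hF₂.arr aSet] at h₁
  clear hF₁ hF₂ hE₁ hE hS hR h10
  have hxn := hR₂.joins.lt_left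
  have hx0 := eq_zero_iff_notMem_supp (f := α₂ aMark) hxn
  rw [h₂] at hx0
  refine Run.cons (Q₁ := fun t ρ' α' => t ≤ 1200 * G.m + 200 ∧ ∃ L', Store G P L' ρ' α' ∧
      (∀ s, L s ⊆ L' s) ∧ (x ∉ G.cov (X.erase e) →
      (∀ i w, G.Joins i x w → w ∉ G.cov X → ∃ j t, G.Joins j w t ∧ t ≠ x) →
      ∃ Z, Found P L' Z ∧ ∀ v ∈ G.cov Z, (v ∈ G.cov X ∧ v ≠ x) ∨ ∃ i, G.Joins i x v))
    (Run.ite (fun h => Run.of_wp ?_) fun h => ?_) ?_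
  · simp only [Exp.ev, h10₂, ne_eq, hx0] at h
    exact ⟨by simp [Exp.cost], L, hS₂, fun _ => List.Subset.refl _,
      fun h' => absurd h' h⟩
  · simp only [Exp.ev, h10₂, hx0] at h
    refine Run.cons (clear_run (by decide)) ?_
    rintro t₃ ρ₃ α₃ hF₃ ⟨ht₃, h₃⟩
    rw [hE₂.n_eq] at ht₃ h₃
    have hE₃ := hE₂.of_frame hF₃
    have hR₃ := hR₂.of_frame hF₃
    refine Run.cons (markNbrs_run hE₃ hR₃ ((hF₃.reg 10).trans h10₂) h₃) ?_
    rintro t₄ ρ₄ α₄ hF₄ ⟨ht₄, h₄⟩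
    have hE₄ := hE₃.of_frame hF₄
    have hR₄ := hR₃.of_frame hF₄
    have hset : supp G.m (α₄ aSet) = X.erase e := by rw [hF₄.arr aSet, hF₃.arr aSet, h₁]
    have hmark : supp G.n (α₄ aMark) = G.cov (X.erase e) := by
      rw [hF₄.arr aMark, hF₃.arr aMark, h₂]
    refine Run.cons (attachNbrs_run hE₄ hR₄ (by rw [hF₄.reg 10, hF₃.reg 10, h10₂])
      (hset ▸ hR₄.detached hG h) (hset ▸ hmark) h₄) ?_
    rintro t₅ ρ₅ α₅ hF₅ ⟨ht₅, h₅, h₅', h₅''⟩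
    have hE₅ := hE₄.of_frame hF₅
    refine Run.cons (testDom_run hE₅ h₅') ?_
    rintro t₆ ρ₆ α₆ hF₆ ⟨ht₆, h₆⟩
    have hE₆ := hE₅.of_frame hF₆
    have hS₆ := (((hS₂.of_frame hF₃).of_frame hF₄).of_frame hF₅).of_frame hF₆
    refine Run.cons (Q₁ := fun t ρ' α' => t ≤ 700 * G.m + 3 ∧ ∃ L', Store G P L' ρ' α' ∧
      (∀ s, L s ⊆ L' s) ∧ (x ∉ G.cov (X.erase e) →
      (∀ i w, G.Joins i x w → w ∉ G.cov X → ∃ j t, G.Joins j w t ∧ t ≠ x) →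
      ∃ Z, Found P L' Z ∧ ∀ v ∈ G.cov Z, (v ∈ G.cov X ∧ v ≠ x) ∨ ∃ i, G.Joins i x v))
      (Run.ite (fun hs => ?_) fun hs => ?_) ?_
    · simp only [Exp.ev] at hs
      rw [h₆] at hs
      refine (insertSet_run hG hE₆ hS₆ (by rw [hF₆.arr aSet]) h₅.tree hs).imp ?_
      rintro t ρ' α' _ ⟨ht, L', hS', hL', Z, hZ, hZF⟩
      refine ⟨by simp only [Exp.cost]; omega, L', hS', hL', fun _ _ => ⟨Z, hZF, fun v hv => ?_⟩⟩
      exact (h₅.sub v (GraphInput.cov_mono hZ hv)).imp_right And.right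
    · simp only [Exp.ev] at hs
      refine Run.of_wp ⟨by simp only [Exp.cost]; omega, L, hS₆, fun _ => List.Subset.refl _,
        fun _ happ => absurd hs (h₆.2 ?_)⟩
      have key : ∀ i a b, G.Joins i a b → a ∈ G.cov X →
          a ∈ G.cov (supp G.m (α₅ aSet)) ∨ b ∈ G.cov (supp G.m (α₅ aSet)) := by
        intro i a b hi ha
        by_cases hax : a = x
        · subst hax
          by_cases hb : b ∈ G.cov X
          · exact .inr (h₅.super b hb hi.ne.symm)
          · exact .inr (h₅'' i b hi hb (happ i b hi hb))
        · exact .inl (h₅.super a ha hax)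
      intro i a b hi
      obtain ha | hb := hR₂.dom i a b hi
      · exact key i a b hi ha
      · exact (key i b a hi.symm hb).symm
    · rintro t ρ' α' _ ⟨ht, h⟩
      refine Run.nil ⟨?_, h⟩
      simp only [Exp.cost]
      omega
  · rintro t ρ' α' _ ⟨ht, h⟩
    exact Run.nil ⟨by omega, h⟩

end RAM

namespace RAM

open Finset

/-- Explore the neighbours of the current set that arise by the removal of the edge of dart `21`. -/
def exploreDart : Cmd := block [copy aCur aSearch 25, .store aSearch (.edge 21) (.const 0),
  .assign 10 (.tail 21), search, swaps, leafMove]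

/-- Put all neighbours of the current set into the queue. -/
def explore : Cmd := block [markCov aCur aCurV 25, loop 21 (.const 0) (.reg rD)
  (.ite (.arr aCur (.edge 21)) exploreDart .skip)]

variable {G : GraphInput} {I : Input} {ρ ρ' : Regs} {α α' : Arrs} {X F : Finset ℕ}
  {P : List (Finset ℕ)} {L L' : ℕ → List (Finset ℕ)} {e x y d : ℕ}

theorem _root_.GraphInput.Explored.mono {D D' : Set (Finset ℕ)} (h : G.Explored D X e x)
    (hD : D ⊆ D') : G.Explored D' X e x :=
  ⟨fun i j a w b hs => (h.1 i j a w b hs).imp fun _ h => ⟨hD h.1, h.2⟩,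
    fun h1 h2 => (h.2 h1 h2).imp fun _ h => ⟨hD h.1, h.2⟩⟩

theorem exploreDart_run (hG : G.Admissible) (hE : Env G ρ α) (hS : Store G P L ρ α)
    (hT : G.IsTree X) (hD : G.Dom X) (hX : supp G.m (α aCur) = X)
    (hV : supp G.n (α aCurV) = G.cov X) (h21 : ρ 21 = d)
    (hj : G.Joins (α aEdge d) (α aTail d) (α aHead d)) (hd : α aEdge d ∈ X) :
    Run I exploreDart ρ α fun t ρ' α' => t ≤ 5000 * (G.m ^ 2 * G.maxDeg) ∧
      ∃ L', Store G P L' ρ' α' ∧ (∀ s, L s ⊆ L' s) ∧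
        G.Explored {Z | Found P L' Z} X (α aEdge d) (α aTail d) := by
  have hm := hG.two_le_m
  have hn := hG.n_le
  have hW : G.m ^ 2 ≤ G.m ^ 2 * G.maxDeg := Nat.le_mul_of_pos_right _ hG.one_le_maxDeg
  refine Run.cons (copy_run hE (by decide) (by decide)) ?_
  rintro t₁ ρ₁ α₁ hF₁ ⟨ht₁, h₁⟩
  have hE₁ := hE.of_frame hF₁
  have hS₁ := hS.of_frame hF₁
  rw [hX] at h₁
  rw [← hF₁.reg 21] at h21
  rw [← hF₁.arr aCurV] at hV
  rw [← hF₁.arr aEdge, ← hF₁.arr aTail, ← hF₁.arr aHead] at hj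
  rw [← hF₁.arr aEdge] at hd
  rw [← hF₁.arr aEdge, ← hF₁.arr aTail]
  clear hF₁ hX hE hS
  refine Run.cons (Q₁ := fun t _ α' => t = 4 ∧ supp G.m (α' aSearch) = X.erase (α₁ aEdge d))
    (Run.of_wp ?_) ?_
  · simp [wp, Exp.ev, Exp.cost, Exp.edge, h21, supp_update_zero, h₁]
  rintro _ ρ₂ α₂ hF₂ ⟨rfl, h₂⟩
  have hE₂ := hE₁.of_frame hF₂
  have hS₂ := hS₁.of_frame hF₂
  rw [← hF₂.reg 21] at h21
  rw [← hF₂.arr aCurV] at hV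
  rw [← hF₂.arr aEdge, ← hF₂.arr aTail, ← hF₂.arr aHead] at hj
  rw [← hF₂.arr aEdge] at hd h₂
  rw [← hF₂.arr aEdge, ← hF₂.arr aTail]
  clear hF₂ h₁ hE₁ hS₁
  refine Run.cons (Q₁ := fun t ρ' α' => t = 3 ∧ ρ' 10 = α₂ aTail d ∧ α' = α₂) (Run.of_wp ?_) ?_
  · simp [wp, Exp.ev, Exp.cost, Exp.tail, h21]
  rintro _ ρ₃ α₃ hF₃ ⟨rfl, h₃, rfl⟩
  have hE₃ := hE₂.of_frame hF₃
  have hS₃ := hS₂.of_frame hF₃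
  clear hF₃ hE₂ hS₂
  refine Run.cons (search_run hE₃ h₃ hj.lt_left h₂) ?_
  rintro t₄ ρ₄ α₄ hF₄ ⟨ht₄, h₄, h₄'⟩
  have hE₄ := hE₃.of_frame hF₄
  have hS₄ := hS₃.of_frame hF₄
  rw [← hF₄.arr aCurV] at hV
  rw [← hF₄.reg 10] at h₃
  rw [← hF₄.arr aSearch] at h₂
  clear hF₄ hE₃ hS₃
  have hR : Removed G X (α₃ aEdge d) (α₃ aTail d) (α₃ aHead d) α₄ := by
    refine ⟨hT, hD, hd, hj, h₂, fun v hv => ?_, fun v hv => ?_⟩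
    · rw [eq_zero_iff_notMem_supp hv, h₄'.mem_iff h₄]
    · rw [eq_zero_iff_notMem_supp hv, hV]
  refine Run.cons (swaps_run hG hE₄ hS₄ hR) ?_
  rintro t₅ ρ₅ α₅ hF₅ ⟨ht₅, L₅, h₅, h₅', h₅''⟩
  refine Run.cons (leafMove_run hG (hE₄.of_frame hF₅) h₅ (hR.of_frame hF₅)
    ((hF₅.reg 10).trans h₃)) ?_
  rintro t₆ ρ₆ α₆ hF₆ ⟨ht₆, L₆, h₆, h₆', h₆''⟩
  refine Run.nil ⟨?_, L₆, h₆, fun s => List.Subset.trans (h₅' s) (h₆' s),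
    fun i j a w b hs => ?_, h₆''⟩
  · have h1 : 200 * (G.n + 1) * (G.m + 1) ≤ 200 * (2 * G.m) * (2 * G.m) :=
      Nat.mul_le_mul (by omega) (by omega)
    have h2 : 2 * G.m ≤ G.m ^ 2 := by
      rw [pow_two]
      exact Nat.mul_le_mul_right _ hm
    have h3 : 200 * (2 * G.m) * (2 * G.m) = 800 * G.m ^ 2 := by ring
    omega
  · obtain ⟨Z, hZ, hZ'⟩ := h₅'' i j a w b hs
    exact ⟨Z, hZ.mono h₆', hZ'⟩

theorem explore_run (hG : G.Admissible) (hE : Env G ρ α) (hS : Store G P L ρ α)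
    (hT : G.IsTree X) (hD : G.Dom X) (hX : supp G.m (α aCur) = X) :
    Run I explore ρ α fun t ρ' α' => t ≤ 11000 * (G.n * G.m ^ 2 * G.maxDeg) ∧
      ∃ L', Store G P L' ρ' α' ∧ (∀ s, L s ⊆ L' s) ∧
        ∀ e ∈ X, ∀ x y, G.Joins e x y → G.Explored {Z | Found P L' Z} X e x := by
  have hm := hG.two_le_m
  have hn := hG.n_le
  have hn1 := hG.n_pos
  refine Run.cons (markCov_run hE (by decide) (by decide) (by decide) hX) ?_
  rintro t₁ ρ₁ α₁ hF₁ ⟨ht₁, h₁⟩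
  have hE₁ := hE.of_frame hF₁
  have hS₁ := hS.of_frame hF₁
  rw [← hF₁.arr aCur] at hX
  clear hF₁ hE hS
  set W := G.m ^ 2 * G.maxDeg with hW
  refine Run.cons (Run.loop (L := 0) (B := ρ₁ rD) (fun d t ρ' α' =>
    t ≤ 20 * d + (5000 * W + 20) * #((range d).filter fun d' => α₁ aEdge d' ∈ X) ∧
      ∃ L', Store G P L' ρ' α' ∧ (∀ s, L s ⊆ L' s) ∧ ∀ d' < d, α₁ aEdge d' ∈ X →
        G.Explored {Z | Found P L' Z} X (α₁ aEdge d') (α₁ aTail d'))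
    (Q := fun t ρ' α' => t ≤ 40 * G.m + 6 + (5000 * W + 20) * (2 * #X) ∧
      ∃ L', Store G P L' ρ' α' ∧ (∀ s, L s ⊆ L' s) ∧
        ∀ e ∈ X, ∀ x y, G.Joins e x y → G.Explored {Z | Found P L' Z} X e x)
    rfl (Nat.zero_le _) ⟨by simp, L, hS₁.update _ _, fun _ => List.Subset.refl _, by simp⟩ rfl
    (fun i ρ' α' hF _ _ _ => hF.reg rD) ?_ ?_) ?_
  · rintro d t ρ₂ α₂ _ hd hx hF ⟨ht, L₂, hS₂, hL₂, h₂⟩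
    have hj := hE₁.darts.join d hd
    have hX₂ : supp G.m (α₂ aCur) = X := by rw [hF.arr aCur, hX]
    have hEd : α₂ aEdge = α₁ aEdge := hF.arr _
    have h0 := eq_zero_iff_notMem_supp (f := α₂ aCur) hj.lt_m
    rw [hX₂] at h0
    rw [← hEd, ← hF.arr aTail, ← hF.arr aHead] at hj
    rw [range_add_one, filter_insert]
    refine Run.ite (fun h => ?_) fun h => ?_
    · simp only [Exp.ev, Exp.edge, hx, hEd, ne_eq, h0, not_not] at h
      refine (exploreDart_run hG (hE₁.of_frame hF) hS₂ hT hD hX₂ (by rw [hF.arr aCurV, h₁]) hx hj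
        (hEd ▸ h)).imp ?_
      rintro t' ρ₃ α₃ _ ⟨ht', L₃, hS₃, hL₃, h₃⟩
      rw [if_pos h, card_insert_of_notMem (by simp)]
      refine ⟨?_, L₃, hS₃.update _ _, fun s => List.Subset.trans (hL₂ s) (hL₃ s), ?_⟩
      · simp only [Exp.cost, Exp.edge]
        rw [mul_add (5000 * W + 20), mul_one]
        omega
      · refine Nat.forall_lt_succ_right.2 ⟨fun d' hd' hd'X => (h₂ d' hd' hd'X).mono
          fun Z hZ => Found.mono hL₃ hZ, fun _ => ?_⟩
        rwa [hEd, hF.arr aTail] at h₃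
    · simp only [Exp.ev, Exp.edge, hx, hEd, h0] at h
      rw [if_neg h]
      refine Run.of_wp ⟨?_, L₂, hS₂.update _ _, hL₂, Nat.forall_lt_succ_right.2
        ⟨h₂, fun h' => absurd h' h⟩⟩
      simp only [Exp.cost, Exp.edge]
      omega
  · rintro t ρ' α' _ _ ⟨ht, L', hS', hL', h'⟩
    have hD := hE₁.darts.le
    have hc := Nat.mul_le_mul_left (5000 * W + 20) (hE₁.darts.card_filter_le X)
    simp only [Exp.cost]
    refine ⟨by omega, L', hS', hL', fun e he x y hxy => ?_⟩
    obtain ⟨d, hd, rfl, rfl, -⟩ := hE₁.darts.complete e x y hxy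
    exact h' d hd he
  · rintro t ρ' α' _ ⟨ht, h'⟩
    refine Run.nil ⟨?_, h'⟩
    have hc := card_le_card (GraphInput.cov_subset_range (G := G) (X := X))
    rw [hT.card, card_range] at hc
    have h1 : (5000 * W + 20) * (2 * #X) ≤ (5000 * W + 20) * (2 * G.n) :=
      Nat.mul_le_mul_left _ (by omega)
    have h2 : (5000 * W + 20) * (2 * G.n) = 10000 * (G.n * W) + 40 * G.n := by ring
    have h3 : G.m ^ 2 ≤ W := Nat.le_mul_of_pos_right _ hG.one_le_maxDeg
    have h4 : 2 * G.m ≤ G.m ^ 2 := by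
      rw [pow_two]
      exact Nat.mul_le_mul_right _ hm
    have h5 : W ≤ G.n * W := Nat.le_mul_of_pos_left _ hn1
    have h6 : G.n * G.m ^ 2 * G.maxDeg = G.n * W := by rw [hW, mul_assoc]
    omega

end RAM

/-! ## The enumeration algorithm -/

/-- The approximate solution from which the enumeration starts. -/
notation "aInit" => 30
/-- Number of sets that have been output. -/
notation "rCount" => 5

namespace RAM

open Finset

/-- The state of the enumeration after the sets in `P` have been output. -/
structure Sound (G : GraphInput) (b k : ℕ) (P : List (Finset ℕ)) : Prop where
  nodup : P.Nodup
  minimal : ∀ X ∈ P, G.IsMinCEDS X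
  le : P.length ≤ k
  card_le : ∀ X ∈ P, ∀ Y, G.IsMinCEDS Y → Y ∉ P → #X ≤ b + #Y

/-- Everything that could be output has been output. -/
def Complete (G : GraphInput) (k : ℕ) (P : List (Finset ℕ)) : Prop :=
  k ≤ P.length ∨ ∀ Y, G.IsMinCEDS Y → Y ∈ P

/-- A small set has been found, and the neighbours of the sets in `P` have been found. -/
structure Frontier (G : GraphInput) (b : ℕ) (P : List (Finset ℕ)) (D : Set (Finset ℕ)) : Prop where
  seed : ∃ X ∈ D, #(G.cov X) ≤ b
  explored : ∀ X ∈ P, ∀ e ∈ X, ∀ x y, G.Joins e x y → G.Explored D X e x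

/-- The state before the output of the set `X`. -/
structure Pending (G : GraphInput) (b k : ℕ) (P : List (Finset ℕ)) (X : Finset ℕ)
    (L : ℕ → List (Finset ℕ)) (ρ : Regs) (α : Arrs) : Prop where
  sound : Sound G b k (P ++ [X])
  env : Env G ρ α
  store : Store G (P ++ [X]) L ρ α
  path : IsPath (α aChild) X G.m (ρ rTop)
  frontier : Frontier G b P {Z | Found (P ++ [X]) L Z}
  count : ρ rCount = P.length

/-- The state before the next output after the sets in `P`. -/
def Ready (G : GraphInput) (b k : ℕ) (P : List (Finset ℕ)) (ρ : Regs) (α : Arrs) : Prop :=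
  (ρ rTop = 0 ∧ Sound G b k P ∧ Complete G k P) ∨ (ρ rTop ≠ 0 ∧ ∃ X L, Pending G b k P X L ρ α)

/-- Select the next set to be output. -/
def next : Cmd := .ite (.sub .param (.reg rCount)) dequeue (.assign rTop (.const 0))

/-- Find an edge of the set in `aSearch` and assign one of its endpoints to register `10`. -/
def findRoot : Cmd := loop 27 (.const 0) (.reg rM)
  (.ite (.arr aSearch (.reg 27)) (.assign 10 (.src 27)) .skip)

/-- Preparation of the enumeration. -/
def prepare : Cmd := block [.assign rNodes (.const 1), buildDarts, copy aInit aSearch 25, findRoot,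
  search, copy aSpan aSet 25, insertSet, next]

/-- What happens after an output. -/
def advance : Cmd := block [.assign rCount (.add (.reg rCount) (.const 1)), explore, next]

variable {G : GraphInput} {I : Input} {ρ ρ' : Regs} {α α' : Arrs} {X Y : Finset ℕ}
  {P : List (Finset ℕ)} {L L' : ℕ → List (Finset ℕ)} {b k : ℕ}

theorem Store.dom (h : Store G P L ρ α) (hX : Found P L X) : G.Dom X := (h.minimal X hX).1.dom

theorem Frontier.exists_le (h : Frontier G b P {Z | Found P L Z}) (hS : Store G P L ρ α)
    (hY : G.IsMinCEDS Y) (hYP : Y ∉ P) (hY1 : Y.Nonempty) : ∃ s, ∃ X ∈ L s, #X ≤ b + #Y := by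
  obtain ⟨X₁, hX₁, hb⟩ := h.seed
  obtain ⟨X, hX, hXP, hc⟩ := GraphInput.exists_frontier (P := {X | X ∈ P})
    (fun X hX => ⟨hS.tree X hX, hS.dom hX⟩) hX₁ h.explored hY hYP
  obtain hX' | ⟨s, hs⟩ := hX
  · exact absurd hX' hXP
  refine ⟨s, X, hs, ?_⟩
  have h1 := (card_le_card hc).trans (card_union_le _ _)
  rw [(hS.tree X (.inr ⟨s, hs⟩)).card] at h1
  have h2 := GraphInput.card_cov_le hY.1.sub hY1 hY.1.conn
  omega

theorem next_run (hG : G.Admissible) (hk : I.param = k) (hE : Env G ρ α) (hS : Store G P L ρ α)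
    (hP : Sound G b k P) (hF : Frontier G b P {Z | Found P L Z}) (hc : ρ rCount = P.length) :
    Run I next ρ α fun t ρ' α' => t ≤ 40 * G.m + 70 ∧ Ready G b k P ρ' α' := by
  have hne : ∀ Y, G.IsMinCEDS Y → Y.Nonempty := fun Y hY =>
    card_pos.1 (by have := hG.two_le hY.1; omega)
  refine Run.ite (fun h => ?_) fun h => Run.of_wp ?_
  · simp only [Exp.ev, hk, hc] at h
    refine (dequeue_run hE hS).imp ?_
    rintro t ρ' α' hF' ⟨ht, ⟨h1, h2, h3⟩ | ⟨h1, X, L', h2⟩⟩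
    · refine ⟨by simp only [Exp.cost]; omega, .inl ⟨h1, hP, .inr fun Y hY => ?_⟩⟩
      by_contra hYP
      obtain ⟨s, X, hX, -⟩ := hF.exists_le hS hY hYP (hne Y hY)
      simp [h3] at hX
    · have hset : {Z | Found (P ++ [X]) L' Z} = {Z | Found P L Z} := Set.ext h2.found
      refine ⟨by simp only [Exp.cost]; omega, .inr ⟨h1, X, L', ⟨h2.store.nodup_processed,
        fun Z hZ => h2.store.minimal Z (.inl hZ), by simp; omega, fun Z hZ Y hY hYP => ?_⟩,
        hE.of_frame hF', h2.store, h2.path, hset ▸ hF, (hF'.reg _).trans hc⟩⟩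
      simp only [List.mem_append, List.mem_singleton, not_or] at hZ hYP
      obtain hZ | rfl := hZ
      · exact hP.card_le Z hZ Y hY hYP.1
      · obtain ⟨s, X, hX, hXY⟩ := hF.exists_le hS hY hYP.1 (hne Y hY)
        exact (h2.le s X hX).trans hXY
  · simp only [Exp.ev, hk, hc] at h
    simp only [wp, Exp.cost, Ready, Exp.ev, Function.update_self, true_and]
    exact ⟨by omega, .inl ⟨hP, .inl (by omega)⟩⟩

theorem advance_run (hG : G.Admissible) (hk : I.param = k) (h : Pending G b k P X L ρ α)
    (hX : supp G.m (α aCur) = X) :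
    Run I advance ρ α fun t ρ' α' => t ≤ 12000 * (G.n * G.m ^ 2 * G.maxDeg) ∧
      Ready G b k (P ++ [X]) ρ' α' := by
  have hf : Found (P ++ [X]) L X := .inl (by simp)
  refine Run.cons (Q₁ := fun t ρ' α' => t = 4 ∧ ρ' rCount = (P ++ [X]).length ∧ α' = α)
    (Run.of_wp ?_) ?_
  · simp [wp, Exp.ev, Exp.cost, h.count]
  rintro _ ρ₁ α hF₁ ⟨rfl, h₁, rfl⟩
  refine Run.cons (explore_run hG (h.env.of_frame hF₁) (h.store.of_frame hF₁) (h.store.tree X hf)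
    (h.store.dom hf) hX) ?_
  rintro t₂ ρ₂ α₂ hF₂ ⟨ht₂, L₂, h₂, hL, h₃⟩
  have hmono : {Z | Found (P ++ [X]) L Z} ⊆ {Z | Found (P ++ [X]) L₂ Z} := fun Z => Found.mono hL
  refine Run.cons (next_run hG hk ((h.env.of_frame hF₁).of_frame hF₂) h₂ h.sound ⟨?_, ?_⟩
    ((hF₂.reg _).trans h₁)) ?_
  · obtain ⟨Z, hZ, hb⟩ := h.frontier.seed
    exact ⟨Z, hmono hZ, hb⟩
  · intro Z hZ e he x y hxy
    obtain hZ | hZ := List.mem_append.1 hZ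
    · exact (h.frontier.explored Z hZ e he x y hxy).mono hmono
    · obtain rfl := List.mem_singleton.1 hZ
      exact h₃ e he x y hxy
  · rintro t₃ ρ₃ α₃ - ⟨ht₃, h₄⟩
    refine Run.nil ⟨?_, h₄⟩
    have h1 := hG.two_le_m
    have h2 := hG.mul_le
    omega

end RAM

namespace RAM

open Finset

variable {G : GraphInput} {I : Input} {ρ ρ' : Regs} {α α' : Arrs} {X Y : Finset ℕ}
  {P : List (Finset ℕ)} {L L' : ℕ → List (Finset ℕ)} {b k : ℕ}

theorem findRoot_run (hI : I.word = G.word) (hE : Env G ρ α) (hX : supp G.m (α aSearch) = X)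
    (hne : X.Nonempty) :
    Run I findRoot ρ α fun t ρ' _ => t ≤ 30 * G.m + 10 ∧ ρ' 10 ∈ G.cov X := by
  refine Run.loop_uniform 20 (L := 0) (B := G.m) (fun i ρ' α' => (∃ j < i, j ∈ X) → ρ' 10 ∈ G.cov X)
    rfl (Nat.zero_le _) (by simp) rfl (fun i ρ' α' hF _ _ _ => (hF.reg rM).trans hE.m_eq) ?_ ?_
  · intro i ρ₁ α₁ _ hi hx hF h
    have h0 := eq_zero_iff_notMem_supp (f := α₁ aSearch) hi
    rw [hF.arr aSearch, hX] at h0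
    refine Run.of_wp ?_
    have hw : I.word (i + i + 2) = G.src ⟨i, hi⟩ := by rw [hI, GraphInput.word_src hi]
    simp only [wp, Exp.ev, Exp.src, Exp.cost, hx, hF.arr aSearch, ne_eq, h0, not_not,
      Function.update_self, Nat.reduceEqDiff, not_false_eq_true, Function.update_of_ne, hw]
    refine ⟨fun h' => ⟨by norm_num, fun _ => ?_⟩, fun h' => ⟨by norm_num, ?_⟩⟩
    · exact GraphInput.Joins.mem_cov ⟨hi, .inl ⟨rfl, rfl⟩⟩ h'
    · rintro ⟨j, hj, hjX⟩
      refine h ⟨j, ?_, hjX⟩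
      have : j ≠ i := by
        rintro rfl
        exact h' hjX
      omega
  · intro t ρ' α' _ _ h ht
    simp only [Exp.cost] at ht
    obtain ⟨j, hj⟩ := hne
    exact ⟨by omega, h ⟨j, by rw [← hX, mem_supp] at hj; exact hj.1, hj⟩⟩

theorem SearchInv.isTree {S R T : Finset ℕ} {r : ℕ} (h : SearchInv G S r R T) (hc : Closed G S R)
    (hS : G.Conn S) (hr : r ∈ G.cov S) : G.IsTree T ∧ G.cov S ⊆ G.cov T := by
  have hR : ∀ v ∈ G.cov S, v ∈ R := fun v hv => (h.mem_iff hc v).2 (hS r hr v hv)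
  obtain ⟨rfl, rfl⟩ | ⟨h1, rfl⟩ := h.tree
  · obtain ⟨i, hi, w, hw⟩ := GraphInput.mem_cov.1 hr
    exact absurd (mem_singleton.1 (hR w (hw.symm.mem_cov hi))).symm hw.ne
  · exact ⟨h1, hR⟩

theorem prepare_run (hG : G.Admissible) (hI : I.word = G.word) (hk : I.param = k)
    (hρ : ∀ x < 30, ρ x = 0) (hα : ∀ a < 30, α a = 0) (hX : supp G.m (α aInit) = X)
    (hC : G.IsCEDS X) (hb : #X + 1 ≤ b) :
    Run I prepare ρ α fun t ρ' α' => t ≤ 12000 * (G.n * G.m ^ 2 * G.maxDeg) ∧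
      Ready G b k [] ρ' α' := by
  have hne : X.Nonempty := card_pos.1 (by have := hG.two_le hC; omega)
  refine Run.cons (Q₁ := fun t ρ' α' => t = 2 ∧ ρ' rNodes = 1 ∧ α' = α) (Run.of_wp ?_) ?_
  · simp [wp, Exp.ev, Exp.cost]
  rintro _ ρ₁ α hF₁ ⟨rfl, h₁, rfl⟩
  refine Run.cons (buildDarts_run hI ((hF₁.reg rD).trans (hρ _ (by decide)))
    (by rw [hα _ (by decide)]; rfl)) ?_
  rintro t₂ ρ₂ α₂ hF₂ ⟨ht₂, hE₂⟩
  have hS₂ : Store G [] (fun _ => []) ρ₂ α₂ := Store.empty ((hF₂.reg _).trans h₁)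
    ((hF₂.arr _).trans (hα _ (by decide))) ((hF₂.arr _).trans (hα _ (by decide)))
    ((hF₂.arr _).trans (hα _ (by decide)))
  have hc₂ : ρ₂ rCount = 0 := by rw [hF₂.reg rCount, hF₁.reg rCount, hρ _ (by decide)]
  rw [← hF₂.arr aInit] at hX
  clear hF₁ hF₂ h₁ hρ hα
  refine Run.cons (copy_run hE₂ (by decide) (by decide)) ?_
  rintro t₃ ρ₃ α₃ hF₃ ⟨ht₃, h₃⟩
  rw [hX] at h₃
  have hE₃ := hE₂.of_frame hF₃
  refine Run.cons (findRoot_run hI hE₃ h₃ hne) ?_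
  rintro t₄ ρ₄ α₄ hF₄ ⟨ht₄, h₄⟩
  have hE₄ := hE₃.of_frame hF₄
  rw [← hF₄.arr aSearch] at h₃
  refine Run.cons (search_run hE₄ rfl (mem_range.1 (GraphInput.cov_subset_range h₄)) h₃) ?_
  rintro t₅ ρ₅ α₅ hF₅ ⟨ht₅, h₅, h₅'⟩
  have hE₅ := hE₄.of_frame hF₅
  have hT := h₅'.isTree h₅ hC.conn h₄
  refine Run.cons (copy_run hE₅ (by decide) (by decide)) ?_
  rintro t₆ ρ₆ α₆ hF₆ ⟨ht₆, h₆⟩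
  have hE₆ := hE₅.of_frame hF₆
  have hS₆ := (((hS₂.of_frame hF₃).of_frame hF₄).of_frame hF₅).of_frame hF₆
  refine Run.cons (insertSet_run hG hE₆ hS₆ h₆ hT.1 (hC.dom.mono hT.2)) ?_
  rintro t₇ ρ₇ α₇ hF₇ ⟨ht₇, L, hS₇, -, Z, hZ, hZL⟩
  refine Run.cons (next_run hG hk (b := b) (hE₆.of_frame hF₇) hS₇ ⟨by simp, by simp, by simp, by simp⟩
    ⟨⟨Z, hZL, ?_⟩, by simp⟩ ?_) ?_
  · refine le_trans (card_le_card (GraphInput.cov_mono (hZ.trans h₅'.sub))) ?_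
    exact (GraphInput.card_cov_le hC.sub hne hC.conn).trans hb
  · rw [hF₇.reg rCount, hF₆.reg rCount, hF₅.reg rCount, hF₄.reg rCount, hF₃.reg rCount, hc₂]
    rfl
  · rintro t₈ ρ₈ α₈ - ⟨ht₈, h₈⟩
    refine Run.nil ⟨?_, h₈⟩
    have h1 := hG.two_le_m
    have h2 := hG.mul_le
    have h3 := hG.n_le
    have h4 : 200 * (G.n + 1) * (G.m + 1) ≤ 200 * (2 * G.m) * (2 * G.m) :=
      Nat.mul_le_mul (by omega) (by omega)
    have h5 : 200 * (2 * G.m) * (2 * G.m) = 800 * G.m ^ 2 := by ring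
    have h6 := hG.sq_le
    omega

/-- Print the edge numbers of the current set. -/
def printCur : Cmd := loop 26 (.const 0) (.reg rM)
  (.ite (.arr aCur (.reg 26)) (.print (.reg 26)) .skip)

/-- Print a set of edges. -/
def listing (m : ℕ) (X : Finset ℕ) : List ℕ := (List.range m).filter fun i => i ∈ X

theorem mem_listing {m i : ℕ} (hX : X ⊆ range m) : i ∈ listing m X ↔ i ∈ X := by
  simpa [listing] using fun hi => mem_range.1 (hX hi)

theorem nodup_listing {m : ℕ} : (listing m X).Nodup := List.nodup_range.filter _

theorem printCur_exec (hE : Env G ρ α) (hX : supp G.m (α aCur) = X) :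
    ∃ t ρ', t ≤ 20 * G.m + 10 ∧ Frame printCur ρ α ρ' α ∧ ∀ τ o,
      Exec I printCur ⟨ρ, α, τ, [], o⟩ ⟨ρ', α, τ + t, listing G.m X, o⟩ := by
  have key : ∀ j i, i + j = G.m → ∃ t, t ≤ 20 * j + 4 ∧ ∀ τ o,
      Exec I (.while (.sub (.reg rM) (.reg 26)) (.seq
        (.ite (.arr aCur (.reg 26)) (.print (.reg 26)) .skip)
        (.assign 26 (.add (.reg 26) (.const 1)))))
        ⟨Function.update ρ 26 i, α, τ, listing i X, o⟩
        ⟨Function.update ρ 26 G.m, α, τ + t, listing G.m X, o⟩ := by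
    intro j
    induction j with
    | zero =>
      intro i hi
      obtain rfl : i = G.m := by omega
      refine ⟨4, by omega, fun τ o => ?_⟩
      exact Exec.while_false (s := ⟨Function.update ρ 26 G.m, α, τ, listing G.m X, o⟩)
        (by simp [Exp.eval, hE.m_eq])
    | succ j ih =>
      intro i hi
      obtain ⟨t, ht, h⟩ := ih (i + 1) (by omega)
      have h0 := eq_zero_iff_notMem_supp (f := α aCur) (show i < G.m by omega)
      rw [hX] at h0
      have hl : listing (i + 1) X = if i ∈ X then listing i X ++ [i] else listing i X := by
        rw [listing, List.range_succ, List.filter_append]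
        split_ifs with h' <;> simp [listing, h']
      have hu : ∀ (v w : ℕ), Function.update (Function.update ρ 26 v) 26 w = Function.update ρ 26 w :=
        fun v w => Function.update_idem _ _ _
      by_cases hiX : i ∈ X
      · rw [if_pos hiX] at hl
        rw [hl] at h
        refine ⟨4 + (3 + (2 + 4)) + t, by omega, fun τ o => ?_⟩
        refine .while_true (by simp [Exp.eval, hE.m_eq]; omega) (.seq (.ite_true
          (by simpa [Exp.eval, State.tick, h0] using hiX) (.print _ _)) (.assign _ _ _)) ?_
        have := h (τ + (4 + (3 + (2 + 4)))) o
        simpa [Exp.eval, State.tick, Exp.cost, add_assoc, hu] using this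
      · rw [if_neg hiX] at hl
        rw [hl] at h
        refine ⟨4 + (3 + (1 + 4)) + t, by omega, fun τ o => ?_⟩
        refine .while_true (by simp [Exp.eval, hE.m_eq]; omega) (.seq (.ite_false
          (by simpa [Exp.eval, State.tick, h0] using hiX) (.skip _)) (.assign _ _ _)) ?_
        have := h (τ + (4 + (3 + (1 + 4)))) o
        simpa [Exp.eval, State.tick, Exp.cost, add_assoc, hu] using this
  obtain ⟨t, ht, h⟩ := key G.m 0 (by omega)
  refine ⟨2 + t, Function.update ρ 26 G.m, by omega, ⟨fun x hx => ?_, fun _ _ => rfl⟩,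
    fun τ o => .seq (.assign _ _ _) ?_⟩
  · refine Function.update_of_ne ?_ _ _
    rintro rfl
    simp [printCur, loop, Cmd.wr] at hx
  · simpa [Exp.eval, State.tick, Exp.cost, add_assoc, listing] using h (τ + 2) o

/-- The main loop. -/
def mainLoop : Cmd := .while (.reg rTop) (.seq unpack (.seq printCur (.seq .emit advance)))

theorem mainLoop_exec (hG : G.Admissible) (hk : I.param = k) (h : Ready G b k P ρ α) (τ : ℕ)
    (o : List (ℕ × List ℕ)) :
    ∃ s, ∃ N : List (ℕ × Finset ℕ), Exec I mainLoop ⟨ρ, α, τ, [], o⟩ s ∧ s.line = [] ∧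
      s.out = o ++ N.map (fun p => (p.1, listing G.m p.2)) ∧
      Sound G b k (P ++ N.map Prod.snd) ∧ Complete G k (P ++ N.map Prod.snd) ∧
      ∀ p, τ ≤ p + 12000 * (G.n * G.m ^ 2 * G.maxDeg) →
        List.IsChain (fun t t' => t' ≤ t + 13000 * (G.n * G.m ^ 2 * G.maxDeg))
          (p :: (N.map Prod.fst ++ [s.time])) := by
  have hm := hG.two_le_m
  have hW := hG.mul_le
  induction hj : k - P.length generalizing P ρ α τ o with
  | zero =>
    obtain ⟨h1, h2, h3⟩ | ⟨h1, X, L, h2⟩ := h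
    · refine ⟨_, [], .while_false (by simpa [Exp.eval] using h1), rfl, by simp [State.tick],
        by simpa, by simpa, fun p hp => ?_⟩
      simp only [State.tick, Exp.cost, List.map_nil, List.nil_append, List.isChain_cons_cons,
        List.isChain_singleton, and_true]
      omega
    · have := h2.sound.le
      simp at this
      omega
  | succ j ih =>
    obtain ⟨h1, h2, h3⟩ | ⟨h1, X, L, h2⟩ := h
    · refine ⟨_, [], .while_false (by simpa [Exp.eval] using h1), rfl, by simp [State.tick],
        by simpa, by simpa, fun p hp => ?_⟩
      simp only [State.tick, Exp.cost, List.map_nil, List.nil_append, List.isChain_cons_cons,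
        List.isChain_singleton, and_true]
      omega
    · have hf : Found (P ++ [X]) L X := .inl (by simp)
      obtain ⟨t₁, ρ₁, α₁, ⟨⟨ht₁, hX₁⟩, hF₁⟩, hx₁⟩ :=
        (unpack_run h2.env (h2.store.tree X hf).sub h2.store.trie h2.path (I := I)).frame
      have hE₁ := h2.env.of_frame hF₁
      obtain ⟨t₂, ρ₂, ht₂, hF₂, hx₂⟩ := printCur_exec hE₁ hX₁ (I := I)
      have h2' : Pending G b k P X L ρ₂ α₁ := ⟨h2.sound, hE₁.of_frame hF₂,
        (h2.store.of_frame hF₁).of_frame hF₂, by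
          rw [hF₂.reg rTop, hF₁.reg rTop, hF₁.arr aChild]; exact h2.path, h2.frontier,
        by rw [hF₂.reg rCount, hF₁.reg rCount, h2.count]⟩
      obtain ⟨t₃, ρ₃, α₃, ⟨ht₃, h₃⟩, hx₃⟩ := advance_run hG hk h2' hX₁
      set τ' := τ + 2 + t₁ + t₂ + 1 with hτ'
      obtain ⟨s, N, hs₁, hs₂, hs₃, hs₄, hs₅, hs₆⟩ := ih h₃ (τ' + t₃)
        (o ++ [(τ', listing G.m X)]) (by simp; omega)
      refine ⟨s, (τ', X) :: N, .while_true (by simpa [Exp.eval] using h1)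
        (.seq (hx₁ (τ + 2) [] o) (.seq (hx₂ _ _) (.seq (.emit _) (hx₃ _ _ _)))) hs₁, hs₂,
        by simp [hs₃], by simpa using hs₄, by simpa using hs₅, fun p hp => ?_⟩
      rw [List.map_cons, List.cons_append, List.isChain_cons_cons]
      exact ⟨by dsimp only; omega, hs₆ τ' (by omega)⟩

end RAM

/-! ### Subroutines -/

namespace RAM

open Finset

def Exp.shift : Exp → Exp
  | .const c => .const c
  | .reg x => .reg (x + 30)
  | .arr a e => .arr (a + 30) e.shift
  | .inp e => .inp e.shift
  | .param => .const 0
  | .add e₁ e₂ => .add e₁.shift e₂.shift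
  | .sub e₁ e₂ => .sub e₁.shift e₂.shift

/-- The program `c` as a subroutine, with renamed registers and arrays, with parameter `0` and
without output. -/
def Cmd.shift : Cmd → Cmd
  | .skip => .skip
  | .assign x e => .assign (x + 30) e.shift
  | .store a e₁ e₂ => .store (a + 30) e₁.shift e₂.shift
  | .print _ => .skip
  | .emit => .skip
  | .seq c₁ c₂ => .seq c₁.shift c₂.shift
  | .ite e c₁ c₂ => .ite e.shift c₁.shift c₂.shift
  | .while e c => .while e.shift c.shift

theorem Exp.cost_shift (e : Exp) : e.shift.cost = e.cost := by
  induction e <;> simp_all [shift, cost]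

theorem Exp.ev_shift {w : ℕ → ℕ} {k : ℕ} {ρ : Regs} {α : Arrs} {s : State}
    (hρ : ∀ x, ρ (x + 30) = s.reg x) (hα : ∀ a, α (a + 30) = s.arr a) (e : Exp) :
    e.shift.ev ⟨w, k⟩ ρ α = e.eval ⟨w, 0⟩ s := by
  induction e <;> simp_all [shift, ev, eval]

theorem Run.while {I : Input} {e : Exp} {c : Cmd} {ρ : Regs} {α : Arrs}
    {Q Q₁ : ℕ → Regs → Arrs → Prop} (he : e.ev I ρ α ≠ 0) (h₁ : Run I c ρ α Q₁)
    (h₂ : ∀ t ρ' α', Q₁ t ρ' α' →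
      Run I (.while e c) ρ' α' fun t' => Q (e.cost + 1 + t + t')) : Run I (.while e c) ρ α Q := by
  obtain ⟨t, ρ', α', hq, hE⟩ := h₁
  obtain ⟨t', ρ'', α'', hq', hE'⟩ := h₂ _ _ _ hq
  refine ⟨_, _, _, hq', fun τ l o => .while_true (by simpa [Exp.eval_eq_ev] using he)
    (hE (τ + (e.cost + 1)) l o) ?_⟩
  simpa [add_assoc] using hE' (τ + (e.cost + 1) + t) l o

theorem Run.while_false {I : Input} {e : Exp} {c : Cmd} {ρ : Regs} {α : Arrs}
    {Q : ℕ → Regs → Arrs → Prop} (he : e.ev I ρ α = 0) (h : Q (e.cost + 1) ρ α) :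
    Run I (.while e c) ρ α Q :=
  ⟨_, _, _, h, fun _ _ _ => .while_false (by simpa [Exp.eval_eq_ev] using he)⟩

theorem Exec.shift_run {w : ℕ → ℕ} {c : Cmd} {s s' : State} (h : Exec ⟨w, 0⟩ c s s') (k : ℕ)
    {ρ : Regs} {α : Arrs} (hρ : ∀ x, ρ (x + 30) = s.reg x) (hα : ∀ a, α (a + 30) = s.arr a) :
    Run ⟨w, k⟩ c.shift ρ α fun t ρ' α' => s.time + t ≤ s'.time ∧
      (∀ x, ρ' (x + 30) = s'.reg x) ∧ (∀ a, α' (a + 30) = s'.arr a) ∧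
      (∀ x < 30, ρ' x = ρ x) ∧ ∀ a < 30, α' a = α a := by
  induction h generalizing ρ α with
  | skip s => exact Run.of_wp ⟨le_rfl, hρ, hα, fun _ _ => rfl, fun _ _ => rfl⟩
  | assign s x e =>
    refine Run.of_wp ⟨?_, fun y => ?_, hα, fun y hy => ?_, fun _ _ => rfl⟩
    · simp [State.tick, Exp.cost_shift]
    · rw [Exp.ev_shift hρ hα]
      simp [Function.update_apply, hρ]
    · exact Function.update_of_ne (by omega) _ _
  | store s a e₁ e₂ =>
    refine Run.of_wp ⟨?_, hρ, fun y => ?_, fun _ _ => rfl, fun y hy => ?_⟩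
    · simp [State.tick, Exp.cost_shift]
    · rw [Exp.ev_shift hρ hα, Exp.ev_shift hρ hα]
      simp [Function.update_apply, hα]
    · exact Function.update_of_ne (by omega) _ _
  | print s e =>
    exact Run.of_wp ⟨by simp [State.tick], hρ, hα, fun _ _ => rfl, fun _ _ => rfl⟩
  | emit s => exact Run.of_wp ⟨le_rfl, hρ, hα, fun _ _ => rfl, fun _ _ => rfl⟩
  | seq _ _ ih₁ ih₂ =>
    refine (ih₁ hρ hα).seq fun t ρ₁ α₁ _ ⟨h1, h2, h3, h4, h5⟩ => (ih₂ h2 h3).imp ?_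
    rintro t' ρ₂ α₂ - ⟨h1', h2', h3', h4', h5'⟩
    exact ⟨by omega, h2', h3', fun x hx => (h4' x hx).trans (h4 x hx),
      fun a ha => (h5' a ha).trans (h5 a ha)⟩
  | ite_true he _ ih =>
    refine Run.ite (fun _ => (ih hρ hα).imp ?_) fun h => absurd ((Exp.ev_shift hρ hα _).symm.trans h) he
    rintro t ρ₁ α₁ _ ⟨h1, h2⟩
    simp only [State.tick] at h1
    exact ⟨by rw [Exp.cost_shift]; omega, h2⟩
  | ite_false he _ ih =>
    refine Run.ite (fun h => absurd ((Exp.ev_shift hρ hα _).trans he) h) fun _ => (ih hρ hα).imp ?_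
    rintro t ρ₁ α₁ _ ⟨h1, h2⟩
    simp only [State.tick] at h1
    exact ⟨by rw [Exp.cost_shift]; omega, h2⟩
  | while_true he _ _ ih₁ ih₂ =>
    refine Run.while (by rwa [Exp.ev_shift hρ hα]) (ih₁ hρ hα)
      fun t ρ₁ α₁ ⟨h1, h2, h3, h4, h5⟩ => (ih₂ h2 h3).imp ?_
    rintro t' ρ₂ α₂ - ⟨h1', h2', h3', h4', h5'⟩
    simp only [State.tick] at h1
    exact ⟨by rw [Exp.cost_shift]; omega, h2', h3', fun x hx => (h4' x hx).trans (h4 x hx),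
      fun a ha => (h5' a ha).trans (h5 a ha)⟩
  | while_false he =>
    exact Run.while_false (by rwa [Exp.ev_shift hρ hα])
      ⟨by simp [State.tick, Exp.cost_shift], hρ, hα, fun _ _ => rfl, fun _ _ => rfl⟩

/-- Enumerate solutions, starting from the result of `A`. -/
def enumerate (A : Cmd) : Cmd := .seq A.shift (.seq prepare mainLoop)

theorem enumerate_exec {G : GraphInput} (hG : G.Admissible) {A : Cmd} {s₀ : State} {T b : ℕ}
    (hA : Exec ⟨G.word, 0⟩ A State.init s₀) (hT : s₀.time ≤ T)
    (hC : G.IsCEDS (supp G.m (s₀.arr 0))) (hb : #(supp G.m (s₀.arr 0)) + 1 ≤ b) (k : ℕ) :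
    ∃ s, ∃ N : List (ℕ × Finset ℕ), Exec ⟨G.word, k⟩ (enumerate A) State.init s ∧ s.line = [] ∧
      s.out = N.map (fun p => (p.1, listing G.m p.2)) ∧
      Sound G b k (N.map Prod.snd) ∧ Complete G k (N.map Prod.snd) ∧
      HasDelay s T (13000 * (G.n * G.m ^ 2 * G.maxDeg)) := by
  obtain ⟨t₁, ρ₁, α₁, ⟨h1, -, h3, h4, h5⟩, hx₁⟩ := hA.shift_run k (ρ := fun _ => 0)
    (α := fun _ _ => 0) (fun _ => rfl) (fun _ => rfl)
  obtain ⟨t₂, ρ₂, α₂, ⟨ht₂, h₂⟩, hx₂⟩ := prepare_run (I := ⟨G.word, k⟩) hG rfl rfl h4 h5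
    (by rw [h3 0]) hC hb
  obtain ⟨s, N, hs₁, hs₂, hs₃, hs₄, hs₅, hs₆⟩ := mainLoop_exec hG rfl h₂ (0 + t₁ + t₂) []
  refine ⟨s, N, .seq (hx₁ 0 [] []) (.seq (hx₂ _ _ _) hs₁), hs₂, by simpa using hs₃,
    by simpa using hs₄, by simpa using hs₅, ?_⟩
  rw [HasDelay, hs₃]
  simp only [State.init] at h1
  simpa [Function.comp_def] using hs₆ T (by omega)

theorem isKBestEnumeration_enumerate {A : Cmd} {r : ℝ} {f : ℕ → ℕ → ℕ}
    (hA : ∀ G : GraphInput, G.Admissible → ∃ s, Exec ⟨G.word, 0⟩ A State.init s ∧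
      s.time ≤ f G.n G.m ∧ G.IsCEDS (supp G.m (s.arr 0)) ∧
      ∀ Y, G.IsCEDS Y → (#(supp G.m (s.arr 0)) : ℝ) + 1 ≤ (r - 1) * #Y) :
    IsKBestEnumeration (enumerate A) r f 13000 := by
  intro G hG k
  obtain ⟨s₀, hs₀, ht, hC, hr⟩ := hA G hG
  obtain ⟨s, N, h1, h2, h3, h4, h5, h6⟩ := enumerate_exec hG hs₀ ht hC le_rfl k
  have hsub : ∀ X ∈ N.map Prod.snd, X ⊆ range G.m := fun X hX => (h4.minimal X hX).1.sub
  have hout : outputs G s = (N.map Prod.snd).map fun X : Finset ℕ => G.edgesAt X := by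
    rw [outputs, h3, List.map_map, List.map_map]
    refine List.map_congr_left fun p hp => congrArg G.edgesAt (Set.ext fun i => ?_)
    exact mem_listing (hsub _ (List.mem_map_of_mem hp))
  have hmem : ∀ X, G.IsMinCEDS X → (G.edgesAt X ∈ outputs G s ↔ X ∈ N.map Prod.snd) := by
    intro X hX
    rw [hout, List.mem_map]
    refine ⟨?_, fun h => ⟨X, h, rfl⟩⟩
    rintro ⟨Y, hY, h⟩
    rwa [← GraphInput.edgesAt_injOn (hsub Y hY) hX.1.sub h]
  have hsol : ∀ S ∈ outputs G s, S ∈ G.solutions := by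
    rw [hout]
    intro S hS
    obtain ⟨X, hX, rfl⟩ := List.mem_map.1 hS
    exact (GraphInput.edgesAt_mem_solutions (hsub X hX)).2 (h4.minimal X hX)
  have hnd : (outputs G s).Nodup := by
    rw [hout]
    exact h4.nodup.map_on fun X hX Y hY h => GraphInput.edgesAt_injOn (hsub X hX) (hsub Y hY) h
  have hcard : ((outputs G s).toFinset : Set (Finset (Sym2 (Fin G.n)))).ncard =
      (outputs G s).length := by
    rw [Set.ncard_coe_finset, List.toFinset_card_of_nodup hnd]
  have hle : (outputs G s).length ≤ k := by
    rw [hout, List.length_map]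
    exact h4.le
  refine ⟨s, h1, h2, ?_, hsol, hnd, ?_, ?_, h6⟩
  · rw [h3]
    intro p hp
    obtain ⟨q, hq, rfl⟩ := List.mem_map.1 hp
    refine ⟨nodup_listing, fun i hi => ?_⟩
    have hq' := hsub _ (List.mem_map_of_mem hq)
    exact mem_range.1 (hq' ((mem_listing hq').1 hi))
  · have hsub' : ((outputs G s).toFinset : Set (Finset (Sym2 (Fin G.n)))) ⊆ G.solutions := by
      intro S hS
      exact hsol S (by simpa using hS)
    have hle' := hcard ▸ Set.ncard_le_ncard hsub' (Set.toFinite _)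
    obtain h | h := h5
    · rw [hout, List.length_map] at hle hle' ⊢
      omega
    · have : ((outputs G s).toFinset : Set (Finset (Sym2 (Fin G.n)))) = G.solutions := by
        refine hsub'.antisymm fun S hS => ?_
        obtain ⟨X, hX, rfl⟩ := GraphInput.exists_of_mem_solutions hS
        simpa using (hmem X hX).2 (h X hX)
      rw [this] at hcard
      omega
  · intro S hS S' hS' hnot
    rw [hout] at hS
    obtain ⟨X, hX, rfl⟩ := List.mem_map.1 hS
    obtain ⟨Y, hY, rfl⟩ := GraphInput.exists_of_mem_solutions hS'
    rw [hmem Y hY] at hnot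
    rw [GraphInput.card_edgesAt (hsub X hX), GraphInput.card_edgesAt hY.1.sub]
    have hXY : (#X : ℝ) ≤ #(supp G.m (s₀.arr 0)) + 1 + #Y := by
      exact_mod_cast h4.card_le X hX Y hY hnot
    have := hr Y hY.1
    linarith

end RAM

theorem GraphInput.edgesAt_supp {G : GraphInput} (f : ℕ → ℕ) :
    G.edgesAt {i | f i ≠ 0} = G.edgesAt (RAM.supp G.m f) := by
  ext e
  simp only [edgesAt, Finset.mem_image, Finset.mem_filter, Finset.mem_univ, true_and,
    Set.mem_ofPred_eq, Finset.mem_coe, RAM.mem_supp, Fin.is_lt]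

theorem IsApproximationAlgorithm.isKBestEnumeration {c : ℝ} {f : ℕ → ℕ → ℕ} {A : RAM.Cmd}
    (hA : IsApproximationAlgorithm A c f) :
    IsKBestEnumeration (RAM.enumerate A) (c + 2) f 13000 := by
  refine RAM.isKBestEnumeration_enumerate fun G hG => ?_
  obtain ⟨s, h1, h2, h3, h4⟩ := hA G hG
  rw [GraphInput.edgesAt_supp] at h3 h4
  rw [GraphInput.isConnectedEDS_edgesAt RAM.supp_subset] at h3
  rw [GraphInput.card_edgesAt RAM.supp_subset] at h4
  refine ⟨s, h1, h2, h3, fun Y hY => ?_⟩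
  have h5 := h4 _ ((GraphInput.isConnectedEDS_edgesAt hY.sub).2 hY)
  rw [GraphInput.card_edgesAt hY.sub] at h5
  have h6 : (2 : ℝ) ≤ Y.card := by exact_mod_cast hG.two_le hY
  linarith

/-! ## Approximation -/

namespace RAM

open Finset

/-- Extend the tree by the path formed by the darts `29` and `30` if both vertices are new. -/
def extend : Cmd := .ite (.arr aMark (.tail 29)) (.ite (.arr aMark (.head 29)) .skip
  (.ite (.dist (.head 29) (.tail 30)) .skip (.ite (.arr aMark (.head 30)) .skip (block [
    .store aSet (.edge 29) (.const 1), .store aMark (.head 29) (.const 1),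
    .store aSet (.edge 30) (.const 1), .store aMark (.head 30) (.const 1)])))) .skip

/-- Grow a tree by paths of length two until it is dominating. -/
def approximate : Cmd := block [buildDarts,
  .store aSet (.const 0) (.const 1),
  .store aMark (.inp (.const 2)) (.const 1),
  .store aMark (.inp (.const 3)) (.const 1),
  loop 28 (.const 0) (.reg rN) (loop 29 (.const 0) (.reg rD) (loop 30 (.const 0) (.reg rD) extend)),
  copy aSet 0 25]

variable {G : GraphInput} {I : Input} {ρ ρ' : Regs} {α α' : Arrs} {X Y V : Finset ℕ}

/-- `X` is a tree with vertex set `V`, and each connected edge dominating set covers at least half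
of its vertices. -/
structure HalfTree (G : GraphInput) (X V : Finset ℕ) : Prop where
  tree : G.IsTree X
  cov : G.cov X = V
  half : ∀ Y, G.IsCEDS Y → #V ≤ 2 * #(V ∩ G.cov Y)

/-- The edges `i` and `j` form a path that starts in `V` and has no other vertices in `V`. -/
def Extends (G : GraphInput) (V : Finset ℕ) (i j a h w : ℕ) : Prop :=
  G.Joins i a h ∧ G.Joins j h w ∧ a ∈ V ∧ h ∉ V ∧ w ∉ V

def Inextensible (G : GraphInput) (V : Finset ℕ) : Prop := ∀ i j a h w, ¬ Extends G V i j a h w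

theorem HalfTree.extend (hX : HalfTree G X V) {i j a h w : ℕ} (he : Extends G V i j a h w) :
    HalfTree G (insert j (insert i X)) (insert w (insert h V)) := by
  obtain ⟨hi, hj, ha, hh, hw⟩ := he
  obtain ⟨ht, hc, hf⟩ := hX
  subst hc
  obtain ⟨h1, h2⟩ := ht.pendant hi ha hh
  have hw' : w ∉ insert h (G.cov X) := by simp [hw, hj.ne.symm]
  rw [← h2] at hw' ⊢
  obtain ⟨h3, h4⟩ := h1.pendant hj (h2 ▸ mem_insert_self _ _) hw'
  refine ⟨h3, h4, fun Y hY => ?_⟩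
  rw [card_insert_of_notMem hw', h2, card_insert_of_notMem hh]
  have hlt : #(G.cov X ∩ G.cov Y) < #(insert w (insert h (G.cov X)) ∩ G.cov Y) := by
    refine card_lt_card ((ssubset_iff_of_subset (inter_subset_inter_right
      ((subset_insert _ _).trans (subset_insert _ _)))).2 ?_)
    obtain h' | h' := hY.dom j h w hj
    · exact ⟨h, by simp [h'], by simp [hh]⟩
    · exact ⟨w, by simp [h'], by simp [hw]⟩
  have := hf Y hY
  omega

theorem HalfTree.singleton {i u v : ℕ} (h : G.Joins i u v) : HalfTree G {i} {u, v} := by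
  obtain ⟨h1, h2⟩ := GraphInput.isTree_singleton h
  refine ⟨h1, h2, fun Y hY => ?_⟩
  have : 0 < #({u, v} ∩ G.cov Y) := by
    rw [card_pos]
    obtain h' | h' := hY.dom i u v h
    · exact ⟨u, by simp [h']⟩
    · exact ⟨v, by simp [h']⟩
  have := card_le_two (a := u) (b := v)
  omega

theorem HalfTree.dom (hX : HalfTree G X V) (hG : G.Admissible) (h : Inextensible G V) : G.Dom X := by
  rintro i p q hi
  by_contra! hpq
  rw [hX.cov] at hpq
  obtain ⟨e, he⟩ := hX.tree.nonempty
  obtain ⟨u, v, huv⟩ := GraphInput.exists_joins (mem_range.1 (hX.tree.sub he))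
  have hu : u ∈ V := hX.cov ▸ huv.mem_cov he
  obtain ⟨j, -, a, b, hab, ha, hb⟩ := (hG.reach huv.lt_left hi.lt_left).exists_crossing
    (fun z => z ∉ V → ∀ j t, G.Joins j z t → t ∈ V) (fun h => absurd hu h)
    fun h => hpq.2 (h hpq.1 i q hi)
  push Not at hb
  obtain ⟨hbV, j', t, hj', ht⟩ := hb
  by_cases haV : a ∈ V
  · exact h j j' a b t ⟨hab, hj', haV, hbV, ht⟩
  · exact hbV (ha haV j b hab)

theorem HalfTree.card_add_one_le (hX : HalfTree G X V) (hY : G.IsCEDS Y) (h2 : 2 ≤ #Y) :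
    #X + 1 ≤ 3 * #Y := by
  have h1 := hX.half Y hY
  have h3 := card_le_card (inter_subset_right (s₁ := V) (s₂ := G.cov Y))
  have h4 := GraphInput.card_cov_le hY.sub (card_pos.1 (by omega)) hY.conn
  have h5 := hX.tree.card
  rw [hX.cov] at h5
  omega

theorem extend_run {d d' : ℕ} (hd : G.Joins (α aEdge d) (α aTail d) (α aHead d))
    (hd' : G.Joins (α aEdge d') (α aTail d') (α aHead d')) (h29 : ρ 29 = d) (h30 : ρ 30 = d')
    (hX : HalfTree G (supp G.m (α aSet)) (supp G.n (α aMark))) :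
    Run I extend ρ α fun t _ α' => t ≤ 60 ∧ HalfTree G (supp G.m (α' aSet)) (supp G.n (α' aMark)) ∧
      ((supp G.n (α' aMark) = supp G.n (α aMark) ∧ (α aHead d = α aTail d' →
          ¬ Extends G (supp G.n (α aMark)) (α aEdge d) (α aEdge d') (α aTail d) (α aHead d)
            (α aHead d'))) ∨
        (#(supp G.n (α aMark)) < #(supp G.n (α' aMark)) ∧
          ¬ Inextensible G (supp G.n (α aMark)))) := by
  have h1 := eq_zero_iff_notMem_supp (f := α aMark) hd.lt_left
  have h2 := eq_zero_iff_notMem_supp (f := α aMark) hd.lt_right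
  have h3 := eq_zero_iff_notMem_supp (f := α aMark) hd'.lt_right
  refine Run.of_wp ?_
  simp only [RAM.extend, block, wp, Exp.ev, Exp.cost, Exp.tail, Exp.head, Exp.edge, h29, h30, ne_eq,
    h1, h2, h3, not_not, Exp.ev_dist, Exp.cost_dist]
  refine ⟨fun ht => ⟨fun hh => ⟨by norm_num, hX, .inl ⟨trivial, fun _ he => he.2.2.2.1 hh⟩⟩,
    fun hh => ⟨fun hne => ⟨by norm_num, hX, .inl ⟨trivial, fun he => absurd he hne⟩⟩,
    fun heq => ⟨fun hw => ⟨by norm_num, hX, .inl ⟨trivial, fun _ he => he.2.2.2.2 hw⟩⟩,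
    fun hw => ?_⟩⟩⟩, fun ht => ⟨by norm_num, hX, .inl ⟨trivial, fun _ he => ht he.2.2.1⟩⟩⟩
  rw [← heq] at hd'
  have hE := hX.extend ⟨hd, hd', ht, hh, hw⟩
  have hlt : #(supp G.n (α aMark)) <
      #(insert (α aHead d') (insert (α aHead d) (supp G.n (α aMark)))) :=
    card_lt_card ((ssubset_iff_of_subset ((subset_insert _ _).trans (subset_insert _ _))).2
      ⟨α aHead d', mem_insert_self _ _, hw⟩)
  simp only [Function.update_self, ne_eq, Nat.reduceEqDiff, not_false_eq_true,
    Function.update_of_ne, supp_update_one hd.lt_m, supp_update_one hd'.lt_m,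
    supp_update_one hd.lt_right, supp_update_one hd'.lt_right]
  exact ⟨by norm_num, hE, .inr ⟨hlt, fun h => h _ _ _ _ _ ⟨hd, hd', ht, hh, hw⟩⟩⟩

theorem grow_run (hE : Env G ρ α) {X V : Finset ℕ} (hX : HalfTree G X V)
    (h₁ : supp G.m (α aSet) = X) (h₂ : supp G.n (α aMark) = V) {c : ℕ}
    (hV : Inextensible G V ∨ c < #V) :
    Run I (loop 29 (.const 0) (.reg rD) (loop 30 (.const 0) (.reg rD) extend)) ρ α fun t _ α' =>
      t ≤ 400 * (G.m + 1) ^ 2 ∧ HalfTree G (supp G.m (α' aSet)) (supp G.n (α' aMark)) ∧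
        (Inextensible G (supp G.n (α' aMark)) ∨ c + 1 < #(supp G.n (α' aMark))) := by
  subst h₁ h₂
  have hD := hE.darts.le
  refine Run.loop_uniform (2 * G.m * 70 + 10) (L := 0) (B := ρ rD) (fun d _ α' =>
    HalfTree G (supp G.m (α' aSet)) (supp G.n (α' aMark)) ∧
      ((supp G.n (α' aMark) = supp G.n (α aMark) ∧ ∀ d₁ < d, ∀ d₂ < ρ rD,
        α aHead d₁ = α aTail d₂ → ¬ Extends G (supp G.n (α aMark)) (α aEdge d₁) (α aEdge d₂)
          (α aTail d₁) (α aHead d₁) (α aHead d₂)) ∨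
        (#(supp G.n (α aMark)) < #(supp G.n (α' aMark)) ∧
          ¬ Inextensible G (supp G.n (α aMark)))))
    rfl (Nat.zero_le _) ⟨hX, .inl ⟨rfl, by simp⟩⟩ rfl (fun i ρ' α' hF _ _ _ => hF.reg rD) ?_ ?_
  · rintro d ρ₁ α₁ _ hd hx hF₁ ⟨h₁, h₁'⟩
    have hD₁ : ρ₁ rD = ρ rD := hF₁.reg rD
    have hT : α₁ aTail = α aTail := hF₁.arr _
    have hH : α₁ aHead = α aHead := hF₁.arr _
    have hEd : α₁ aEdge = α aEdge := hF₁.arr _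
    refine Run.loop_uniform 60 (L := 0) (B := ρ rD) (fun d' _ α' =>
      HalfTree G (supp G.m (α' aSet)) (supp G.n (α' aMark)) ∧
        ((supp G.n (α' aMark) = supp G.n (α₁ aMark) ∧ ∀ d₂ < d',
          α aHead d = α aTail d₂ → ¬ Extends G (supp G.n (α₁ aMark)) (α aEdge d) (α aEdge d₂)
            (α aTail d) (α aHead d) (α aHead d₂)) ∨
          (#(supp G.n (α₁ aMark)) < #(supp G.n (α' aMark)) ∧
            ¬ Inextensible G (supp G.n (α₁ aMark)))))
      rfl (Nat.zero_le _) ⟨h₁, .inl ⟨rfl, by simp⟩⟩ rfl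
      (fun i ρ' α' hF _ _ _ => (hF.reg rD).trans hD₁) ?_ ?_
    · rintro d' ρ₂ α₂ _ hd' hx' hF₂ ⟨h₂, h₂'⟩
      have hT₂ : α₂ aTail = α aTail := (hF₂.arr _).trans hT
      have hH₂ : α₂ aHead = α aHead := (hF₂.arr _).trans hH
      have hEd₂ : α₂ aEdge = α aEdge := (hF₂.arr _).trans hEd
      refine (extend_run (d := d) (d' := d') (by rw [hT₂, hH₂, hEd₂]; exact hE.darts.join d hd)
        (by rw [hT₂, hH₂, hEd₂]; exact hE.darts.join d' hd') ((hF₂.reg 29).trans hx) hx' h₂).imp ?_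
      rintro t ρ₃ α₃ _ ⟨ht, h₃, h₃'⟩
      rw [hT₂, hH₂, hEd₂] at h₃'
      refine ⟨ht, h₃, ?_⟩
      obtain ⟨h4, h5⟩ | h4 := h₃' <;> obtain ⟨h6, h7⟩ | h6 := h₂'
      · exact .inl ⟨h4.trans h6, Nat.forall_lt_succ_right.2 ⟨h7, h6 ▸ h5⟩⟩
      · exact .inr (h4 ▸ h6)
      · exact .inr (h6 ▸ h4)
      · exact .inr ⟨h6.1.trans h4.1, h6.2⟩
    · rintro t ρ₂ α₂ _ _ ⟨h₂, h₂'⟩ ht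
      simp only [Exp.cost] at ht
      refine ⟨by omega, h₂, ?_⟩
      obtain ⟨h4, h5⟩ | h4 := h₂' <;> obtain ⟨h6, h7⟩ | h6 := h₁'
      · exact .inl ⟨h4.trans h6, Nat.forall_lt_succ_right.2 ⟨h7, h6 ▸ h5⟩⟩
      · exact .inr (h4 ▸ h6)
      · exact .inr (h6 ▸ h4)
      · exact .inr ⟨h6.1.trans h4.1, h6.2⟩
  · rintro t ρ' α' _ _ ⟨h₁, h₁'⟩ ht
    refine ⟨?_, h₁, ?_⟩
    · simp only [Exp.cost] at ht
      have : (ρ rD - 0) * (2 * G.m * 70 + 10 + 1 + 7) ≤ 2 * G.m * (2 * G.m * 70 + 18) :=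
        Nat.mul_le_mul (by omega) (by omega)
      nlinarith
    · obtain ⟨h2, h3⟩ | h2 := h₁'
      · left
        rw [h2]
        rintro i j a p w ⟨hi, hj, ha, hp, hw⟩
        obtain ⟨d₁, hd₁, rfl, rfl, rfl⟩ := hE.darts.complete _ _ _ hi
        obtain ⟨d₂, hd₂, rfl, h4, rfl⟩ := hE.darts.complete _ _ _ hj
        exact h3 d₁ hd₁ d₂ hd₂ h4.symm ⟨hi, hj, ha, hp, hw⟩
      · have := hV.resolve_left h2.2
        exact .inr (by omega)

theorem approximate_run (hG : G.Admissible) (hI : I.word = G.word) :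
    Run I approximate (fun _ => 0) (fun _ _ => 0) fun t _ α' => t ≤ 2000 * (G.n + G.m) ^ 3 ∧
      G.IsCEDS (supp G.m (α' 0)) ∧ ∀ Y, G.IsCEDS Y → #(supp G.m (α' 0)) + 1 ≤ 3 * #Y := by
  have hm := hG.two_le_m
  have hn := hG.n_pos
  have hm0 : 0 < G.m := by omega
  refine Run.cons (buildDarts_run hI rfl rfl) ?_
  rintro t₁ ρ₁ α₁ hF₁ ⟨ht₁, hE₁⟩
  refine Run.cons (Q₁ := fun t ρ' α' => t = 3 ∧ ρ' = ρ₁ ∧ supp G.m (α' aSet) = {0}) (Run.of_wp ?_) ?_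
  · simp only [wp, Exp.ev, Exp.cost, Function.update_self, supp_update_one hm0, true_and]
    rw [hF₁.arr aSet]
    simp [supp]
  rintro _ ρ₂ α₂ hF₂ ⟨rfl, -, h₂⟩
  have hE₂ := hE₁.of_frame hF₂
  have hs : I.word 2 = G.src ⟨0, hm0⟩ := by rw [hI]; exact GraphInput.word_src hm0
  have hd : I.word 3 = G.dst ⟨0, hm0⟩ := by rw [hI]; exact GraphInput.word_dst hm0
  have hj : G.Joins 0 (I.word 2) (I.word 3) := ⟨hm0, .inl ⟨hs.symm, hd.symm⟩⟩
  refine Run.cons (Q₁ := fun t ρ' α' => t = 4 ∧ supp G.n (α' aMark) = {I.word 2})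
    (Run.of_wp ?_) ?_
  · simp only [wp, Exp.ev, Exp.cost, Function.update_self, supp_update_one hj.lt_left, true_and]
    rw [hF₂.arr aMark, hF₁.arr aMark]
    simp [supp]
  rintro _ ρ₃ α₃ hF₃ ⟨rfl, h₃⟩
  have hE₃ := hE₂.of_frame hF₃
  refine Run.cons (Q₁ := fun t ρ' α' => t = 4 ∧ supp G.n (α' aMark) = {I.word 2, I.word 3})
    (Run.of_wp ?_) ?_
  · simp only [wp, Exp.ev, Exp.cost, Function.update_self, supp_update_one hj.lt_right, true_and, h₃]
    exact pair_comm _ _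
  rintro _ ρ₄ α₄ hF₄ ⟨rfl, h₄⟩
  have hE₄ := hE₃.of_frame hF₄
  rw [← hF₃.arr aSet, ← hF₄.arr aSet] at h₂
  refine Run.cons (Run.loop_uniform (400 * (G.m + 1) ^ 2) (L := 0) (B := G.n) (fun c _ α' =>
    HalfTree G (supp G.m (α' aSet)) (supp G.n (α' aMark)) ∧
      (Inextensible G (supp G.n (α' aMark)) ∨ c < #(supp G.n (α' aMark))))
    (Q := fun t ρ' α' => t ≤ G.n * (400 * (G.m + 1) ^ 2 + 8) + 6 ∧
      HalfTree G (supp G.m (α' aSet)) (supp G.n (α' aMark)) ∧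
      Inextensible G (supp G.n (α' aMark)))
    rfl (Nat.zero_le _) ?_ rfl (fun i ρ' α' hF _ _ _ => (hF.reg rN).trans hE₄.n_eq) ?_ ?_) ?_
  · rw [h₂, h₄]
    exact ⟨.singleton hj, .inr (card_pos.2 ⟨_, mem_insert_self _ _⟩)⟩
  · rintro c ρ₅ α₅ _ _ _ hF₅ ⟨h₅, h₅'⟩
    exact grow_run (hE₄.of_frame hF₅) h₅ rfl rfl h₅'
  · rintro t ρ' α' _ _ ⟨h₅, h₅'⟩ ht
    simp only [Exp.cost] at ht
    refine ⟨by omega, h₅, h₅'.resolve_right fun h => ?_⟩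
    have := card_le_card (supp_subset (m := G.n) (f := α' aMark))
    rw [card_range] at this
    omega
  rintro t₅ ρ₅ α₅ hF₅ ⟨ht₅, h₅, h₅'⟩
  refine Run.cons (copy_run (hE₄.of_frame hF₅) (by decide) (by decide)) ?_
  rintro t₆ ρ₆ α₆ - ⟨ht₆, h₆⟩
  refine Run.nil ?_
  rw [h₆]
  refine ⟨?_, h₅.tree.ceds (h₅.dom hG h₅'), fun Y hY => h₅.card_add_one_le hY (hG.two_le hY)⟩
  have h1 : 200 * (G.n + 1) * (G.m + 1) ≤ 200 * (G.n + G.m) * (G.n + G.m) :=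
    Nat.mul_le_mul (Nat.mul_le_mul_left _ (by omega)) (by omega)
  have h2 : G.n * (400 * (G.m + 1) ^ 2 + 8) ≤ (G.n + G.m) * (400 * (G.n + G.m) ^ 2 + 8) :=
    Nat.mul_le_mul (by omega) (Nat.add_le_add_right (Nat.mul_le_mul_left _
      (Nat.pow_le_pow_left (by omega) _)) _)
  have h3 : G.m ≤ G.n + G.m := by omega
  have h4 : 3 ≤ G.n + G.m := by omega
  generalize G.n + G.m = s at *
  have h5 : t₁ + (3 + (4 + (4 + (t₅ + (t₆ + 1))))) ≤ 200 * s * s + (s * (400 * s ^ 2 + 8)) +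
      20 * s + 28 := by omega
  refine h5.trans ?_
  nlinarith [Nat.mul_le_mul h4 h4, Nat.mul_le_mul_left s h4, Nat.mul_le_mul_left (s ^ 2) h4]

theorem isKBestEnumeration_approximate :
    IsKBestEnumeration (enumerate approximate) 4 (fun n m => 2000 * (n + m) ^ 3) 13000 := by
  refine isKBestEnumeration_enumerate fun G hG => ?_
  obtain ⟨t, ρ, α, ⟨h1, h2, h3⟩, h⟩ := approximate_run (I := ⟨G.word, 0⟩) hG rfl
  refine ⟨_, h 0 [] [], by simpa using h1, h2, fun Y hY => ?_⟩
  have : ((#(supp G.m (α 0)) + 1 : ℕ) : ℝ) ≤ (3 * #Y : ℕ) := Nat.cast_le.2 (h3 Y hY)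
  push_cast at this
  linarith

end RAM

theorem mainTheorem1 :
    ∃ C : ℕ,
      (∀ (c : ℝ) (f : ℕ → ℕ → ℕ) (A : RAM.Cmd), IsApproximationAlgorithm A c f →
        ∃ B : RAM.Cmd, IsKBestEnumeration B (c + 2) f C) ∧
      ∃ (B : RAM.Cmd) (a d : ℕ), IsKBestEnumeration B 4 (fun n m => a * (n + m) ^ d) C :=
  ⟨13000, fun _ _ _ hA => ⟨_, hA.isKBestEnumeration⟩, _, _, _, RAM.isKBestEnumeration_approximate⟩
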